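/- Let $\mathsf{RCA}_0$ be the subsystem of second order arithmetic whose axioms are the basic axioms of arithmetic for $0,1,+,\cdot,<$, induction for $\Sigma^0_1$-formulas and comprehension for $\Delta^0_1$-formulas (number and set parameters allowed), and let $\vdash$ denote derivability in classical two-sorted first-order logic. (1) For $k\in\mathbb N$ let $\mathrm{STAR}_k$ (the Triangle Ramsey theorem for $k$ colours) be the statement: for every colouring $c:[\mathbb N]^2\to\{0,\dots,k-1\}$ there are a colour $i<k$ and a node $t$ such that for infinitely many pairs $m<l$ the triangle $t,m,l$ is homogeneous in colour $i$; precisely, for every $n$ there are $m,l$ with $n<m<l$, $t<m$ and $c(t,m)=c(t,l)=c(m,l)=i$. Then for every standard natural number $k$, $$\mathsf{RCA}_0\vdash \mathrm{STAR}_k .$$ (2) A size-change graph $G:f\to g$ between functions $f,g$, each of which has a finite set of parameters (their number is the arity of the function), is a finite set of arcs $x\xrightarrow{r}y$, with $x$ a parameter of $f$, $y$ a parameter of $g$ and $r\in\{\downarrow,\Downarrow\}$ (strict, non-strict), with at most one arc for given $x,y$. For $G:f\to g$ and $H:g\to h$ the composition $G;H:f\to h$ has the arc $x\xrightarrow{\downarrow}z$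 if there are arcs $x\xrightarrow{r}y$ in $G$ and $y\xrightarrow{r'}z$ in $H$, for some $y$, at least one of which is strict, and the arc $x\xrightarrow{\Downarrow}z$ if there are such arcs and all of them are non-strict. $G$ is idempotent if $G;G=G$, and $\mathsf{cl}(\mathcal G)$ is the smallest set that includes $\mathcal G$ and is closed under composition. A set $\mathcal G$ of size-change graphs is SCT if for every infinite sequence $G_0,G_1,\dots$ in $\mathcal G$ in which the target function of each $G_i$ is the source function of $G_{i+1}$ there are $t$ and parameters $x_0,x_1,\dots$ such that $G_{t+s}$ has an arc from $x_s$ to $x_{s+1}$ for every $s$, and infinitely many of these arcs are strict. Then, for all standard natural numbers $k$ and $n$, $\mathsf{RCA}_0$ proves the SCT criterion for sets of size-change graphs of size bounded by $k$ and $n$: for every set $\mathcal G$ of at most $k$ size-change graphs between functions of arity at most $n$, $$\mathcal G\text{ is SCT}\iff\text{every idempotent } G\in\mathsf{cl}(\mathcal G)\text{ has an arc } x\xrightarrow{\downarrow}x \text{ for some parameter } x .$$ -/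

import Mathlib

namespace SOA

/-! ## The language of second order arithmetic

Two sorts of variables, numbers and sets, each with de Bruijn indices of its own. -/

/-- Number terms. -/
inductive Tm : Type
  | var : ℕ → Tm
  | zero : Tm
  | one : Tm
  | add : Tm → Tm → Tm
  | mul : Tm → Tm → Tm

/-- Formulas of second order arithmetic. `mem t X` says that the number `t` belongs to the set with
index `X`; `all` quantifies over numbers, `allS` over sets. -/
inductive Fm : Type
  | eq : Tm → Tm → Fm
  | lt : Tm → Tm → Fm
  | mem : Tm → ℕ → Fm
  | bot : Fm
  | imp : Fm → Fm → Fm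
  | all : Fm → Fm
  | allS : Fm → Fm

namespace Tm

/-- Simultaneous substitution in terms. -/
def subst (σ : ℕ → Tm) : Tm → Tm
  | var n => σ n
  | zero => zero
  | one => one
  | add t s => add (t.subst σ) (s.subst σ)
  | mul t s => mul (t.subst σ) (s.subst σ)

/-- Shift all number variables of a term by `k` (used to place the term under `k` quantifiers). -/
def up (k : ℕ) (t : Tm) : Tm := t.subst fun n => var (n + k)

/-- The numeral of a standard natural number. -/
def num : ℕ → Tm
  | 0 => zero
  | n + 1 => add (num n) one

/-- The pairing `(a, b) = (a + b)² + a`, which is injective on the natural numbers. -/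
def pair (a b : Tm) : Tm := add (mul (add a b) (add a b)) a

end Tm

/-- A number substitution, moved under one number quantifier. -/
def liftSub (σ : ℕ → Tm) : ℕ → Tm
  | 0 => Tm.var 0
  | n + 1 => (σ n).up 1

/-- A renaming of set variables, moved under one set quantifier. -/
def liftRen (τ : ℕ → ℕ) : ℕ → ℕ
  | 0 => 0
  | n + 1 => τ n + 1

namespace Fm

/-- Capture avoiding simultaneous substitution: terms `σ` for the number variables, set variables
`τ` for the set variables. -/
def subst : (ℕ → Tm) → (ℕ → ℕ) → Fm → Fm
  | σ, _, eq t s => eq (t.subst σ) (s.subst σ)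
  | σ, _, lt t s => lt (t.subst σ) (s.subst σ)
  | σ, τ, mem t X => mem (t.subst σ) (τ X)
  | _, _, bot => bot
  | σ, τ, imp φ ψ => imp (φ.subst σ τ) (ψ.subst σ τ)
  | σ, τ, all φ => all (φ.subst (liftSub σ) τ)
  | σ, τ, allS φ => allS (φ.subst σ (liftRen τ))

/-- Place a formula under one more number quantifier. -/
def lift (φ : Fm) : Fm := φ.subst (fun n => Tm.var (n + 1)) id

/-- Place a formula under one more set quantifier. -/
def liftS (φ : Fm) : Fm := φ.subst Tm.var fun n => n + 1

/-- `φ(t)`: substitute `t` for number variable `0` and lower the other number variables. -/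
def inst (t : Tm) (φ : Fm) : Fm :=
  φ.subst (fun n => match n with
    | 0 => t
    | n + 1 => Tm.var n) id

/-- `φ(X)`: substitute `X` for set variable `0` and lower the other set variables. -/
def instS (X : ℕ) (φ : Fm) : Fm :=
  φ.subst Tm.var fun n => match n with
    | 0 => X
    | n + 1 => n

/-- `φ(n + 1)`, where `n` is number variable `0`, which stays free. -/
def atSucc (φ : Fm) : Fm :=
  φ.subst (fun n => match n with
    | 0 => Tm.add (Tm.var 0) Tm.one
    | n + 1 => Tm.var (n + 1)) id

def neg (φ : Fm) : Fm := imp φ bot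
def and (φ ψ : Fm) : Fm := neg (imp φ (neg ψ))
def or (φ ψ : Fm) : Fm := imp (neg φ) ψ
def iff (φ ψ : Fm) : Fm := and (imp φ ψ) (imp ψ φ)
def ex (φ : Fm) : Fm := neg (all (neg φ))
def exS (φ : Fm) : Fm := neg (allS (neg φ))

end Fm

/-! ## Provability -/

/-- Classical two-sorted natural deduction with equality of numbers. `Derives T Γ φ` says that `φ`
is derivable from the axioms `T` and the open assumptions `Γ`. The free variables of an axiom are
read as universally quantified (the assumptions are lifted in `allI` and `allSI`, the axioms are
not), so `T` stands for the set of the universal closures of its members. -/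
inductive Derives (T : Set Fm) : List Fm → Fm → Prop
  | ax {Γ : List Fm} {φ : Fm} : φ ∈ T → Derives T Γ φ
  | assumption {Γ : List Fm} {φ : Fm} : φ ∈ Γ → Derives T Γ φ
  | impI {Γ : List Fm} {φ ψ : Fm} : Derives T (φ :: Γ) ψ → Derives T Γ (φ.imp ψ)
  | impE {Γ : List Fm} {φ ψ : Fm} : Derives T Γ (φ.imp ψ) → Derives T Γ φ → Derives T Γ ψ
  | raa {Γ : List Fm} {φ : Fm} : Derives T (φ.neg :: Γ) Fm.bot → Derives T Γ φ
  | allI {Γ : List Fm} {φ : Fm} : Derives T (Γ.map Fm.lift) φ → Derives T Γ φ.all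
  | allE {Γ : List Fm} {φ : Fm} (t : Tm) : Derives T Γ φ.all → Derives T Γ (φ.inst t)
  | allSI {Γ : List Fm} {φ : Fm} : Derives T (Γ.map Fm.liftS) φ → Derives T Γ φ.allS
  | allSE {Γ : List Fm} {φ : Fm} (X : ℕ) : Derives T Γ φ.allS → Derives T Γ (φ.instS X)
  | eqRefl {Γ : List Fm} (t : Tm) : Derives T Γ (Fm.eq t t)
  | eqSubst {Γ : List Fm} (φ : Fm) {t s : Tm} :
      Derives T Γ (Fm.eq t s) → Derives T Γ (φ.inst t) → Derives T Γ (φ.inst s)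

/-- `T ⊢ φ`. -/
def Proves (T : Set Fm) (φ : Fm) : Prop := Derives T [] φ

/-! ## The system `RCA₀` -/

open Tm Fm

/-- Formulas all of whose quantifiers are bounded number quantifiers `∀ n < t` (and hence, through
negation, `∃ n < t`), where `n` does not occur in `t`; set variables may occur as parameters. -/
inductive IsBounded : Fm → Prop
  | eq (t s : Tm) : IsBounded (Fm.eq t s)
  | lt (t s : Tm) : IsBounded (Fm.lt t s)
  | mem (t : Tm) (X : ℕ) : IsBounded (Fm.mem t X)
  | bot : IsBounded Fm.bot
  | imp {φ ψ : Fm} : IsBounded φ → IsBounded ψ → IsBounded (φ.imp ψ)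
  | ball (t : Tm) {φ : Fm} : IsBounded φ → IsBounded (all ((Fm.lt (var 0) (t.up 1)).imp φ))

/-- The axioms of `RCA₀`: basic arithmetic, induction for `Σ⁰₁` formulas `∃ m θ`, and comprehension
for `Δ⁰₁` formulas, with arbitrary number and set parameters. -/
inductive RCA0 : Set Fm
  | succ_ne_zero : RCA0 (Fm.eq (add (var 0) one) zero).neg
  | succ_inj : RCA0 ((Fm.eq (add (var 0) one) (add (var 1) one)).imp (Fm.eq (var 0) (var 1)))
  | add_zero : RCA0 (Fm.eq (add (var 0) zero) (var 0))
  | add_succ : RCA0 (Fm.eq (add (var 0) (add (var 1) one)) (add (add (var 0) (var 1)) one))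
  | mul_zero : RCA0 (Fm.eq (mul (var 0) zero) zero)
  | mul_succ : RCA0 (Fm.eq (mul (var 0) (add (var 1) one)) (add (mul (var 0) (var 1)) (var 0)))
  | not_lt_zero : RCA0 (Fm.lt (var 0) zero).neg
  | lt_succ : RCA0 ((Fm.lt (var 0) (add (var 1) one)).iff
      ((Fm.lt (var 0) (var 1)).or (Fm.eq (var 0) (var 1))))
  | induction (θ : Fm) : IsBounded θ →
      RCA0 ((((ex θ).inst zero).and (all ((ex θ).imp (ex θ).atSucc))).imp (all (ex θ)))
  | comprehension (θ η : Fm) : IsBounded θ → IsBounded η →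
      RCA0 ((all ((ex θ).iff (all η))).imp
        (exS (all ((Fm.mem (var 0) 0).iff (ex θ).liftS))))

/-! ## The triangle Ramsey theorem -/

/-- The set `C` is (the graph of) a function from `{(x, y) : x < y}` to `{0, …, k - 1}`. -/
def isColoring (C : ℕ) (k : Tm) : Fm :=
  -- every element of `C` is some `((x, y), i)`
  (all ((Fm.mem (var 0) C).imp
    (ex (ex (ex ((Fm.lt (var 2) (var 1)).and ((Fm.lt (var 0) (k.up 4)).and
      (Fm.eq (var 3) (pair (pair (var 2) (var 1)) (var 0)))))))))).and
  -- every pair has a colour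
  ((all (all ((Fm.lt (var 1) (var 0)).imp
    (ex (Fm.mem (pair (pair (var 2) (var 1)) (var 0)) C))))).and
  -- the colour is unique
  (all (all (all (all (((Fm.mem (pair (pair (var 3) (var 2)) (var 1)) C).and
    (Fm.mem (pair (pair (var 3) (var 2)) (var 0)) C)).imp (Fm.eq (var 1) (var 0))))))))

/-- Triangle Ramsey theorem for `k` colours: every colouring `C` has a colour `i < k` and a node `t`
such that for every `n` there are `m, l` with `n < m < l` and `t < m`, and the triangle `t, m, l`
is homogeneous in colour `i`. -/
def triangleRamsey (k : Tm) : Fm :=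
  allS ((isColoring 0 k).imp
    (ex ((Fm.lt (var 0) (k.up 1)).and
      -- variables: `i = 4`, `t = 3`, `n = 2`, `m = 1`, `l = 0`
      (ex (all (ex (ex ((Fm.lt (var 2) (var 1)).and ((Fm.lt (var 1) (var 0)).and
        ((Fm.lt (var 3) (var 1)).and
        ((Fm.mem (pair (pair (var 3) (var 1)) (var 4)) 0).and
        ((Fm.mem (pair (pair (var 3) (var 0)) (var 4)) 0).and
        (Fm.mem (pair (pair (var 1) (var 0)) (var 4)) 0)))))))))))))

/-! ## Size-change graphs, formalized in second order arithmetic -/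

/-- `i` belongs to the finite set coded by `e`: `e = ((k, m), n)`, `i < k`, and `m (i + 1) + 1`
divides `n`. -/
def memCode (i e : Tm) : Fm :=
  -- variables: `k = 3`, `m = 2`, `n = 1`, quotient `= 0`
  ex (ex (ex (ex ((Fm.eq (e.up 4) (pair (pair (var 3) (var 2)) (var 1))).and
    ((Fm.lt (i.up 4) (var 3)).and
    (Fm.eq (mul (add (mul (var 2) (add (i.up 4) one)) one) (var 0)) (var 1)))))))

/-- `e` is the least code of the finite set that it codes; only such codes are used, so a finite set
has exactly one. -/
def isCode (e : Tm) : Fm :=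
  all ((Fm.lt (var 0) (e.up 1)).imp
    (ex ((memCode (var 0) (var 1)).iff (memCode (var 0) (e.up 2))).neg))

/-- `G` is a size-change graph. A function is a pair `(name, arity)`, and the parameters of a
function of arity `a` are `0, …, a - 1`. A size-change graph with source `(p, a)` and target
`(q, b)` is `(((p, a), (q, b)), e)`, where `e` codes a finite set of arcs. An arc from `x` to `y` is
`((x, r), y)`, with `r = 1` for a strict (decreasing) arc and `r = 0` for a non-strict one; between
two parameters there is at most one arc. -/
def isGraph (G : Tm) : Fm :=
  -- variables: `p = 4`, `a = 3`, `q = 2`, `b = 1`, `e = 0`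
  ex (ex (ex (ex (ex
    ((Fm.eq (G.up 5) (pair (pair (pair (var 4) (var 3)) (pair (var 2) (var 1))) (var 0))).and
    ((isCode (var 0)).and
    -- additional variables: `z = 3`, `x = 2`, `r = 1`, `y = 0`, so that `e = 4`, `b = 5`, `a = 7`
    ((all ((memCode (var 0) (var 1)).imp
      (ex (ex (ex ((Fm.lt (var 2) (var 7)).and
        (((Fm.eq (var 1) zero).or (Fm.eq (var 1) one)).and
        ((Fm.lt (var 0) (var 5)).and
        (Fm.eq (var 3) (pair (pair (var 2) (var 1)) (var 0))))))))))).and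
    -- additional variables: `x = 1`, `y = 0`, so that `e = 2`
    (all (all ((memCode (pair (pair (var 1) zero) (var 0)) (var 2)).and
      (memCode (pair (pair (var 1) one) (var 0)) (var 2))).neg)))))))))

/-- The size-change graph `G` has source function `f` and target function `g`. -/
def hasType (G f g : Tm) : Fm :=
  ex (Fm.eq (G.up 1) (pair (pair (f.up 1) (g.up 1)) (var 0)))

/-- The size-change graph `G` has an arc of kind `r` from `x` to `y`. -/
def arc (G x r y : Tm) : Fm :=
  ex (ex (ex ((Fm.eq (G.up 3) (pair (pair (var 2) (var 1)) (var 0))).and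
    (memCode (pair (pair (x.up 3) (r.up 3)) (y.up 3)) (var 0)))))

/-- The target function of `G` is the source function of `H`. -/
def composable (G H : Tm) : Fm :=
  ex (ex (ex ((hasType (G.up 3) (var 2) (var 1)).and (hasType (H.up 3) (var 1) (var 0)))))

/-- For size-change graphs `G : f → g` and `H : g → h`, the size-change graph `K : f → h` is the
composition `G;H`. -/
def isComp (G H K : Tm) : Fm :=
  (isGraph K).and
  ((ex (ex (ex ((hasType (G.up 3) (var 2) (var 1)).and ((hasType (H.up 3) (var 1) (var 0)).and
    (hasType (K.up 3) (var 2) (var 0))))))).and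
  -- variables: `x = 1`, `z = 0`; below `y` and `r`: `x = 3`, `z = 2`, `y = 1`, `r = 0`
  ((all (all ((arc (K.up 2) (var 1) one (var 0)).iff
    (ex (ex (((arc (G.up 4) (var 3) one (var 1)).and (arc (H.up 4) (var 1) (var 0) (var 2))).or
      ((arc (G.up 4) (var 3) (var 0) (var 1)).and (arc (H.up 4) (var 1) one (var 2))))))))).and
  -- variables: `x = 1`, `z = 0`; below `y`: `x = 2`, `z = 1`, `y = 0`;
  -- below `y`, `r` and `r'`: `x = 4`, `z = 3`, `y = 2`, `r = 1`, `r' = 0`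
  (all (all ((arc (K.up 2) (var 1) zero (var 0)).iff
    ((ex ((arc (G.up 3) (var 2) zero (var 0)).and (arc (H.up 3) (var 0) zero (var 1)))).and
    (all (all (all (((arc (G.up 5) (var 4) (var 1) (var 2)).and
      (arc (H.up 5) (var 2) (var 0) (var 3))).imp
        ((Fm.eq (var 1) zero).and (Fm.eq (var 0) zero))))))))))))

/-- `G` belongs to the closure of the set `S` of size-change graphs under composition, i.e. to the
smallest set that includes `S` and is closed under composition. -/
def inClosure (S : ℕ) (G : Tm) : Fm :=
  allS (((all ((Fm.mem (var 0) (S + 1)).imp (Fm.mem (var 0) 0))).and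
    (all (all (all (((Fm.mem (var 2) 0).and ((Fm.mem (var 1) 0).and
      (isComp (var 2) (var 1) (var 0)))).imp (Fm.mem (var 0) 0)))))).imp
    (Fm.mem G 0))

/-- The set `F` is (the graph of) a function defined on all natural numbers. -/
def isFunction (F : ℕ) : Fm :=
  (all ((Fm.mem (var 0) F).imp (ex (ex (Fm.eq (var 2) (pair (var 1) (var 0))))))).and
  ((all (ex (Fm.mem (pair (var 1) (var 0)) F))).and
  (all (all (all (((Fm.mem (pair (var 2) (var 1)) F).and (Fm.mem (pair (var 2) (var 0)) F)).imp
    (Fm.eq (var 1) (var 0)))))))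

/-- `M` is an infinite multipath all of whose graphs belong to `S`. -/
def isMultipath (S M : ℕ) : Fm :=
  (isFunction M).and
  ((all (all ((Fm.mem (pair (var 1) (var 0)) M).imp (Fm.mem (var 0) S)))).and
  (all (all (all (((Fm.mem (pair (var 2) (var 1)) M).and
    (Fm.mem (pair (add (var 2) one) (var 0)) M)).imp (composable (var 1) (var 0)))))))

/-- The infinite multipath `M` has infinite descent: there are `t` and a thread `H` that passes from
parameter `H s` to parameter `H (s + 1)` along an arc of the graph `M (t + s)`, for every `s`, and
infinitely many of these arcs are strict. -/
def hasDescent (M : ℕ) : Fm :=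
  ex (exS ((isFunction 0).and
    -- variables: `t = 4`, `s = 3`, `x = 2`, `y = 1`, `G = 0`
    ((all (all (all (all (((Fm.mem (pair (var 3) (var 2)) 0).and
      ((Fm.mem (pair (add (var 3) one) (var 1)) 0).and
      (Fm.mem (pair (add (var 4) (var 3)) (var 0)) (M + 1)))).imp
        ((arc (var 0) (var 2) zero (var 1)).or (arc (var 0) (var 2) one (var 1)))))))).and
    -- variables: `t = 5`, `n = 4`, `s = 3`, `x = 2`, `y = 1`, `G = 0`
    (all (ex (ex (ex (ex ((Fm.lt (var 4) (var 3)).and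
      ((Fm.mem (pair (var 3) (var 2)) 0).and
      ((Fm.mem (pair (add (var 3) one) (var 1)) 0).and
      ((Fm.mem (pair (add (var 5) (var 3)) (var 0)) (M + 1)).and
      (arc (var 0) (var 2) one (var 1))))))))))))))

/-- `S` is size-change terminating: every infinite multipath of graphs in `S` has infinite
descent. -/
def isSCT (S : ℕ) : Fm :=
  allS ((isMultipath (S + 1) 0).imp (hasDescent 0))

/-- Every idempotent `G` in the closure of `S` has a strict arc from some parameter `x` to itself. -/
def idempotentsHaveStrictLoop (S : ℕ) : Fm :=
  all (((inClosure S (var 0)).and (isComp (var 0) (var 0) (var 0))).imp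
    (ex (arc (var 1) (var 0) one (var 0))))

/-- The set `S` has at most `k` elements: some `F` injects `S` into `{0, …, k - 1}`. -/
def cardLE (S : ℕ) (k : Tm) : Fm :=
  exS ((all ((Fm.mem (var 0) (S + 1)).imp
      (ex ((Fm.lt (var 0) (k.up 2)).and (Fm.mem (pair (var 1) (var 0)) 0))))).and
    (all (all (all (((Fm.mem (pair (var 2) (var 0)) 0).and
      (Fm.mem (pair (var 1) (var 0)) 0)).imp (Fm.eq (var 2) (var 1)))))))

/-- All source and target functions of the graphs in `S` have arity at most `n`. -/
def aritiesLE (S : ℕ) (n : Tm) : Fm :=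
  -- variables: `G = 4`, `p = 3`, `a = 2`, `q = 1`, `b = 0`
  all (all (all (all (all (((Fm.mem (var 4) S).and
    (hasType (var 4) (pair (var 3) (var 2)) (pair (var 1) (var 0)))).imp
      ((Fm.lt (var 2) (add (n.up 5) one)).and (Fm.lt (var 0) (add (n.up 5) one))))))))

/-- The SCT criterion for graphs, restricted to sets of at most `k` size-change graphs between
functions of arity at most `n`: such a set is size-change terminating if and only if every
idempotent in its closure has a strict arc from some parameter to itself. -/
def sctCriterion (k n : Tm) : Fm :=
  allS (((all ((Fm.mem (var 0) 0).imp (isGraph (var 0)))).and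
    ((cardLE 0 k).and (aritiesLE 0 n))).imp
      ((isSCT 0).iff (idempotentsHaveStrictLoop 0)))

end SOA

/-! By the completeness theorem, proved here by a Henkin construction (`proves_of_forall_sat`), it
suffices to verify both statements in every model of `RCA0`. Such a model is an ordered semiring
`N`, possibly nonstandard, with a family of sets. `Dec` and `Rec` say that a predicate or a function
is given by a set of the model; comprehension yields their closure properties, and codes of finite
sets yield iteration (`exists_iterate`). Since `k` and `n` are standard, the sets of colours,
parameters and graphs that occur are finite in the metatheory. Such sets belong to the model
(`dec_of_finite`), and both the pigeonhole principle for them (`exists_unbounded_fiber`) and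
inductions on their size take place outside the model, so no induction beyond `Σ⁰₁` is needed
inside.

Triangle Ramsey (`exists_star`): let `X` be an unbounded recursive set whose pairs use only colours
from `F`. Take `t` in `X` and a colour `i` that `t` gives to unboundedly many members of `X`. Either
`t` and `i` are as required, or sufficiently far out no pair of these members has colour `i`. In the
second case they form an unbounded recursive set that uses fewer colours.

Strict loops imply termination (`isSCT_of_strict_loops`): colour `s < m` with the composition `c s
m` of the graphs of the path from `s` up to `m`. Homogeneous triangles `t, m, l` of colour `G` give
`G;G = G`, hence a strict loop at some `x`. If `m, l` and `m', l'` complete such triangles and `l <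
m'`, then the common node `t` gives `c m m' = c m l; c l m' = c t l; c l m' = c t m' = G`. So
segments with composition `G` can be chained without end, and a thread that realizes a strict arc
from `x` to `x` through each of them is found by unbounded search.

Termination implies strict loops (`strict_loop_of_isSCT`): write an idempotent `G` as a composition
of a standard finite sequence from the set and repeat this sequence for ever. A descending thread
visits some parameter `x` unboundedly often at the beginning of a period. Two visits with a strict
arc between them give a strict arc from `x` to `x` in a power of `G`, that is, in `G`. The number of
periods may be nonstandard, so this is shown by induction in the model on a predicate with finitely
many states. -/

namespace SOA

/-! ## Substitution -/

/-- Put `a` in front of the sequence `v`. -/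
def cons {α : Type} (a : α) (v : ℕ → α) : ℕ → α
  | 0 => a
  | n + 1 => v n

@[simp] theorem cons_zero {α : Type} (a : α) (v : ℕ → α) : cons a v 0 = a := rfl

@[simp] theorem cons_succ {α : Type} (a : α) (v : ℕ → α) (n : ℕ) : cons a v (n + 1) = v n := rfl

@[simp] theorem liftSub_zero (σ : ℕ → Tm) : liftSub σ 0 = Tm.var 0 := rfl

@[simp] theorem liftSub_succ (σ : ℕ → Tm) (n : ℕ) : liftSub σ (n + 1) = (σ n).up 1 := rfl

@[simp] theorem liftRen_zero (τ : ℕ → ℕ) : liftRen τ 0 = 0 := rfl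

@[simp] theorem liftRen_succ (τ : ℕ → ℕ) (n : ℕ) : liftRen τ (n + 1) = τ n + 1 := rfl

theorem Tm.subst_subst (σ σ' : ℕ → Tm) (t : Tm) :
    (t.subst σ).subst σ' = t.subst fun n => (σ n).subst σ' := by
  induction t <;> simp_all [Tm.subst]

@[simp] theorem Tm.subst_var (t : Tm) : t.subst Tm.var = t := by
  induction t <;> simp_all [Tm.subst]

theorem Tm.subst_up (k : ℕ) (σ : ℕ → Tm) (t : Tm) :
    (t.up k).subst σ = t.subst fun n => σ (n + k) := by
  rw [Tm.up, Tm.subst_subst]; rfl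

@[simp] theorem Tm.subst_cons_up (s : Tm) (t : Tm) : (t.up 1).subst (cons s Tm.var) = t := by
  rw [Tm.subst_up]; exact t.subst_var

theorem liftSub_comp (σ σ' : ℕ → Tm) :
    (fun n => (liftSub σ n).subst (liftSub σ')) = liftSub fun n => (σ n).subst σ' := by
  funext n
  cases n with
  | zero => rfl
  | succ n => simp only [liftSub_succ, Tm.up, Tm.subst_subst]; rfl

@[simp] theorem liftSub_var : liftSub Tm.var = Tm.var := by
  funext n; cases n <;> rfl

@[simp] theorem liftRen_id : liftRen id = id := by
  funext n; cases n <;> rfl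

theorem Fm.subst_subst (φ : Fm) : ∀ (σ σ' : ℕ → Tm) (τ τ' : ℕ → ℕ),
    (φ.subst σ τ).subst σ' τ' = φ.subst (fun n => (σ n).subst σ') fun n => τ' (τ n) := by
  induction φ with
  | eq t s => intros; simp [Fm.subst, Tm.subst_subst]
  | lt t s => intros; simp [Fm.subst, Tm.subst_subst]
  | mem t X => intros; simp [Fm.subst, Tm.subst_subst]
  | bot => intros; rfl
  | imp φ ψ ih₁ ih₂ => intros; simp [Fm.subst, ih₁, ih₂]
  | all φ ih => intros; simp [Fm.subst, ih, liftSub_comp]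
  | allS φ ih =>
    intro σ σ' τ τ'
    simp only [Fm.subst, ih]
    congr 2
    funext n; cases n <;> rfl

@[simp] theorem Fm.subst_id (φ : Fm) : φ.subst Tm.var id = φ := by
  induction φ <;> simp_all [Fm.subst]

theorem Fm.inst_eq (t : Tm) (φ : Fm) : φ.inst t = φ.subst (cons t Tm.var) id := by
  rw [Fm.inst]; congr 1

theorem Fm.instS_eq (X : ℕ) (φ : Fm) : φ.instS X = φ.subst Tm.var (cons X id) := by
  rw [Fm.instS]; congr 1

theorem Fm.subst_inst (φ : Fm) (t : Tm) (σ : ℕ → Tm) (τ : ℕ → ℕ) :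
    (φ.inst t).subst σ τ = φ.subst (cons (t.subst σ) σ) τ := by
  rw [Fm.inst_eq, Fm.subst_subst]
  congr 1; funext n; cases n <;> rfl

theorem Fm.inst_subst (φ : Fm) (t : Tm) (σ : ℕ → Tm) (τ : ℕ → ℕ) :
    (φ.subst (liftSub σ) τ).inst t = φ.subst (cons t σ) τ := by
  rw [Fm.inst_eq, Fm.subst_subst]
  congr 1; funext n; cases n <;> simp [Tm.subst]

theorem Fm.subst_instS (φ : Fm) (X : ℕ) (σ : ℕ → Tm) (τ : ℕ → ℕ) :
    (φ.instS X).subst σ τ = φ.subst σ (cons (τ X) τ) := by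
  rw [Fm.instS_eq, Fm.subst_subst]
  congr 1; funext n; cases n <;> rfl

theorem Fm.instS_subst (φ : Fm) (X : ℕ) (σ : ℕ → Tm) (τ : ℕ → ℕ) :
    (φ.subst σ (liftRen τ)).instS X = φ.subst σ (cons X τ) := by
  rw [Fm.instS_eq, Fm.subst_subst]
  congr 1
  · funext n; simp
  · funext n; cases n <;> rfl

theorem Fm.lift_subst (φ : Fm) (σ : ℕ → Tm) (τ : ℕ → ℕ) :
    φ.lift.subst (liftSub σ) τ = (φ.subst σ τ).lift := by
  simp only [Fm.lift, Fm.subst_subst]; rfl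

theorem Fm.liftS_subst (φ : Fm) (σ : ℕ → Tm) (τ : ℕ → ℕ) :
    φ.liftS.subst σ (liftRen τ) = (φ.subst σ τ).liftS := by
  simp only [Fm.liftS, Fm.subst_subst]
  congr 1; funext n; simp [Tm.subst]

/-- Only finitely many free variables occur in a term. -/
theorem Tm.exists_bound (t : Tm) :
    ∃ K, ∀ σ σ' : ℕ → Tm, (∀ n < K, σ n = σ' n) → t.subst σ = t.subst σ' := by
  induction t with
  | var n => exact ⟨n + 1, fun σ σ' h => h n (by omega)⟩
  | zero => exact ⟨0, fun _ _ _ => rfl⟩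
  | one => exact ⟨0, fun _ _ _ => rfl⟩
  | add t s iht ihs =>
    obtain ⟨K, hK⟩ := iht
    obtain ⟨L, hL⟩ := ihs
    exact ⟨max K L, fun σ σ' h => by
      simp only [Tm.subst, hK σ σ' fun n hn => h n (by omega), hL σ σ' fun n hn => h n (by omega)]⟩
  | mul t s iht ihs =>
    obtain ⟨K, hK⟩ := iht
    obtain ⟨L, hL⟩ := ihs
    exact ⟨max K L, fun σ σ' h => by
      simp only [Tm.subst, hK σ σ' fun n hn => h n (by omega), hL σ σ' fun n hn => h n (by omega)]⟩

/-- Only the variables below some `K` matter for substitutions in `φ`. -/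
def Fm.BoundedBy (φ : Fm) (K : ℕ) : Prop :=
  ∀ (σ σ' : ℕ → Tm) (τ τ' : ℕ → ℕ), (∀ n < K, σ n = σ' n) → (∀ n < K, τ n = τ' n) →
    φ.subst σ τ = φ.subst σ' τ'

theorem Fm.BoundedBy.mono {φ : Fm} {K L : ℕ} (h : φ.BoundedBy K) (hKL : K ≤ L) :
    φ.BoundedBy L := fun σ σ' τ τ' h₁ h₂ =>
  h σ σ' τ τ' (fun n hn => h₁ n (by omega)) fun n hn => h₂ n (by omega)

theorem Fm.exists_boundedBy (φ : Fm) : ∃ K, φ.BoundedBy K := by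
  induction φ with
  | eq t s =>
    obtain ⟨K, hK⟩ := t.exists_bound
    obtain ⟨L, hL⟩ := s.exists_bound
    exact ⟨max K L, fun σ σ' _ _ h _ => by
      simp only [Fm.subst, hK σ σ' fun n hn => h n (by omega), hL σ σ' fun n hn => h n (by omega)]⟩
  | lt t s =>
    obtain ⟨K, hK⟩ := t.exists_bound
    obtain ⟨L, hL⟩ := s.exists_bound
    exact ⟨max K L, fun σ σ' _ _ h _ => by
      simp only [Fm.subst, hK σ σ' fun n hn => h n (by omega), hL σ σ' fun n hn => h n (by omega)]⟩
  | mem t X =>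
    obtain ⟨K, hK⟩ := t.exists_bound
    exact ⟨max K (X + 1), fun σ σ' τ τ' h h' => by
      simp only [Fm.subst, hK σ σ' fun n hn => h n (by omega), h' X (by omega)]⟩
  | bot => exact ⟨0, fun _ _ _ _ _ _ => rfl⟩
  | imp φ ψ ih₁ ih₂ =>
    obtain ⟨K, hK⟩ := ih₁
    obtain ⟨L, hL⟩ := ih₂
    exact ⟨max K L, fun σ σ' τ τ' h h' => by
      simp only [Fm.subst, hK.mono (le_max_left K L) σ σ' τ τ' h h',
        hL.mono (le_max_right K L) σ σ' τ τ' h h']⟩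
  | all φ ih =>
    obtain ⟨K, hK⟩ := ih
    refine ⟨K, fun σ σ' τ τ' h h' => ?_⟩
    simp only [Fm.subst]
    rw [hK (liftSub σ) (liftSub σ') τ τ' (fun n hn => ?_) h']
    cases n with
    | zero => rfl
    | succ n => simp [h n (by omega)]
  | allS φ ih =>
    obtain ⟨K, hK⟩ := ih
    refine ⟨K, fun σ σ' τ τ' h h' => ?_⟩
    simp only [Fm.subst]
    rw [hK σ σ' (liftRen τ) (liftRen τ') h (fun n hn => ?_)]
    cases n with
    | zero => rfl
    | succ n => simp [h' n (by omega)]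

theorem exists_boundedBy_list (Γ : List Fm) : ∃ K, ∀ φ ∈ Γ, φ.BoundedBy K := by
  induction Γ with
  | nil => exact ⟨0, by simp⟩
  | cons φ Γ ih =>
    obtain ⟨K, hK⟩ := ih
    obtain ⟨L, hL⟩ := φ.exists_boundedBy
    refine ⟨max K L, fun ψ hψ => ?_⟩
    rcases List.mem_cons.1 hψ with rfl | h
    · exact hL.mono (le_max_right _ _)
    · exact (hK ψ h).mono (le_max_left _ _)

/-! ## Structural properties of derivations -/

theorem Derives.weaken {T : Set Fm} {Γ : List Fm} {φ : Fm} (h : Derives T Γ φ) :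
    ∀ {Δ : List Fm}, Γ ⊆ Δ → Derives T Δ φ := by
  induction h with
  | ax h => exact fun _ => .ax h
  | assumption h => exact fun hs => .assumption (hs h)
  | impI _ ih => exact fun hs => .impI (ih (List.cons_subset_cons _ hs))
  | impE _ _ ih₁ ih₂ => exact fun hs => .impE (ih₁ hs) (ih₂ hs)
  | raa _ ih => exact fun hs => .raa (ih (List.cons_subset_cons _ hs))
  | allI _ ih => exact fun hs => .allI (ih (List.map_subset _ hs))
  | allE t _ ih => exact fun hs => .allE t (ih hs)
  | allSI _ ih => exact fun hs => .allSI (ih (List.map_subset _ hs))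
  | allSE X _ ih => exact fun hs => .allSE X (ih hs)
  | eqRefl t => exact fun _ => .eqRefl t
  | eqSubst φ _ _ ih₁ ih₂ => exact fun hs => .eqSubst φ (ih₁ hs) (ih₂ hs)

/-- The theorems of `T` are closed under substitution of terms. -/
theorem derives_subst_num {T : Set Fm} {φ : Fm} (h : ∀ Γ, Derives T Γ φ) (σ : ℕ → Tm) :
    ∀ Γ, Derives T Γ (φ.subst σ id) := by
  have key : ∀ (N : ℕ) (φ : Fm) (σ : ℕ → Tm), (∀ Γ, Derives T Γ φ) →
      (∀ j, σ (N + j) = Tm.var j) → ∀ Γ, Derives T Γ (φ.subst σ id) := by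
    intro N
    induction N with
    | zero =>
      intro φ σ h hσ
      have : σ = Tm.var := by funext j; simpa using hσ j
      simpa [this] using h
    | succ N ih =>
      intro φ σ h hσ
      -- Each of the `N` variables still to be replaced lowers the others by one. The term `σ 0` is
      -- therefore shifted by `N` in advance, which also protects its variables from the later
      -- substitutions.
      have := ih (φ.inst ((σ 0).up N)) (fun n => σ (n + 1))
        (fun Γ => .allE _ (.allI (h _))) (fun j => by rw [← hσ j]; congr 1; omega)
      rw [Fm.subst_inst] at this
      convert this using 3
      funext n
      cases n with
      | zero =>
        rw [cons_zero, Tm.subst_up]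
        have e : (fun n => σ (n + N + 1)) = Tm.var := by
          funext j; rw [← hσ j]; congr 1; omega
        rw [e, Tm.subst_var]
      | succ n => rfl
  obtain ⟨K, hK⟩ := φ.exists_boundedBy
  -- Beyond the variables of `φ` the substitution may be changed, so that it has the shape required
  -- by `key`.
  rw [hK σ (fun n => if n < K then σ n else Tm.var (n - K)) id id (fun n hn => by simp [hn])
    fun _ _ => rfl]
  exact key K φ _ h fun j => by simp

/-- The theorems of `T` are closed under substitution of set variables. -/
theorem derives_subst_set {T : Set Fm} {φ : Fm} (h : ∀ Γ, Derives T Γ φ) (τ : ℕ → ℕ) :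
    ∀ Γ, Derives T Γ (φ.subst Tm.var τ) := by
  have key : ∀ (N : ℕ) (φ : Fm) (τ : ℕ → ℕ), (∀ Γ, Derives T Γ φ) →
      (∀ j, τ (N + j) = j) → ∀ Γ, Derives T Γ (φ.subst Tm.var τ) := by
    intro N
    induction N with
    | zero =>
      intro φ τ h hτ
      have : τ = id := by funext j; simpa using hτ j
      simpa [this] using h
    | succ N ih =>
      intro φ τ h hτ
      have := ih (φ.instS (τ 0 + N)) (fun n => τ (n + 1))
        (fun Γ => .allSE _ (.allSI (h _))) (fun j => by
          have := hτ j; rwa [show N + 1 + j = N + j + 1 by omega] at this)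
      rw [Fm.subst_instS] at this
      convert this using 3
      funext n
      cases n with
      | zero =>
        have := hτ (τ 0)
        rw [cons_zero, show τ 0 + N + 1 = N + 1 + τ 0 by omega, this]
      | succ n => rfl
  obtain ⟨K, hK⟩ := φ.exists_boundedBy
  rw [hK Tm.var Tm.var τ (fun n => if n < K then τ n else n - K) (fun _ _ => rfl)
    (fun n hn => by simp [hn])]
  exact key K φ _ h fun j => by simp

theorem derives_subst_of_ax {T : Set Fm} {φ : Fm} (h : φ ∈ T) (σ : ℕ → Tm) (τ : ℕ → ℕ)
    (Γ : List Fm) : Derives T Γ (φ.subst σ τ) := by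
  have h₁ : ∀ Γ, Derives T Γ (φ.subst Tm.var τ) := derives_subst_set (fun Γ => .ax h) τ
  have h₂ := derives_subst_num h₁ σ Γ
  rw [Fm.subst_subst] at h₂
  exact h₂

/-- The axiom case holds although `T` need not be closed under substitution: an axiom is derivable
from every list of assumptions, so it can be generalized and then instantiated. -/
theorem Derives.subst {T : Set Fm} {Γ : List Fm} {φ : Fm} (h : Derives T Γ φ) :
    ∀ (σ : ℕ → Tm) (τ : ℕ → ℕ), Derives T (Γ.map (Fm.subst σ τ)) (φ.subst σ τ) := by
  induction h with
  | ax h => exact fun σ τ => derives_subst_of_ax h σ τ _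
  | assumption h => exact fun σ τ => .assumption (List.mem_map_of_mem h)
  | impI _ ih => exact fun σ τ => .impI (ih σ τ)
  | impE _ _ ih₁ ih₂ => exact fun σ τ => .impE (ih₁ σ τ) (ih₂ σ τ)
  | raa _ ih => exact fun σ τ => .raa (ih σ τ)
  | allI _ ih =>
    intro σ τ
    refine .allI ?_
    have := ih (liftSub σ) τ
    rw [List.map_map] at this ⊢
    convert this using 2
    funext φ
    exact (φ.lift_subst σ τ).symm
  | @allE Γ φ t _ ih =>
    intro σ τ
    have := (ih σ τ).allE (t.subst σ)
    rwa [Fm.inst_subst, ← Fm.subst_inst] at this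
  | allSI _ ih =>
    intro σ τ
    refine .allSI ?_
    have := ih σ (liftRen τ)
    rw [List.map_map] at this ⊢
    convert this using 2
    funext φ
    exact (φ.liftS_subst σ τ).symm
  | @allSE Γ φ X _ ih =>
    intro σ τ
    have := (ih σ τ).allSE (τ X)
    rwa [Fm.instS_subst, ← Fm.subst_instS] at this
  | eqRefl t => exact fun σ τ => .eqRefl _
  | @eqSubst Γ φ t s _ _ ih₁ ih₂ =>
    intro σ τ
    have h₂ := ih₂ σ τ
    rw [Fm.subst_inst, ← Fm.inst_subst] at h₂
    have := Derives.eqSubst _ (ih₁ σ τ) h₂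
    rwa [Fm.inst_subst, ← Fm.subst_inst] at this

/-- Generalization over a variable that does not occur. -/
theorem Derives.all_of_fresh {T : Set Fm} {Γ : List Fm} {φ : Fm} {K : ℕ}
    (hΓ : ∀ ψ ∈ Γ, ψ.BoundedBy K) (hφ : φ.BoundedBy K)
    (h : Derives T Γ (φ.inst (Tm.var K))) : Derives T Γ φ.all := by
  -- This renaming moves the fresh variable `K` into the position to be quantified. On the
  -- assumptions, in which `K` does not occur, it acts as `Fm.lift`.
  have h' := h.subst (fun n => if n = K then Tm.var 0 else Tm.var (n + 1)) id
  refine .allI ?_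
  have e : Γ.map (Fm.subst (fun n => if n = K then Tm.var 0 else Tm.var (n + 1)) id) =
      Γ.map Fm.lift :=
    List.map_congr_left fun ψ hψ => hΓ ψ hψ _ _ _ _ (fun n hn => by simp [hn.ne]) fun _ _ => rfl
  rw [e, Fm.subst_inst, hφ _ Tm.var _ id (fun n hn => ?_) fun _ _ => rfl, Fm.subst_id] at h'
  · exact h'
  · cases n with
    | zero => simp [Tm.subst]
    | succ n => simp [show n ≠ K by omega]

theorem Derives.allS_of_fresh {T : Set Fm} {Γ : List Fm} {φ : Fm} {K : ℕ}
    (hΓ : ∀ ψ ∈ Γ, ψ.BoundedBy K) (hφ : φ.BoundedBy K)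
    (h : Derives T Γ (φ.instS K)) : Derives T Γ φ.allS := by
  have h' := h.subst Tm.var (fun n => if n = K then 0 else n + 1)
  refine .allSI ?_
  have e : Γ.map (Fm.subst Tm.var (fun n => if n = K then 0 else n + 1)) =
      Γ.map Fm.liftS :=
    List.map_congr_left fun ψ hψ => hΓ ψ hψ _ _ _ _ (fun _ _ => rfl) fun n hn => by simp [hn.ne]
  rw [e, Fm.subst_instS, hφ _ Tm.var _ id (fun _ _ => rfl) (fun n hn => ?_), Fm.subst_id] at h'
  · exact h'
  · cases n with
    | zero => simp
    | succ n => simp [show n ≠ K by omega]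

/-! ## Completeness -/

/-- An injective coding of terms. -/
def Tm.code : Tm → ℕ
  | Tm.var n => Nat.pair 0 n
  | Tm.zero => Nat.pair 1 0
  | Tm.one => Nat.pair 2 0
  | Tm.add t s => Nat.pair 3 (Nat.pair t.code s.code)
  | Tm.mul t s => Nat.pair 4 (Nat.pair t.code s.code)

theorem Tm.code_injective : Function.Injective Tm.code := by
  intro t
  induction t with
  | var n => intro s h; cases s <;> simp_all [Tm.code, Nat.pair_eq_pair]
  | zero => intro s h; cases s <;> simp_all [Tm.code, Nat.pair_eq_pair]
  | one => intro s h; cases s <;> simp_all [Tm.code, Nat.pair_eq_pair]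
  | add t₁ t₂ ih₁ ih₂ =>
    intro s h
    cases s <;> simp [Tm.code, Nat.pair_eq_pair] at h
    rw [ih₁ h.1, ih₂ h.2]
  | mul t₁ t₂ ih₁ ih₂ =>
    intro s h
    cases s <;> simp [Tm.code, Nat.pair_eq_pair] at h
    rw [ih₁ h.1, ih₂ h.2]

/-- An injective coding of formulas. -/
def Fm.code : Fm → ℕ
  | Fm.eq t s => Nat.pair 0 (Nat.pair t.code s.code)
  | Fm.lt t s => Nat.pair 1 (Nat.pair t.code s.code)
  | Fm.mem t X => Nat.pair 2 (Nat.pair t.code X)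
  | Fm.bot => Nat.pair 3 0
  | Fm.imp φ ψ => Nat.pair 4 (Nat.pair φ.code ψ.code)
  | Fm.all φ => Nat.pair 5 φ.code
  | Fm.allS φ => Nat.pair 6 φ.code

theorem Fm.code_injective : Function.Injective Fm.code := by
  intro φ
  induction φ with
  | eq t s =>
    intro ψ h
    cases ψ <;> simp [Fm.code, Nat.pair_eq_pair] at h
    rw [Tm.code_injective h.1, Tm.code_injective h.2]
  | lt t s =>
    intro ψ h
    cases ψ <;> simp [Fm.code, Nat.pair_eq_pair] at h
    rw [Tm.code_injective h.1, Tm.code_injective h.2]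
  | mem t X =>
    intro ψ h
    cases ψ <;> simp [Fm.code, Nat.pair_eq_pair] at h
    rw [Tm.code_injective h.1, h.2]
  | bot => intro ψ h; cases ψ <;> simp_all [Fm.code, Nat.pair_eq_pair]
  | imp φ₁ φ₂ ih₁ ih₂ =>
    intro ψ h
    cases ψ <;> simp [Fm.code, Nat.pair_eq_pair] at h
    rw [ih₁ h.1, ih₂ h.2]
  | all φ ih =>
    intro ψ h
    cases ψ <;> simp [Fm.code, Nat.pair_eq_pair] at h
    rw [ih h]
  | allS φ ih =>
    intro ψ h
    cases ψ <;> simp [Fm.code, Nat.pair_eq_pair] at h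
    rw [ih h]

instance : Countable Fm := Fm.code_injective.countable

instance : Nonempty Fm := ⟨Fm.bot⟩

theorem Derives.negE {T : Set Fm} {Γ : List Fm} {φ : Fm} (h : Derives T Γ φ.neg)
    (h' : Derives T Γ φ) : Derives T Γ Fm.bot := .impE h h'

theorem Derives.cut {T : Set Fm} {Γ : List Fm} {φ ψ : Fm} (h : Derives T Γ φ)
    (h' : Derives T (φ :: Γ) ψ) : Derives T Γ ψ := .impE (.impI h') h

/-- `Δ` decides the formula `ψ`, with a counterexample in case `ψ` is universal and refuted. -/
def DecidesWithWitness (Δ : List Fm) (ψ : Fm) : Prop :=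
  ψ ∈ Δ ∨ (ψ.neg ∈ Δ ∧ (∀ χ, ψ = Fm.all χ → ∃ t, (χ.inst t).neg ∈ Δ) ∧
    ∀ χ, ψ = Fm.allS χ → ∃ X, (χ.instS X).neg ∈ Δ)

/-- A finite list leaves variables unused, and an unused variable serves as the counterexample to a
refuted universal formula. No new constants are needed. -/
theorem exists_extension {T : Set Fm} {Γ : List Fm} (hΓ : ¬ Derives T Γ Fm.bot) (ψ : Fm) :
    ∃ Δ, ¬ Derives T Δ Fm.bot ∧ Γ ⊆ Δ ∧ DecidesWithWitness Δ ψ := by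
  by_cases h : Derives T (ψ :: Γ) Fm.bot
  · have hn : Derives T Γ ψ.neg := .impI h
    have hcon : ¬ Derives T (ψ.neg :: Γ) Fm.bot := fun h' => hΓ (hn.cut h')
    obtain ⟨K, hK⟩ := exists_boundedBy_list (ψ.neg :: Γ)
    by_cases hall : ∃ χ, ψ = Fm.all χ
    · obtain ⟨χ, rfl⟩ := hall
      obtain ⟨L, hL⟩ := χ.exists_boundedBy
      refine ⟨(χ.inst (Tm.var (max K L))).neg :: (Fm.all χ).neg :: Γ, fun h' => ?_,
        fun x hx => by simp [hx], Or.inr ⟨by simp, ?_, by simp⟩⟩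
      · refine hcon (.negE (φ := Fm.all χ) (.assumption (by simp)) ?_)
        exact .all_of_fresh (K := max K L) (fun ψ hψ => (hK ψ hψ).mono (le_max_left _ _))
          (hL.mono (le_max_right _ _)) (.raa h')
      · rintro χ' h'
        cases h'
        exact ⟨_, List.mem_cons_self⟩
    by_cases hallS : ∃ χ, ψ = Fm.allS χ
    · obtain ⟨χ, rfl⟩ := hallS
      obtain ⟨L, hL⟩ := χ.exists_boundedBy
      refine ⟨(χ.instS (max K L)).neg :: (Fm.allS χ).neg :: Γ, fun h' => ?_,
        fun x hx => by simp [hx], Or.inr ⟨by simp, by simp, ?_⟩⟩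
      · refine hcon (.negE (φ := Fm.allS χ) (.assumption (by simp)) ?_)
        exact .allS_of_fresh (K := max K L) (fun ψ hψ => (hK ψ hψ).mono (le_max_left _ _))
          (hL.mono (le_max_right _ _)) (.raa h')
      · rintro χ' h'
        cases h'
        exact ⟨_, List.mem_cons_self⟩
    exact ⟨ψ.neg :: Γ, hcon, List.subset_cons_self _ _, Or.inr ⟨by simp,
      fun χ h => (hall ⟨χ, h⟩).elim, fun χ h => (hallS ⟨χ, h⟩).elim⟩⟩
  · exact ⟨ψ :: Γ, h, List.subset_cons_self _ _, Or.inl (by simp)⟩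

/-- Maximal consistent sets with witnesses. -/
structure IsHenkin (T H : Set Fm) : Prop where
  closed {L : List Fm} {ψ : Fm} : (∀ χ ∈ L, χ ∈ H) → Derives T L ψ → ψ ∈ H
  bot_notMem : Fm.bot ∉ H
  neg_mem {ψ : Fm} : ψ ∉ H → ψ.neg ∈ H
  exists_inst {χ : Fm} : Fm.all χ ∉ H → ∃ t, χ.inst t ∉ H
  exists_instS {χ : Fm} : Fm.allS χ ∉ H → ∃ X, χ.instS X ∉ H

/-- Lindenbaum's construction along an enumeration of the countably many formulas. A derivation uses
a finite list of assumptions, all of which appear at some stage, so the union of the chain stays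
consistent. -/
theorem exists_isHenkin {T : Set Fm} {Γ : List Fm} (hΓ : ¬ Derives T Γ Fm.bot) :
    ∃ H, IsHenkin T H ∧ ∀ φ ∈ Γ, φ ∈ H := by
  obtain ⟨e, he⟩ := exists_surjective_nat Fm
  choose F hF₁ hF₂ hF₃ using fun (Γ : {Γ : List Fm // ¬ Derives T Γ Fm.bot}) (ψ : Fm) =>
    exists_extension Γ.2 ψ
  let chain : ℕ → {Γ : List Fm // ¬ Derives T Γ Fm.bot} := fun n =>
    Nat.rec ⟨Γ, hΓ⟩ (fun n Δ => ⟨F Δ (e n), hF₁ Δ (e n)⟩) n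
  have hmono : ∀ m n, m ≤ n → (chain m).1 ⊆ (chain n).1 := by
    intro m n hmn
    induction hmn with
    | refl => exact fun _ h => h
    | step _ ih => exact fun x hx => hF₂ _ _ (ih hx)
  have hdec : ∀ ψ, ∃ n, DecidesWithWitness (chain n).1 ψ := by
    intro ψ
    obtain ⟨n, rfl⟩ := he ψ
    exact ⟨n + 1, hF₃ (chain n) (e n)⟩
  set H : Set Fm := {ψ | ∃ n, ψ ∈ (chain n).1} with hH
  have hfin : ∀ L : List Fm, (∀ χ ∈ L, χ ∈ H) → ∃ n, L ⊆ (chain n).1 := by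
    intro L
    induction L with
    | nil => exact fun _ => ⟨0, by simp⟩
    | cons χ L ih =>
      intro h
      obtain ⟨n, hn⟩ := ih fun χ' h' => h χ' (by simp [h'])
      obtain ⟨m, hm⟩ := h χ (by simp)
      refine ⟨max m n, fun x hx => ?_⟩
      rcases List.mem_cons.1 hx with rfl | hx
      · exact hmono _ _ (le_max_left _ _) hm
      · exact hmono _ _ (le_max_right _ _) (hn hx)
  have hcon : ∀ L : List Fm, (∀ χ ∈ L, χ ∈ H) → ¬ Derives T L Fm.bot := by
    intro L hL h
    obtain ⟨n, hn⟩ := hfin L hL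
    exact (chain n).2 (h.weaken hn)
  have hboth : ∀ ψ : Fm, ψ ∈ H → ψ.neg ∉ H := fun ψ h h' =>
    hcon [ψ.neg, ψ] (by simp [h, h'])
      (.negE (φ := ψ) (.assumption (by simp)) (.assumption (by simp)))
  refine ⟨H, ⟨?_, ?_, ?_, ?_, ?_⟩, fun φ hφ => ⟨0, hφ⟩⟩
  · intro L ψ hL h
    obtain ⟨n, hn⟩ := hdec ψ
    rcases hn with hn | hn
    · exact ⟨n, hn⟩
    · exact (hcon (ψ.neg :: L)
        (by intro χ hχ; rcases List.mem_cons.1 hχ with rfl | hχ; exacts [⟨n, hn.1⟩, hL χ hχ])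
        (.negE (φ := ψ) (.assumption (by simp)) (h.weaken (List.subset_cons_self _ _)))).elim
  · exact fun h => hcon [Fm.bot] (by simpa using h) (.assumption (by simp))
  · intro ψ h
    obtain ⟨n, hn | hn⟩ := hdec ψ
    · exact (h ⟨n, hn⟩).elim
    · exact ⟨n, hn.1⟩
  · intro χ h
    obtain ⟨n, hn | hn⟩ := hdec χ.all
    · exact (h ⟨n, hn⟩).elim
    · obtain ⟨t, ht⟩ := hn.2.1 χ rfl
      exact ⟨t, fun h' => hboth _ h' ⟨n, ht⟩⟩
  · intro χ h
    obtain ⟨n, hn | hn⟩ := hdec χ.allS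
    · exact (h ⟨n, hn⟩).elim
    · obtain ⟨t, ht⟩ := hn.2.2 χ rfl
      exact ⟨t, fun h' => hboth _ h' ⟨n, ht⟩⟩

/-! ### Tarski semantics of the two-sorted language -/

section Semantics

variable {N S : Type} [Zero N] [One N] [Add N] [Mul N] [LT N]

/-- The value of a term. -/
def Tm.eval (v : ℕ → N) : Tm → N
  | Tm.var n => v n
  | Tm.zero => 0
  | Tm.one => 1
  | Tm.add t s => t.eval v + s.eval v
  | Tm.mul t s => t.eval v * s.eval v

/-- Satisfaction in the structure with numbers `N` and sets `S`. -/
def Fm.Sat (mem : N → S → Prop) : (ℕ → N) → (ℕ → S) → Fm → Prop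
  | v, _, Fm.eq t s => t.eval v = s.eval v
  | v, _, Fm.lt t s => t.eval v < s.eval v
  | v, w, Fm.mem t X => mem (t.eval v) (w X)
  | _, _, Fm.bot => False
  | v, w, Fm.imp φ ψ => φ.Sat mem v w → ψ.Sat mem v w
  | v, w, Fm.all φ => ∀ a, φ.Sat mem (cons a v) w
  | v, w, Fm.allS φ => ∀ A, φ.Sat mem v (cons A w)

end Semantics

/-! ### The term model of a Henkin set -/

section TermModel

variable {T H : Set Fm}

theorem IsHenkin.imp_mem_iff (hH : IsHenkin T H) {φ ψ : Fm} : φ.imp ψ ∈ H ↔ (φ ∈ H → ψ ∈ H) := by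
  constructor
  · intro h h'
    exact hH.closed (L := [φ.imp ψ, φ]) (by simp [h, h'])
      (.impE (φ := φ) (.assumption (by simp)) (.assumption (by simp)))
  · intro h
    by_cases hφ : φ ∈ H
    · exact hH.closed (L := [ψ]) (by simp [h hφ]) (.impI (.assumption (by simp)))
    · exact hH.closed (L := [φ.neg]) (by simp [hH.neg_mem hφ])
        (.impI (.raa (.negE (φ := φ) (.assumption (by simp)) (.assumption (by simp)))))

theorem IsHenkin.all_mem_iff (hH : IsHenkin T H) {φ : Fm} : φ.all ∈ H ↔ ∀ t, φ.inst t ∈ H := by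
  constructor
  · intro h t
    exact hH.closed (L := [φ.all]) (by simp [h]) (.allE t (.assumption (by simp)))
  · intro h
    by_contra h'
    obtain ⟨t, ht⟩ := hH.exists_inst h'
    exact ht (h t)

theorem IsHenkin.allS_mem_iff (hH : IsHenkin T H) {φ : Fm} : φ.allS ∈ H ↔ ∀ X, φ.instS X ∈ H := by
  constructor
  · intro h t
    exact hH.closed (L := [φ.allS]) (by simp [h]) (.allSE t (.assumption (by simp)))
  · intro h
    by_contra h'
    obtain ⟨t, ht⟩ := hH.exists_instS h'
    exact ht (h t)

theorem IsHenkin.eq_refl (hH : IsHenkin T H) (t : Tm) : Fm.eq t t ∈ H :=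
  hH.closed (L := []) (by simp) (.eqRefl t)

theorem IsHenkin.eq_subst (hH : IsHenkin T H) {t s : Tm} (φ : Fm) (h : Fm.eq t s ∈ H) (h' : φ.inst t ∈ H) :
    φ.inst s ∈ H :=
  hH.closed (L := [Fm.eq t s, φ.inst t]) (by simp [h, h'])
    (.eqSubst φ (t := t) (.assumption (by simp)) (.assumption (by simp)))

theorem IsHenkin.eq_symm (hH : IsHenkin T H) {t s : Tm} (h : Fm.eq t s ∈ H) : Fm.eq s t ∈ H := by
  have := hH.eq_subst (Fm.eq (Tm.var 0) (t.up 1)) h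
  simp only [Fm.inst_eq, Fm.subst, Tm.subst_cons_up, Tm.subst, cons_zero] at this
  exact this (hH.eq_refl t)

theorem IsHenkin.eq_trans (hH : IsHenkin T H) {t s r : Tm} (h : Fm.eq t s ∈ H) (h' : Fm.eq s r ∈ H) :
    Fm.eq t r ∈ H := by
  have := hH.eq_subst (Fm.eq (t.up 1) (Tm.var 0)) h'
  simp only [Fm.inst_eq, Fm.subst, Tm.subst_cons_up, Tm.subst, cons_zero] at this
  exact this h

/-- Provable equality of terms. -/
def termSetoid (hH : IsHenkin T H) : Setoid Tm where
  r t s := Fm.eq t s ∈ H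
  iseqv := ⟨hH.eq_refl, hH.eq_symm, hH.eq_trans⟩

/-- The numbers of the term model. -/
def TermModel (hH : IsHenkin T H) : Type := Quotient (termSetoid hH)

/-- The value of a term in the term model. -/
def TermModel.mk (hH : IsHenkin T H) (t : Tm) : TermModel hH := Quotient.mk _ t

theorem TermModel.mk_eq_mk (hH : IsHenkin T H) {t s : Tm} :
    TermModel.mk hH t = TermModel.mk hH s ↔ Fm.eq t s ∈ H := Quotient.eq (r := termSetoid hH)

theorem TermModel.exists_mk (hH : IsHenkin T H) (a : TermModel hH) :
    ∃ t, TermModel.mk hH t = a := Quotient.exists_rep a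

theorem IsHenkin.mem_congr (hH : IsHenkin T H) {t s : Tm} {X : ℕ} (h : Fm.eq t s ∈ H) (h' : Fm.mem t X ∈ H) :
    Fm.mem s X ∈ H := by
  have := hH.eq_subst (Fm.mem (Tm.var 0) X) h
  simp only [Fm.inst_eq, Fm.subst, Tm.subst, cons_zero] at this
  exact this h'

theorem IsHenkin.lt_congr (hH : IsHenkin T H) {t t' s s' : Tm} (h : Fm.eq t t' ∈ H) (h' : Fm.eq s s' ∈ H)
    (h'' : Fm.lt t s ∈ H) : Fm.lt t' s' ∈ H := by
  have h₁ := hH.eq_subst (Fm.lt (Tm.var 0) (s.up 1)) h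
  have h₂ := hH.eq_subst (Fm.lt (t'.up 1) (Tm.var 0)) h'
  simp only [Fm.inst_eq, Fm.subst, Tm.subst_cons_up, Tm.subst, cons_zero] at h₁ h₂
  exact h₂ (h₁ h'')

theorem IsHenkin.congr_op (hH : IsHenkin T H) {t t' s s' : Tm} (P : Tm → Tm → Tm)
    (hP : ∀ t s σ, (P t s).subst σ = P (t.subst σ) (s.subst σ))
    (h : Fm.eq t t' ∈ H) (h' : Fm.eq s s' ∈ H) : Fm.eq (P t s) (P t' s') ∈ H := by
  have h₁ := hH.eq_subst (Fm.eq ((P t s).up 1) (P (Tm.var 0) (s.up 1))) h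
  have h₂ := hH.eq_subst (Fm.eq ((P t s).up 1) (P (t'.up 1) (Tm.var 0))) h'
  simp only [Fm.inst_eq, Fm.subst, hP, Tm.subst_cons_up, Tm.subst, cons_zero] at h₁ h₂
  exact h₂ (h₁ (hH.eq_refl _))

instance (hH : IsHenkin T H) : Zero (TermModel hH) := ⟨TermModel.mk hH Tm.zero⟩

instance (hH : IsHenkin T H) : One (TermModel hH) := ⟨TermModel.mk hH Tm.one⟩

instance (hH : IsHenkin T H) : Add (TermModel hH) := ⟨Quotient.map₂ Tm.add fun _ _ h _ _ h' =>
  hH.congr_op Tm.add (fun _ _ _ => rfl) h h'⟩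

instance (hH : IsHenkin T H) : Mul (TermModel hH) := ⟨Quotient.map₂ Tm.mul fun _ _ h _ _ h' =>
  hH.congr_op Tm.mul (fun _ _ _ => rfl) h h'⟩

instance (hH : IsHenkin T H) : LT (TermModel hH) := ⟨Quotient.lift₂ (fun t s => Fm.lt t s ∈ H) fun _ _ _ _ h h' =>
  propext ⟨hH.lt_congr h h', hH.lt_congr (hH.eq_symm h) (hH.eq_symm h')⟩⟩

/-- Membership in the term model, whose sets are the set variables. -/
def TermModel.mem (hH : IsHenkin T H) : TermModel hH → ℕ → Prop :=
  Quotient.lift (fun t X => Fm.mem t X ∈ H) fun _ _ h => funext fun _ =>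
    propext ⟨hH.mem_congr h, hH.mem_congr (hH.eq_symm h)⟩

theorem TermModel.eval_mk (hH : IsHenkin T H) (σ : ℕ → Tm) (t : Tm) :
    t.eval (fun n => TermModel.mk hH (σ n)) = TermModel.mk hH (t.subst σ) := by
  induction t with
  | var n => rfl
  | zero => rfl
  | one => rfl
  | add t s iht ihs => simp only [Tm.eval, iht, ihs]; rfl
  | mul t s iht ihs => simp only [Tm.eval, iht, ihs]; rfl

/-- The truth lemma. It is stated for all substitutions because an assignment in the term model is a
substitution up to provable equality; the quantifier cases extend `σ` and `τ` by one value and use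
the witnesses in `H`. -/
theorem TermModel.sat_iff (hH : IsHenkin T H) (φ : Fm) : ∀ (σ : ℕ → Tm) (τ : ℕ → ℕ),
    φ.Sat (TermModel.mem hH) (fun n => TermModel.mk hH (σ n)) τ ↔
      φ.subst σ τ ∈ H := by
  induction φ with
  | eq t s =>
    intro σ τ
    simp only [Fm.Sat, TermModel.eval_mk, TermModel.mk_eq_mk, Fm.subst]
  | lt t s => intro σ τ; simp only [Fm.Sat, TermModel.eval_mk]; rfl
  | mem t X => intro σ τ; simp only [Fm.Sat, TermModel.eval_mk]; rfl
  | bot => intro σ τ; simp only [Fm.Sat, Fm.subst, hH.bot_notMem]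
  | imp φ ψ ih₁ ih₂ => intro σ τ; simp only [Fm.Sat, Fm.subst, ih₁, ih₂, hH.imp_mem_iff]
  | all φ ih =>
    intro σ τ
    have key : ∀ t, φ.Sat (TermModel.mem hH)
        (cons (TermModel.mk hH t) fun n => TermModel.mk hH (σ n)) τ ↔
          φ.subst (cons t σ) τ ∈ H := by
      intro t
      rw [← ih]
      have : (cons (TermModel.mk hH t) fun n => TermModel.mk hH (σ n)) =
          fun n => TermModel.mk hH (cons t σ n) := by funext n; cases n <;> rfl
      rw [this]
    simp only [Fm.Sat, Fm.subst, hH.all_mem_iff, Fm.inst_subst]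
    exact ⟨fun h t => (key t).1 (h _), fun h a => by
      obtain ⟨t, rfl⟩ := TermModel.exists_mk hH a
      exact (key t).2 (h t)⟩
  | allS φ ih => intro σ τ; simp only [Fm.Sat, Fm.subst, hH.allS_mem_iff, Fm.instS_subst, ih]

end TermModel

/-- Completeness: what holds in all structures that satisfy the universal closures of the members
of `T` is provable in `T`. -/
theorem proves_of_forall_sat {T : Set Fm} {φ : Fm}
    (h : ∀ (N S : Type) [Zero N] [One N] [Add N] [Mul N] [LT N] (mem : N → S → Prop),
      (∀ ψ ∈ T, ∀ v w, ψ.Sat mem v w) → ∀ v w, φ.Sat mem v w) : Proves T φ := by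
  by_contra hφ
  have hcon : ¬ Derives T [φ.neg] Fm.bot := fun h' => hφ (.raa h')
  obtain ⟨H, hH, hmem⟩ := exists_isHenkin hcon
  -- An axiom must hold under every assignment, that is, all of its substitution instances must lie
  -- in `H`; they do, being theorems of `T`.
  have hsat := h (TermModel hH) ℕ (TermModel.mem hH) (fun ψ hψ v w => by
    choose σ hσ using fun n => TermModel.exists_mk hH (v n)
    obtain rfl : (fun n => TermModel.mk hH (σ n)) = v := funext hσ
    exact (TermModel.sat_iff hH ψ σ w).2
      (hH.closed (L := []) (by simp) (derives_subst_of_ax hψ σ w [])))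
    (fun n => TermModel.mk hH (Tm.var n)) id
  have h₁ := (TermModel.sat_iff hH φ Tm.var id).1 hsat
  rw [Fm.subst_id] at h₁
  exact hH.bot_notMem (hH.imp_mem_iff.1 (hmem φ.neg (by simp)) h₁)

/-! ## Structures that satisfy `RCA₀` -/

section SatLemmas

variable {N S : Type} [Zero N] [One N] [Add N] [Mul N] [LT N] {mem : N → S → Prop}

theorem Tm.eval_subst (σ : ℕ → Tm) (v : ℕ → N) (t : Tm) :
    (t.subst σ).eval v = t.eval fun n => (σ n).eval v := by
  induction t <;> simp_all [Tm.subst, Tm.eval]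

theorem Tm.eval_up (k : ℕ) (v : ℕ → N) (t : Tm) :
    (t.up k).eval v = t.eval fun n => v (n + k) := Tm.eval_subst _ v t

theorem Fm.sat_subst (φ : Fm) : ∀ (σ : ℕ → Tm) (τ : ℕ → ℕ) (v : ℕ → N) (w : ℕ → S),
    (φ.subst σ τ).Sat mem v w ↔ φ.Sat mem (fun n => (σ n).eval v) fun n => w (τ n) := by
  induction φ with
  | eq t s => intros; simp only [Fm.subst, Fm.Sat, Tm.eval_subst]
  | lt t s => intros; simp only [Fm.subst, Fm.Sat, Tm.eval_subst]
  | mem t X => intros; simp only [Fm.subst, Fm.Sat, Tm.eval_subst]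
  | bot => intros; rfl
  | imp φ ψ ih₁ ih₂ => intros; simp only [Fm.subst, Fm.Sat, ih₁, ih₂]
  | all φ ih =>
    intro σ τ v w
    have : ∀ a, (fun n => (liftSub σ n).eval (cons a v)) = cons a fun n => (σ n).eval v := by
      intro a; funext n
      cases n with
      | zero => rfl
      | succ n => simp only [liftSub_succ, Tm.eval_up]; rfl
    simp only [Fm.subst, Fm.Sat, ih, this]
  | allS φ ih =>
    intro σ τ v w
    have : ∀ A, (fun n => cons A w (liftRen τ n)) = cons A fun n => w (τ n) := by
      intro A; funext n; cases n <;> rfl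
    simp only [Fm.subst, Fm.Sat, ih, this]

variable {v : ℕ → N} {w : ℕ → S}

@[simp] theorem sat_eq {t s : Tm} : (Fm.eq t s).Sat mem v w ↔ t.eval v = s.eval v := Iff.rfl

@[simp] theorem sat_lt {t s : Tm} : (Fm.lt t s).Sat mem v w ↔ t.eval v < s.eval v := Iff.rfl

@[simp] theorem sat_mem {t : Tm} {X : ℕ} : (Fm.mem t X).Sat mem v w ↔ mem (t.eval v) (w X) :=
  Iff.rfl

@[simp] theorem sat_bot : Fm.bot.Sat mem v w ↔ False := Iff.rfl

@[simp] theorem sat_imp {φ ψ : Fm} :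
    (φ.imp ψ).Sat mem v w ↔ (φ.Sat mem v w → ψ.Sat mem v w) := Iff.rfl

@[simp] theorem sat_all {φ : Fm} : φ.all.Sat mem v w ↔ ∀ a, φ.Sat mem (cons a v) w := Iff.rfl

@[simp] theorem sat_allS {φ : Fm} : φ.allS.Sat mem v w ↔ ∀ A, φ.Sat mem v (cons A w) := Iff.rfl

@[simp] theorem sat_neg {φ : Fm} : φ.neg.Sat mem v w ↔ ¬ φ.Sat mem v w := Iff.rfl

@[simp] theorem sat_and {φ ψ : Fm} :
    (φ.and ψ).Sat mem v w ↔ φ.Sat mem v w ∧ ψ.Sat mem v w := by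
  simp [Fm.and]

@[simp] theorem sat_or {φ ψ : Fm} :
    (φ.or ψ).Sat mem v w ↔ φ.Sat mem v w ∨ ψ.Sat mem v w := by
  simp only [Fm.or, sat_imp, sat_neg]; tauto

@[simp] theorem sat_iff {φ ψ : Fm} :
    (φ.iff ψ).Sat mem v w ↔ (φ.Sat mem v w ↔ ψ.Sat mem v w) := by
  simp only [Fm.iff, sat_imp, sat_and]; tauto

@[simp] theorem sat_ex {φ : Fm} : φ.ex.Sat mem v w ↔ ∃ a, φ.Sat mem (cons a v) w := by
  simp [Fm.ex]

@[simp] theorem sat_exS {φ : Fm} : φ.exS.Sat mem v w ↔ ∃ A, φ.Sat mem v (cons A w) := by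
  simp [Fm.exS]

@[simp] theorem eval_var {n : ℕ} : (Tm.var n).eval v = v n := rfl

@[simp] theorem eval_zero : Tm.zero.eval v = 0 := rfl

@[simp] theorem eval_one : Tm.one.eval v = 1 := rfl

@[simp] theorem eval_add {t s : Tm} : (Tm.add t s).eval v = t.eval v + s.eval v := rfl

@[simp] theorem eval_mul {t s : Tm} : (Tm.mul t s).eval v = t.eval v * s.eval v := rfl

end SatLemmas

/-- The axioms of `RCA₀`, read in a structure. -/
structure SatisfiesRCA0 {N S : Type} [Zero N] [One N] [Add N] [Mul N] [LT N]
    (mem : N → S → Prop) : Prop where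
  nonempty : Nonempty S
  succ_ne_zero (a : N) : a + 1 ≠ 0
  succ_inj {a b : N} : a + 1 = b + 1 → a = b
  add_zero (a : N) : a + 0 = a
  add_succ (a b : N) : a + (b + 1) = a + b + 1
  mul_zero (a : N) : a * 0 = 0
  mul_succ (a b : N) : a * (b + 1) = a * b + a
  not_lt_zero (a : N) : ¬ a < 0
  lt_succ (a b : N) : a < b + 1 ↔ a < b ∨ a = b
  induction {θ : Fm} (hθ : IsBounded θ) (v : ℕ → N) (w : ℕ → S)
    (zero : ∃ m, θ.Sat mem (cons m (cons 0 v)) w)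
    (succ : ∀ a, (∃ m, θ.Sat mem (cons m (cons a v)) w) →
      ∃ m, θ.Sat mem (cons m (cons (a + 1) v)) w) (a : N) : ∃ m, θ.Sat mem (cons m (cons a v)) w
  comprehension {θ η : Fm} (hθ : IsBounded θ) (hη : IsBounded η) (v : ℕ → N) (w : ℕ → S)
    (h : ∀ a, (∃ m, θ.Sat mem (cons m (cons a v)) w) ↔ ∀ m, η.Sat mem (cons m (cons a v)) w) :
    ∃ X, ∀ a, mem a X ↔ ∃ m, θ.Sat mem (cons m (cons a v)) w

theorem satisfiesRCA0 {N S : Type} [Zero N] [One N] [Add N] [Mul N] [LT N] {mem : N → S → Prop}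
    [hS : Nonempty S] (h : ∀ ψ ∈ RCA0, ∀ v w, ψ.Sat mem v w) : SatisfiesRCA0 mem := by
  obtain ⟨A⟩ := hS
  have inst_sat : ∀ (φ : Fm) (t : Tm) (v : ℕ → N) (w : ℕ → S),
      (φ.inst t).Sat mem v w ↔ φ.Sat mem (cons (t.eval v) v) w := by
    intro φ t v w
    rw [Fm.inst_eq, Fm.sat_subst]
    have : (fun n => (cons t Tm.var n).eval v) = cons (t.eval v) v := by
      funext n; cases n <;> rfl
    rw [this]; rfl
  have succ_sat : ∀ (φ : Fm) (a : N) (v : ℕ → N) (w : ℕ → S),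
      φ.atSucc.Sat mem (cons a v) w ↔ φ.Sat mem (cons (a + 1) v) w := by
    intro φ a v w
    rw [Fm.atSucc, Fm.sat_subst]
    refine iff_of_eq (congrArg₂ (fun v w => φ.Sat mem v w) ?_ rfl)
    funext n; cases n <;> rfl
  have liftS_sat : ∀ (φ : Fm) (v : ℕ → N) (X : S) (w : ℕ → S),
      φ.liftS.Sat mem v (cons X w) ↔ φ.Sat mem v w := fun φ v X w => Fm.sat_subst _ _ _ _ _
  refine ⟨⟨A⟩, fun a => ?_, fun {a b} => ?_, fun a => ?_, fun a b => ?_, fun a => ?_, fun a b => ?_,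
    fun a => ?_, fun a b => ?_, fun {θ} hθ v w => ?_, fun {θ η} hθ hη v w => ?_⟩
  · exact h _ RCA0.succ_ne_zero (fun _ => a) fun _ => A
  · exact h _ RCA0.succ_inj (cons a fun _ => b) fun _ => A
  · exact h _ RCA0.add_zero (fun _ => a) fun _ => A
  · exact h _ RCA0.add_succ (cons a fun _ => b) fun _ => A
  · exact h _ RCA0.mul_zero (fun _ => a) fun _ => A
  · exact h _ RCA0.mul_succ (cons a fun _ => b) fun _ => A
  · exact h _ RCA0.not_lt_zero (fun _ => a) fun _ => A
  · simpa using h _ RCA0.lt_succ (cons a fun _ => b) fun _ => A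
  · simpa [inst_sat, succ_sat] using h _ (RCA0.induction θ hθ) v w
  · simpa [liftS_sat] using h _ (RCA0.comprehension θ η hθ hη) v w

/-! ### Arithmetic from the axioms -/

namespace SatisfiesRCA0

variable {N S : Type} [Zero N] [One N] [Add N] [Mul N] [LT N] {mem : N → S → Prop}

/-- Induction for bounded formulas, as `Σ⁰₁` induction with a dummy witness. In `θ`, variable `0` is
the dummy, variable `1` the induction variable, and the parameters start at variable `2`. -/
theorem induction_open (h : SatisfiesRCA0 mem) {θ : Fm} (hθ : IsBounded θ) (v : ℕ → N) (P : N → Prop)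
    (hP : ∀ m a w, θ.Sat mem (cons m (cons a v)) w ↔ P a) (zero : P 0)
    (succ : ∀ a, P a → P (a + 1)) (a : N) : P a := by
  obtain ⟨A⟩ := h.nonempty
  obtain ⟨m, hm⟩ := h.induction hθ v (fun _ => A) ⟨0, (hP _ _ _).2 zero⟩
    (fun a ⟨m, hm⟩ => ⟨m, (hP _ _ _).2 (succ a ((hP _ _ _).1 hm))⟩) a
  exact (hP _ _ _).1 hm

open Tm Fm

theorem zero_add (h : SatisfiesRCA0 mem) (a : N) : 0 + a = a :=
  h.induction_open (.eq (add zero (var 1)) (var 1)) (fun _ => 0) (fun a => 0 + a = a)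
    (fun _ _ _ => Iff.rfl) (h.add_zero 0) (fun a ih => by rw [h.add_succ, ih]) a

theorem succ_add (h : SatisfiesRCA0 mem) (a b : N) : a + 1 + b = a + b + 1 :=
  h.induction_open (.eq (add (add (var 2) one) (var 1)) (add (add (var 2) (var 1)) one))
    (fun _ => a) (fun b => a + 1 + b = a + b + 1)
    (fun _ _ _ => Iff.rfl) (by rw [h.add_zero, h.add_zero])
    (fun b ih => by rw [h.add_succ, ih, h.add_succ]) b

theorem add_comm (h : SatisfiesRCA0 mem) (a b : N) : a + b = b + a :=
  h.induction_open (.eq (add (var 2) (var 1)) (add (var 1) (var 2)))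
    (fun _ => a) (fun b => a + b = b + a)
    (fun _ _ _ => Iff.rfl) (by rw [h.add_zero, h.zero_add])
    (fun b ih => by rw [h.add_succ, ih, h.succ_add]) b

theorem add_assoc (h : SatisfiesRCA0 mem) (a b c : N) : a + b + c = a + (b + c) :=
  h.induction_open (.eq (add (add (var 2) (var 3)) (var 1)) (add (var 2) (add (var 3) (var 1))))
    (cons a fun _ => b) (fun c => a + b + c = a + (b + c))
    (fun _ _ _ => Iff.rfl) (by rw [h.add_zero, h.add_zero])
    (fun c ih => by rw [h.add_succ, ih, h.add_succ, h.add_succ]) c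

theorem zero_mul (h : SatisfiesRCA0 mem) (a : N) : 0 * a = 0 :=
  h.induction_open (.eq (mul zero (var 1)) zero) (fun _ => 0) (fun a => 0 * a = 0)
    (fun _ _ _ => Iff.rfl) (h.mul_zero 0) (fun a ih => by rw [h.mul_succ, ih, h.add_zero]) a

theorem succ_mul (h : SatisfiesRCA0 mem) (a b : N) : (a + 1) * b = a * b + b :=
  h.induction_open (.eq (mul (add (var 2) one) (var 1)) (add (mul (var 2) (var 1)) (var 1)))
    (fun _ => a) (fun b => (a + 1) * b = a * b + b)
    (fun _ _ _ => Iff.rfl) (by rw [h.mul_zero, h.mul_zero, h.add_zero])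
    (fun b ih => by
      rw [h.mul_succ, ih, h.mul_succ, h.add_succ (a * b + b), h.add_succ (a * b + a),
        h.add_assoc _ b a, h.add_comm b a, ← h.add_assoc]) b

theorem mul_comm (h : SatisfiesRCA0 mem) (a b : N) : a * b = b * a :=
  h.induction_open (.eq (mul (var 2) (var 1)) (mul (var 1) (var 2)))
    (fun _ => a) (fun b => a * b = b * a)
    (fun _ _ _ => Iff.rfl) (by rw [h.mul_zero, h.zero_mul])
    (fun b ih => by rw [h.mul_succ, ih, h.succ_mul]) b

theorem mul_add (h : SatisfiesRCA0 mem) (a b c : N) : a * (b + c) = a * b + a * c :=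
  h.induction_open
    (.eq (mul (var 2) (add (var 3) (var 1))) (add (mul (var 2) (var 3)) (mul (var 2) (var 1))))
    (cons a fun _ => b) (fun c => a * (b + c) = a * b + a * c)
    (fun _ _ _ => Iff.rfl) (by rw [h.add_zero, h.mul_zero, h.add_zero])
    (fun c ih => by rw [h.add_succ, h.mul_succ, ih, h.mul_succ, h.add_assoc]) c

theorem mul_assoc (h : SatisfiesRCA0 mem) (a b c : N) : a * b * c = a * (b * c) :=
  h.induction_open (.eq (mul (mul (var 2) (var 3)) (var 1)) (mul (var 2) (mul (var 3) (var 1))))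
    (cons a fun _ => b) (fun c => a * b * c = a * (b * c))
    (fun _ _ _ => Iff.rfl) (by rw [h.mul_zero, h.mul_zero, h.mul_zero])
    (fun c ih => by rw [h.mul_succ, ih, h.mul_succ, h.mul_add]) c

theorem mul_one (h : SatisfiesRCA0 mem) (a : N) : a * 1 = a := by
  have := h.mul_succ a 0
  rwa [h.zero_add, h.mul_zero, h.zero_add] at this

theorem add_right_cancel (h : SatisfiesRCA0 mem) {a b c : N} : a + c = b + c → a = b :=
  h.induction_open (.imp (.eq (add (var 2) (var 1)) (add (var 3) (var 1))) (.eq (var 2) (var 3)))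
    (cons a fun _ => b) (fun c => a + c = b + c → a = b)
    (fun _ _ _ => Iff.rfl) (by rw [h.add_zero, h.add_zero]; exact id)
    (fun c ih e => ih (h.succ_inj (by rwa [← h.add_succ, ← h.add_succ]))) c

theorem eq_zero_or_succ (h : SatisfiesRCA0 mem) (a : N) : a = 0 ∨ ∃ b, a = b + 1 := by
  obtain ⟨A⟩ := h.nonempty
  obtain ⟨m, hm⟩ := h.induction
    (.imp (.imp (.eq (var 1) zero) .bot) (.eq (var 1) (add (var 0) one))) (fun _ => 0) (fun _ => A)
    ⟨0, fun h => (h rfl).elim⟩ (fun a _ => ⟨a, fun _ => rfl⟩) a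
  by_cases ha : a = 0
  · exact Or.inl ha
  · exact Or.inr ⟨m, hm ha⟩

theorem lt_add_succ (h : SatisfiesRCA0 mem) (a b : N) : a < a + (b + 1) :=
  h.induction_open (.lt (var 2) (add (var 2) (add (var 1) one)))
    (fun _ => a) (fun b => a < a + (b + 1))
    (fun _ _ _ => Iff.rfl) (by rw [h.zero_add, h.lt_succ]; exact Or.inr rfl)
    (fun b ih => by rw [h.add_succ a (b + 1), h.lt_succ]; exact Or.inl ih) b

theorem lt_iff (h : SatisfiesRCA0 mem) (a b : N) : a < b ↔ ∃ c, b = a + (c + 1) := by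
  refine ⟨fun hab => ?_, fun ⟨c, hc⟩ => hc ▸ h.lt_add_succ a c⟩
  obtain ⟨A⟩ := h.nonempty
  -- Induction on `b` for `∃ m, (a < b → b = a + (m + 1))`, where the witness is the predecessor of
  -- the difference.
  obtain ⟨m, hm⟩ := h.induction
    (.imp (.lt (var 2) (var 1)) (.eq (var 1) (add (var 2) (add (var 0) one)))) (fun _ => a)
    (fun _ => A)
    ⟨0, fun h' => (h.not_lt_zero _ h').elim⟩ (fun b ⟨m, hm⟩ => by
      by_cases hab : a < b
      · exact ⟨m + 1, fun _ => by
          have e : b = a + (m + 1) := hm hab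
          show b + 1 = a + (m + 1 + 1)
          rw [h.add_succ a (m + 1), ← e]⟩
      · refine ⟨0, fun h' => ?_⟩
        rcases (h.lt_succ a b).1 h' with h' | rfl
        · exact (hab h').elim
        · show a + 1 = a + (0 + 1)
          rw [h.zero_add]) b
  exact ⟨m, hm hab⟩

theorem trichotomy (h : SatisfiesRCA0 mem) (a b : N) : a < b ∨ a = b ∨ b < a := by
  have key := h.induction_open
    (.imp (.imp (.lt (var 2) (var 1)) .bot) (.imp (.imp (.eq (var 2) (var 1)) .bot)
      (.lt (var 1) (var 2))))
    (fun _ => a) (fun b => ¬ a < b → ¬ a = b → b < a)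
    (fun _ _ _ => Iff.rfl) (fun _ h₂ => by
      rcases h.eq_zero_or_succ a with rfl | ⟨c, rfl⟩
      · exact (h₂ rfl).elim
      · have := h.lt_add_succ 0 c
        rwa [h.zero_add] at this)
    (fun b ih h₁ h₂ => by
      rw [h.lt_succ, not_or] at h₁
      obtain ⟨c, rfl⟩ := (h.lt_iff b a).1 (ih h₁.1 h₁.2)
      rcases h.eq_zero_or_succ c with rfl | ⟨d, rfl⟩
      · rw [h.zero_add] at h₂
        exact (h₂ rfl).elim
      · exact (h.lt_iff _ _).2 ⟨d, by rw [h.add_succ b (d + 1), h.succ_add]⟩) b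
  tauto

theorem lt_irrefl (h : SatisfiesRCA0 mem) (a : N) : ¬ a < a := by
  intro h'
  obtain ⟨c, hc⟩ := (h.lt_iff a a).1 h'
  refine h.succ_ne_zero c (h.add_right_cancel (c := a) ?_)
  rw [h.zero_add, h.add_comm]; exact hc.symm

theorem lt_trans (h : SatisfiesRCA0 mem) {a b c : N} (h₁ : a < b) (h₂ : b < c) : a < c := by
  obtain ⟨d, rfl⟩ := (h.lt_iff _ _).1 h₁
  obtain ⟨e, rfl⟩ := (h.lt_iff _ _).1 h₂
  exact (h.lt_iff _ _).2 ⟨d + 1 + e, by rw [h.add_assoc, h.add_succ (d + 1)]⟩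

end SatisfiesRCA0

/-- Models of `RCA₀` as ordered semirings. -/
class Model (N : Type) extends CommSemiring N, LinearOrder N, IsStrictOrderedRing N,
    CanonicallyOrderedAdd N where
  /-- The sets of the model. -/
  Sets : Type
  /-- Membership. -/
  mem : N → Sets → Prop
  satisfies : SatisfiesRCA0 mem

/-- A structure that satisfies `RCA₀` is an ordered semiring. -/
noncomputable abbrev SatisfiesRCA0.toModel {N S : Type} [Zero N] [One N] [Add N] [Mul N] [LT N]
    {mem : N → S → Prop} (h : SatisfiesRCA0 mem) : Model N :=
  letI : CommSemiring N :=
    { zero_add := h.zero_add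
      add_zero := h.add_zero
      add_comm := h.add_comm
      add_assoc := h.add_assoc
      zero_mul := h.zero_mul
      mul_zero := h.mul_zero
      mul_one := h.mul_one
      one_mul := fun a => by rw [h.mul_comm, h.mul_one]
      mul_comm := h.mul_comm
      mul_assoc := h.mul_assoc
      left_distrib := h.mul_add
      right_distrib := fun a b c => by rw [h.mul_comm, h.mul_add, h.mul_comm c, h.mul_comm c]
      nsmul := nsmulRec }
  letI : LinearOrder N :=
    { le := fun a b => a < b ∨ a = b
      lt := fun a b => a < b
      le_refl := fun a => Or.inr rfl
      le_trans := by
        rintro a b c (h₁ | rfl) (h₂ | rfl)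
        · exact Or.inl (h.lt_trans h₁ h₂)
        · exact Or.inl h₁
        · exact Or.inl h₂
        · exact Or.inr rfl
      lt_iff_le_not_ge := fun a b => by
        constructor
        · intro h₁
          refine ⟨Or.inl h₁, ?_⟩
          rintro (h₂ | rfl)
          · exact h.lt_irrefl _ (h.lt_trans h₁ h₂)
          · exact h.lt_irrefl _ h₁
        · rintro ⟨h₁ | rfl, h₂⟩
          · exact h₁
          · exact (h₂ (Or.inr rfl)).elim
      le_antisymm := by
        rintro a b (h₁ | rfl) (h₂ | h₂)
        · exact (h.lt_irrefl _ (h.lt_trans h₁ h₂)).elim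
        · exact h₂.symm
        · rfl
        · rfl
      le_total := fun a b => by
        rcases h.trichotomy a b with h' | h' | h'
        · exact Or.inl (Or.inl h')
        · exact Or.inl (Or.inr h')
        · exact Or.inr (Or.inl h')
      toDecidableLE := Classical.decRel _ }
  have hle : ∀ a b : N, a ≤ b ↔ ∃ c, b = a + c := fun a b => by
    constructor
    · rintro (h' | rfl)
      · obtain ⟨c, hc⟩ := (h.lt_iff _ _).1 h'
        exact ⟨_, hc⟩
      · exact ⟨0, (h.add_zero _).symm⟩
    · rintro ⟨c, rfl⟩
      rcases h.eq_zero_or_succ c with rfl | ⟨d, rfl⟩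
      · exact Or.inr (h.add_zero _).symm
      · exact Or.inl (h.lt_add_succ _ _)
  have hadd : ∀ a b c : N, a + b ≤ a + c → b ≤ c := fun a b c h' => by
    obtain ⟨d, hd⟩ := (hle _ _).1 h'
    refine (hle _ _).2 ⟨d, h.add_right_cancel (c := a) ?_⟩
    rw [h.add_comm, hd, h.add_comm _ a, h.add_assoc]
  have hmul : ∀ a b c : N, 0 < a → b < c → a * b < a * c := fun a b c ha hb => by
    obtain ⟨d, rfl⟩ := (h.lt_iff _ _).1 hb
    obtain ⟨e, rfl⟩ := (h.lt_iff _ _).1 ha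
    refine (h.lt_iff _ _).2 ⟨(e + 1) * d + e, ?_⟩
    ring
  letI : IsStrictOrderedRing N :=
    { add_le_add_left := fun a b hab c => by
        obtain ⟨d, rfl⟩ := (hle _ _).1 hab
        exact (hle _ _).2 ⟨d, by ring⟩
      le_of_add_le_add_left := hadd
      zero_le_one := (hle _ _).2 ⟨1, (h.zero_add 1).symm⟩
      exists_pair_ne := ⟨0, 1, fun e => h.succ_ne_zero 0 (by rw [h.zero_add, e])⟩
      mul_lt_mul_of_pos_left := fun a ha b c hb => hmul _ _ _ ha hb
      mul_lt_mul_of_pos_right := fun a ha b c hb => by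
        show b * a < c * a
        rw [h.mul_comm b, h.mul_comm c]; exact hmul _ _ _ ha hb }
  { exists_add_of_le := fun {a b} hab => (hle a b).1 hab
    le_add_self := fun a b => (hle _ _).2 ⟨b, h.add_comm _ _⟩
    le_self_add := fun a b => (hle _ _).2 ⟨b, rfl⟩
    Sets := S
    mem := mem
    satisfies := h }

/-! ## Recursive predicates and functions of a model -/

section Pairing

variable {N : Type} [Model N]

/-- The pairing function. -/
def pr (a b : N) : N := (a + b) * (a + b) + a

@[simp] theorem eval_pair (v : ℕ → N) (t s : Tm) :
    (Tm.pair t s).eval v = pr (t.eval v) (s.eval v) := rfl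

theorem lt_add_one_iff' {a b : N} : a < b + 1 ↔ a ≤ b := by
  rw [le_iff_lt_or_eq]; exact Model.satisfies.lt_succ a b

theorem add_one_le_iff' {a b : N} : a + 1 ≤ b ↔ a < b := by
  rw [← not_lt, lt_add_one_iff', not_le]

theorem left_le_pr (a b : N) : a ≤ pr a b := le_add_self

theorem le_self_mul_self (a : N) : a ≤ a * a := by
  rcases eq_or_ne a 0 with rfl | h
  · simp
  · have : 0 + 1 ≤ a := add_one_le_iff'.2 (pos_iff_ne_zero.2 h)
    rw [zero_add] at this
    exact le_mul_of_one_le_left zero_le this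

theorem right_le_pr (a b : N) : b ≤ pr a b :=
  calc b ≤ a + b := le_add_self
    _ ≤ (a + b) * (a + b) := le_self_mul_self _
    _ ≤ pr a b := le_self_add

/-- The value `pr a b` lies between the consecutive squares of `a + b` and `a + b + 1`, so the pair
determines `a + b` and then `a`. -/
theorem pr_lt_of_add_lt {a b c d : N} (h : a + b < c + d) : pr a b < pr c d := by
  have h' := add_one_le_iff'.2 h
  calc pr a b ≤ (a + b) * (a + b) + (a + b) := by
        unfold pr; gcongr; exact le_self_add
    _ < (a + b) * (a + b) + (a + b) + (a + b + 1) :=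
        lt_add_of_pos_right _ (lt_add_one_iff'.2 zero_le)
    _ = (a + b + 1) * (a + b + 1) := by ring
    _ ≤ (c + d) * (c + d) := mul_le_mul' h' h'
    _ ≤ pr c d := le_self_add

theorem pr_inj {a b c d : N} : pr a b = pr c d ↔ a = c ∧ b = d := by
  refine ⟨fun h => ?_, by rintro ⟨rfl, rfl⟩; rfl⟩
  rcases lt_trichotomy (a + b) (c + d) with h' | h' | h'
  · exact ((pr_lt_of_add_lt h').ne h).elim
  · unfold pr at h
    rw [h'] at h
    have hac := add_left_cancel h
    subst hac
    exact ⟨rfl, add_left_cancel h'⟩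
  · exact ((pr_lt_of_add_lt h').ne' h).elim

open Classical in
/-- The components of a pair. -/
noncomputable def unpr (z : N) : N × N :=
  if h : ∃ p : N × N, pr p.1 p.2 = z then h.choose else (0, 0)

/-- The first component. -/
noncomputable def fst (z : N) : N := (unpr z).1

/-- The second component. -/
noncomputable def snd (z : N) : N := (unpr z).2

theorem unpr_pr (a b : N) : unpr (pr a b) = (a, b) := by
  have h : ∃ p : N × N, pr p.1 p.2 = pr a b := ⟨(a, b), rfl⟩
  rw [unpr, dif_pos h]
  exact Prod.ext (pr_inj.1 h.choose_spec).1 (pr_inj.1 h.choose_spec).2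

@[simp] theorem fst_pr (a b : N) : fst (pr a b) = a := by rw [fst, unpr_pr]

@[simp] theorem snd_pr (a b : N) : snd (pr a b) = b := by rw [snd, unpr_pr]

theorem exists_pr_or (z : N) :
    (∃ a b, z = pr a b) ∨ ((¬ ∃ a b, z = pr a b) ∧ fst z = 0 ∧ snd z = 0) := by
  by_cases h : ∃ a b, z = pr a b
  · exact Or.inl h
  · have h' : ¬ ∃ p : N × N, pr p.1 p.2 = z := fun ⟨p, hp⟩ => h ⟨p.1, p.2, hp.symm⟩
    refine Or.inr ⟨h, ?_⟩
    simp [fst, snd, unpr, dif_neg h']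

/-- A predicate is recursive if it is given by a set of the model. -/
class Dec (P : N → Prop) : Prop where
  out : ∃ X : Model.Sets N, ∀ x, Model.mem x X ↔ P x

/-- A function is recursive if its graph is given by a set of the model. -/
class Rec (f : N → N) : Prop where
  out : ∃ X : Model.Sets N, ∀ x y, Model.mem (pr x y) X ↔ y = f x

end Pairing

/-! ### Bounded quantifiers and bounded formulas -/

section BoundedFormulas

/-- Bounded universal quantification. -/
def Fm.ball (t : Tm) (φ : Fm) : Fm := Fm.all ((Fm.lt (Tm.var 0) (t.up 1)).imp φ)

/-- Bounded existential quantification. -/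
def Fm.bex (t : Tm) (φ : Fm) : Fm := (Fm.ball t φ.neg).neg

theorem IsBounded.neg {φ : Fm} (h : IsBounded φ) : IsBounded φ.neg := .imp h .bot

theorem IsBounded.and {φ ψ : Fm} (h : IsBounded φ) (h' : IsBounded ψ) : IsBounded (φ.and ψ) :=
  (IsBounded.imp h h'.neg).neg

theorem IsBounded.or {φ ψ : Fm} (h : IsBounded φ) (h' : IsBounded ψ) : IsBounded (φ.or ψ) :=
  IsBounded.imp h.neg h'

theorem IsBounded.bex {φ : Fm} (t : Tm) (h : IsBounded φ) : IsBounded (φ.bex t) :=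
  (IsBounded.ball t h.neg).neg

variable {N S : Type} [Zero N] [One N] [Add N] [Mul N] [LT N] {mem : N → S → Prop}
  {v : ℕ → N} {w : ℕ → S}

@[simp] theorem sat_ball {t : Tm} {φ : Fm} :
    (φ.ball t).Sat mem v w ↔ ∀ a < t.eval v, φ.Sat mem (cons a v) w := by
  simp only [Fm.ball, sat_all, sat_imp, sat_lt, Tm.eval_up]; rfl

@[simp] theorem sat_bex {t : Tm} {φ : Fm} :
    (φ.bex t).Sat mem v w ↔ ∃ a < t.eval v, φ.Sat mem (cons a v) w := by
  simp [Fm.bex]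

end BoundedFormulas

/-! ### Closure properties of recursive predicates and functions -/

section Closure

variable {N : Type} [Model N]

theorem dec_of_sigma_pi {θ η : Fm} (hθ : IsBounded θ) (hη : IsBounded η) (v : ℕ → N)
    (w : ℕ → Model.Sets N) {P : N → Prop}
    (h₁ : ∀ x, P x ↔ ∃ m, θ.Sat Model.mem (cons m (cons x v)) w)
    (h₂ : ∀ x, P x ↔ ∀ m, η.Sat Model.mem (cons m (cons x v)) w) : Dec P := by
  obtain ⟨X, hX⟩ := Model.satisfies.comprehension hθ hη v w fun x => (h₁ x).symm.trans (h₂ x)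
  exact ⟨X, fun x => (hX x).trans (h₁ x).symm⟩

theorem dec_of_bounded {θ : Fm} (hθ : IsBounded θ) (v : ℕ → N)
    (w : ℕ → Model.Sets N) {P : N → Prop}
    (h : ∀ m x, θ.Sat Model.mem (cons m (cons x v)) w ↔ P x) : Dec P :=
  dec_of_sigma_pi hθ hθ v w (fun x => by simp [h]) fun x => by simp [h]

theorem Dec.congr {P Q : N → Prop} (hP : Dec P) (h : ∀ x, P x ↔ Q x) : Dec Q := by
  obtain rfl : P = Q := funext fun x => propext (h x)
  exact hP

theorem Rec.congr {f g : N → N} (hf : Rec f) (h : ∀ x, f x = g x) : Rec g := by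
  obtain rfl : f = g := funext h
  exact hf

theorem rec_of_dec {Q : N → Prop} {f : N → N} (hQ : Dec Q) (h : ∀ x y, Q (pr x y) ↔ y = f x) :
    Rec f := by
  obtain ⟨X, hX⟩ := hQ
  exact ⟨X, fun x y => (hX _).trans (h x y)⟩

open Tm Fm

instance Dec.imp {P Q : N → Prop} [hP : Dec P] [hQ : Dec Q] : Dec fun x => P x → Q x := by
  obtain ⟨X, hX⟩ := hP
  obtain ⟨Y, hY⟩ := hQ
  refine dec_of_bounded (.imp (.mem (var 1) 0) (.mem (var 1) 1)) (fun _ => 0) (cons X fun _ => Y)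
    fun m x => ?_
  rw [← hX, ← hY]; rfl

instance Dec.const {p : Prop} : Dec fun _ : N => p := by
  obtain ⟨X⟩ := (Model.satisfies (N := N)).nonempty
  by_cases h : p
  · exact dec_of_bounded (.imp .bot .bot) (fun _ => 0) (fun _ => X) fun m x => by simp [h]
  · exact dec_of_bounded .bot (fun _ => 0) (fun _ => X) fun m x => by simp [h]

instance Dec.not {P : N → Prop} [hP : Dec P] : Dec fun x => ¬ P x :=
  Dec.imp (Q := fun _ => False)

instance Dec.and {P Q : N → Prop} [hP : Dec P] [hQ : Dec Q] : Dec fun x => P x ∧ Q x :=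
  (inferInstance : Dec fun x => ¬ (P x → ¬ Q x)).congr fun x => by tauto

instance Dec.or {P Q : N → Prop} [hP : Dec P] [hQ : Dec Q] : Dec fun x => P x ∨ Q x :=
  (inferInstance : Dec fun x => ¬ P x → Q x).congr fun x => by tauto

instance Dec.iff {P Q : N → Prop} [hP : Dec P] [hQ : Dec Q] : Dec fun x => P x ↔ Q x :=
  (inferInstance : Dec fun x => (P x → Q x) ∧ (Q x → P x)).congr fun x => by tauto

/-- There is no bound on `f x`, but since `f` is total and single-valued, `P (f x)` has the two
forms `∃ m, m = f x ∧ P m` and `∀ m, m = f x → P m`, and `Δ⁰₁` comprehension applies. -/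
theorem Dec.comp {P : N → Prop} {f : N → N} (hP : Dec P) (hf : Rec f) : Dec fun x => P (f x) := by
  obtain ⟨X, hX⟩ := hP
  obtain ⟨F, hF⟩ := hf
  refine dec_of_sigma_pi (θ := Fm.and (.mem (pair (var 1) (var 0)) 1) (.mem (var 0) 0))
    (η := .imp (.mem (pair (var 1) (var 0)) 1) (.mem (var 0) 0))
    ((IsBounded.mem _ _).and (.mem _ _)) (.imp (.mem _ _) (.mem _ _))
    (fun _ => 0) (cons X fun _ => F) (fun x => ?_) fun x => ?_
  · rw [← hX]
    constructor
    · exact fun h => ⟨f x, sat_and.2 ⟨(hF _ _).2 rfl, h⟩⟩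
    · rintro ⟨m, hm⟩
      obtain ⟨h₁, h₂⟩ := sat_and.1 hm
      rw [← show m = f x from (hF x m).1 h₁]
      exact h₂
  · rw [← hX]
    constructor
    · intro h m hm
      rw [show m = f x from (hF x m).1 hm]
      exact h
    · exact fun h => h _ ((hF _ _).2 rfl)

theorem Rec.comp {f g : N → N} (hf : Rec f) (hg : Rec g) : Rec fun x => f (g x) := by
  obtain ⟨F, hF⟩ := hf
  obtain ⟨G, hG⟩ := hg
  refine rec_of_dec (Q := fun z => ∃ x y, z = pr x y ∧ y = f (g x)) ?_ fun x y =>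
    ⟨fun ⟨x', y', h, h'⟩ => by rw [(pr_inj.1 h).1, (pr_inj.1 h).2]; exact h',
      fun h => ⟨x, y, rfl, h⟩⟩
  refine dec_of_sigma_pi
    (θ := Fm.bex (add (var 1) one) (Fm.bex (add (var 2) one) (Fm.and (.eq (var 3) (pair (var 1) (var 0)))
      (Fm.and (.mem (pair (var 1) (var 2)) 1) (.mem (pair (var 2) (var 0)) 0)))))
    (η := Fm.bex (add (var 1) one) (Fm.bex (add (var 2) one) (Fm.and (.eq (var 3) (pair (var 1) (var 0)))
      (.imp (.mem (pair (var 1) (var 2)) 1) (.mem (pair (var 2) (var 0)) 0)))))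
    (.bex _ (.bex _ ((IsBounded.eq _ _).and ((IsBounded.mem _ _).and (.mem _ _)))))
    (.bex _ (.bex _ ((IsBounded.eq _ _).and (.imp (.mem _ _) (.mem _ _)))))
    (fun _ => 0) (cons F fun _ => G) (fun z => ?_) fun z => ?_
  · simp only [sat_bex, sat_and, sat_eq, sat_mem, eval_pair, eval_add, eval_one, eval_var]
    simp only [cons, hF, hG]
    constructor
    · rintro ⟨x, y, rfl, rfl⟩
      exact ⟨g x, x, lt_add_one_iff'.2 (left_le_pr _ _), _, lt_add_one_iff'.2 (right_le_pr _ _),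
        rfl, rfl, rfl⟩
    · rintro ⟨m, x, -, y, -, rfl, rfl, rfl⟩
      exact ⟨x, _, rfl, rfl⟩
  · simp only [sat_bex, sat_and, sat_imp, sat_eq, sat_mem, eval_pair, eval_add, eval_one, eval_var]
    simp only [cons, hF, hG]
    constructor
    · rintro ⟨x, y, rfl, rfl⟩ m
      exact ⟨x, lt_add_one_iff'.2 (left_le_pr _ _), _, lt_add_one_iff'.2 (right_le_pr _ _),
        rfl, by rintro rfl; rfl⟩
    · intro h
      obtain ⟨x, -, y, -, rfl, -⟩ := h 0
      obtain ⟨x', -, y', -, h₁, h₂⟩ := h (g x)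
      obtain ⟨rfl, rfl⟩ := pr_inj.1 h₁
      exact ⟨x, y, rfl, h₂ rfl⟩

instance Rec.id : Rec fun x : N => x := by
  obtain ⟨X⟩ := (Model.satisfies (N := N)).nonempty
  refine rec_of_dec (Q := fun z => ∃ x < z + 1, z = pr x x) ?_ fun x y => ?_
  · exact dec_of_bounded (θ := Fm.bex (add (var 1) one) (.eq (var 2) (pair (var 0) (var 0))))
      (.bex _ (.eq _ _)) (fun _ => 0) (fun _ => X) fun m x => by simp [cons]
  · constructor
    · rintro ⟨x', -, h⟩
      rw [(pr_inj.1 h).1, (pr_inj.1 h).2]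
    · rintro rfl
      exact ⟨_, lt_add_one_iff'.2 (left_le_pr _ _), rfl⟩

/-- The functions given by terms with variables for the two components of the argument. -/
theorem rec_of_term (t : Tm) (v : ℕ → N) :
    Rec fun z => t.eval (cons (fst z) (cons (snd z) v)) := by
  obtain ⟨X⟩ := (Model.satisfies (N := N)).nonempty
  -- The second disjunct covers arguments that are not pairs, where both components take the default
  -- value `0`.
  refine rec_of_dec (Q := fun p => ∃ z < p + 1, ∃ y < p + 1, p = pr z y ∧
    ((∃ a < z + 1, ∃ b < z + 1, z = pr a b ∧ y = t.eval (cons a (cons b v))) ∨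
    ((∀ a < z + 1, ∀ b < z + 1, z ≠ pr a b) ∧ y = t.eval (cons 0 (cons 0 v))))) ?_ fun z y => ?_
  · have e₁ : ∀ a b c d e f : N, (t.subst (cons (var 1) (cons (var 0) fun n => var (n + 6)))).eval
        (cons a (cons b (cons c (cons d (cons e (cons f v)))))) = t.eval (cons b (cons a v)) := by
      intro a b c d e f
      rw [Tm.eval_subst]
      congr 1; funext n
      rcases n with _ | _ | n <;> rfl
    have e₂ : ∀ a b c d : N, (t.subst (cons zero (cons zero fun n => var (n + 4)))).eval
        (cons a (cons b (cons c (cons d v)))) = t.eval (cons 0 (cons 0 v)) := by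
      intro a b c d
      rw [Tm.eval_subst]
      congr 1; funext n
      rcases n with _ | _ | n <;> rfl
    refine dec_of_bounded
      (θ := Fm.bex (add (var 1) one) (Fm.bex (add (var 2) one) (Fm.and (.eq (var 3) (pair (var 1) (var 0)))
        (Fm.or (Fm.bex (add (var 1) one) (Fm.bex (add (var 2) one) (and
            (.eq (var 3) (pair (var 1) (var 0)))
            (.eq (var 2) (t.subst (cons (var 1) (cons (var 0) fun n => var (n + 6))))))))
          (Fm.and (Fm.ball (add (var 1) one) (Fm.ball (add (var 2) one) (neg
            (.eq (var 3) (pair (var 1) (var 0))))))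
            (.eq (var 0) (t.subst (cons zero (cons zero fun n => var (n + 4))))))))))
      (.bex _ (.bex _ ((IsBounded.eq _ _).and (.or (.bex _ (.bex _ (.and (.eq _ _) (.eq _ _))))
        (.and (.ball _ (.ball _ (.neg (.eq _ _)))) (.eq _ _))))))
      v (fun _ => X) fun m x => ?_
    simp only [sat_bex, sat_ball, sat_and, sat_or, sat_neg, sat_eq, eval_pair, eval_add, eval_one,
      eval_var, e₁, e₂]
    rfl
  · constructor
    · rintro ⟨z', -, y', -, h, h'⟩
      obtain ⟨rfl, rfl⟩ := pr_inj.1 h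
      rcases h' with ⟨a, -, b, -, rfl, h''⟩ | ⟨h₁, h''⟩
      · rw [fst_pr, snd_pr]; exact h''
      · rcases exists_pr_or z with ⟨a, b, rfl⟩ | ⟨-, h₂, h₃⟩
        · exact (h₁ a (lt_add_one_iff'.2 (left_le_pr _ _)) b (lt_add_one_iff'.2 (right_le_pr _ _))
            rfl).elim
        · rw [h₂, h₃]; exact h''
    · rintro rfl
      refine ⟨z, lt_add_one_iff'.2 (left_le_pr _ _), _, lt_add_one_iff'.2 (right_le_pr _ _),
        rfl, ?_⟩
      rcases exists_pr_or z with ⟨a, b, rfl⟩ | ⟨h₁, h₂, h₃⟩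
      · exact Or.inl ⟨a, lt_add_one_iff'.2 (left_le_pr _ _), b, lt_add_one_iff'.2 (right_le_pr _ _),
          rfl, by simp⟩
      · exact Or.inr ⟨fun a _ b _ h => h₁ ⟨a, b, h⟩, by rw [h₂, h₃]⟩

instance Rec.const {c : N} : Rec fun _ : N => c := rec_of_term (var 2) fun _ => c

instance Rec.fst' : Rec (SOA.fst (N := N)) := rec_of_term (var 0) fun _ => 0

instance Rec.snd' : Rec (SOA.snd (N := N)) := rec_of_term (var 1) fun _ => 0

instance Rec.fst {f : N → N} [hf : Rec f] : Rec fun x => fst (f x) :=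
  (rec_of_term (var 0) fun _ => 0).comp hf

instance Rec.snd {f : N → N} [hf : Rec f] : Rec fun x => snd (f x) :=
  (rec_of_term (var 1) fun _ => 0).comp hf

instance Rec.pr {f g : N → N} [hf : Rec f] [hg : Rec g] : Rec fun x => pr (f x) (g x) := by
  obtain ⟨F, hF⟩ := hf
  obtain ⟨G, hG⟩ := hg
  refine rec_of_dec (Q := fun z => ∃ x < z + 1, ∃ a < z + 1, ∃ b < z + 1, z = SOA.pr x (SOA.pr a b) ∧
    a = f x ∧ b = g x) ?_ fun x y => ?_
  · refine dec_of_bounded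
      (θ := Fm.bex (add (var 1) one) (Fm.bex (add (var 2) one) (Fm.bex (add (var 3) one) (and
        (.eq (var 4) (pair (var 2) (pair (var 1) (var 0))))
        (Fm.and (.mem (pair (var 2) (var 1)) 0) (.mem (pair (var 2) (var 0)) 1))))))
      (.bex _ (.bex _ (.bex _ (.and (.eq _ _) (.and (.mem _ _) (.mem _ _))))))
      (fun _ => 0) (cons F fun _ => G) fun m x => ?_
    simp only [sat_bex, sat_and, sat_eq, sat_mem, eval_pair, eval_add, eval_one, eval_var]
    simp only [cons, hF, hG]
  · constructor
    · rintro ⟨x', -, a, -, b, -, h, rfl, rfl⟩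
      obtain ⟨rfl, rfl⟩ := pr_inj.1 h
      rfl
    · rintro rfl
      exact ⟨x, lt_add_one_iff'.2 (left_le_pr _ _),
        _, lt_add_one_iff'.2 ((left_le_pr _ _).trans (right_le_pr _ _)),
        _, lt_add_one_iff'.2 ((right_le_pr _ _).trans (right_le_pr _ _)), rfl, rfl, rfl⟩

theorem Rec.comp₂ {c : N → N → N} (hc : Rec fun z => c (SOA.fst z) (SOA.snd z)) (f g : N → N)
    [hf : Rec f] [hg : Rec g] : Rec fun x => c (f x) (g x) :=
  (hc.comp (Rec.pr (f := f) (g := g))).congr fun x => by simp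

theorem Dec.comp₂ {Q : N → N → Prop} (hQ : Dec fun z => Q (SOA.fst z) (SOA.snd z)) (f g : N → N)
    [hf : Rec f] [hg : Rec g] : Dec fun x => Q (f x) (g x) :=
  (hQ.comp (Rec.pr (f := f) (g := g))).congr fun x => by simp

instance Rec.add {f g : N → N} [hf : Rec f] [hg : Rec g] : Rec fun x => f x + g x :=
  Rec.comp₂ (rec_of_term (Tm.add (var 0) (var 1)) fun _ => 0) f g

instance Rec.mul {f g : N → N} [hf : Rec f] [hg : Rec g] : Rec fun x => f x * g x :=
  Rec.comp₂ (rec_of_term (Tm.mul (var 0) (var 1)) fun _ => 0) f g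

instance Rec.add_left {a : N} : Rec (HAdd.hAdd a) := Rec.add (f := fun _ => a) (g := fun x => x)

instance Rec.pr_left {a : N} : Rec (SOA.pr a) := Rec.pr (f := fun _ => a) (g := fun x => x)

theorem dec_of_pairs {θ : Fm} (hθ : IsBounded θ) (v : ℕ → N) (w : ℕ → Model.Sets N)
    {Q : N → N → Prop} (f g : N → N) [hf : Rec f] [hg : Rec g]
    (h : ∀ a b z m, θ.Sat Model.mem (cons a (cons b (cons m (cons z v)))) w ↔ Q a b) :
    Dec fun x => Q (f x) (g x) := by
  have h' : Dec fun z : N => ∃ b < z + 1, ∃ a < z + 1, z = SOA.pr a b ∧ Q a b := by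
    refine dec_of_bounded
      (θ := Fm.bex (add (var 1) one) (Fm.bex (add (var 2) one)
        (Fm.and (.eq (var 3) (pair (var 0) (var 1))) θ)))
      (.bex _ (.bex _ (.and (.eq _ _) hθ))) v w fun m x => ?_
    simp only [sat_bex, sat_and, sat_eq, eval_pair, eval_add, eval_one, eval_var, h]
    rfl
  refine (h'.comp (Rec.pr (f := f) (g := g))).congr fun x => ⟨?_, fun h => ?_⟩
  · rintro ⟨b, -, a, -, h, hab⟩
    rwa [(pr_inj.1 h).1, (pr_inj.1 h).2]
  · exact ⟨_, lt_add_one_iff'.2 (right_le_pr _ _), _, lt_add_one_iff'.2 (left_le_pr _ _), rfl, h⟩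

instance Dec.lt {f g : N → N} [hf : Rec f] [hg : Rec g] : Dec fun x => f x < g x := by
  obtain ⟨X⟩ := (Model.satisfies (N := N)).nonempty
  exact dec_of_pairs (Q := fun a b => a < b) (.lt (var 0) (var 1)) (fun _ => 0) (fun _ => X) f g
    fun _ _ _ _ => Iff.rfl

instance Dec.eq {f g : N → N} [hf : Rec f] [hg : Rec g] : Dec fun x => f x = g x := by
  obtain ⟨X⟩ := (Model.satisfies (N := N)).nonempty
  exact dec_of_pairs (Q := fun a b => a = b) (.eq (var 0) (var 1)) (fun _ => 0) (fun _ => X) f g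
    fun _ _ _ _ => Iff.rfl

instance Dec.le {f g : N → N} [hf : Rec f] [hg : Rec g] : Dec fun x => f x ≤ g x :=
  (inferInstance : Dec fun x => ¬ g x < f x).congr fun _ => not_lt

instance Dec.ne {f g : N → N} [hf : Rec f] [hg : Rec g] : Dec fun x => f x ≠ g x :=
  Dec.not (P := fun x => f x = g x)

instance Dec.lt_left {a : N} : Dec (LT.lt a) := Dec.lt (f := fun _ => a) (g := fun x => x)

instance Dec.ball {t : N → N} {Q : N → N → Prop} [ht : Rec t]
    [hQ : Dec fun z => Q (SOA.fst z) (SOA.snd z)] : Dec fun x => ∀ i < t x, Q i x := by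
  obtain ⟨X, hX⟩ := hQ
  refine dec_of_pairs (Q := fun a b => ∀ i < a, Q i b)
    (θ := Fm.ball (var 0) (.mem (pair (var 0) (var 2)) 0)) (.ball _ (.mem _ _))
    (fun _ => 0) (fun _ => X) t (fun x => x) fun a b z m => ?_
  simp only [sat_ball, sat_mem, eval_pair, eval_var]
  simp only [cons, hX, fst_pr, snd_pr]

instance Dec.bex {t : N → N} {Q : N → N → Prop} [ht : Rec t]
    [hQ : Dec fun z => Q (SOA.fst z) (SOA.snd z)] : Dec fun x => ∃ i < t x, Q i x :=
  (inferInstance : Dec fun x => ¬ ∀ i < t x, ¬ Q i x).congr fun _ => by simp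

/-- `Δ⁰₁` comprehension. -/
theorem dec_of_exists_forall {P : N → Prop} (A B : N → N → Prop)
    [hA : Dec fun z => A (SOA.fst z) (SOA.snd z)] [hB : Dec fun z => B (SOA.fst z) (SOA.snd z)]
    (h₁ : ∀ x, P x ↔ ∃ m, A x m) (h₂ : ∀ x, P x ↔ ∀ m, B x m) : Dec P := by
  obtain ⟨X, hX⟩ := hA
  obtain ⟨Y, hY⟩ := hB
  refine dec_of_sigma_pi (θ := .mem (pair (var 1) (var 0)) 0) (η := .mem (pair (var 1) (var 0)) 1)
    (.mem _ _) (.mem _ _) (fun _ => 0) (cons X fun _ => Y) (fun x => ?_) fun x => ?_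
  · rw [h₁]
    refine exists_congr fun m => ?_
    simp only [sat_mem, eval_pair, eval_var]
    simp only [cons, hX, fst_pr, snd_pr]
  · rw [h₂]
    refine forall_congr' fun m => ?_
    simp only [sat_mem, eval_pair, eval_var]
    simp only [cons, hY, fst_pr, snd_pr]

/-- `Σ⁰₁` induction. -/
theorem sigma_induction (A : N → N → Prop) [hA : Dec fun z => A (SOA.fst z) (SOA.snd z)]
    (zero : ∃ m, A 0 m) (succ : ∀ x, (∃ m, A x m) → ∃ m, A (x + 1) m) (x : N) : ∃ m, A x m := by
  obtain ⟨X, hX⟩ := hA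
  have h : ∀ x m : N, (Fm.mem (pair (var 1) (var 0)) 0).Sat Model.mem
      (cons m (cons x fun _ => 0)) (fun _ => X) ↔ A x m := by
    intro x m
    simp only [sat_mem, eval_pair, eval_var]
    simp only [cons, hX, fst_pr, snd_pr]
  have := Model.satisfies.induction (.mem (pair (var 1) (var 0)) 0) (fun _ => 0) (fun _ => X)
    (by simpa only [h] using zero) (fun x => by simpa only [h] using succ x) x
  simpa only [h] using this

theorem dec_induction (P : N → Prop) [hP : Dec P] (zero : P 0) (succ : ∀ x, P x → P (x + 1))
    (x : N) : P x := by
  have : Dec fun z => P (SOA.fst z) := hP.comp inferInstance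
  obtain ⟨-, h⟩ := sigma_induction (fun x _ => P x) ⟨0, zero⟩ (fun x ⟨_, h⟩ => ⟨0, succ x h⟩) x
  exact h

theorem dec_induction_from (P : N → Prop) [hP : Dec P] (a : N) (base : P a)
    (succ : ∀ x, a ≤ x → P x → P (x + 1)) (x : N) (hx : a ≤ x) : P x := by
  obtain ⟨b, rfl⟩ := exists_add_of_le hx
  have : Dec fun b => P (a + b) := hP.comp inferInstance
  refine dec_induction (fun b => P (a + b)) (by simpa using base) (fun b hb => ?_) b
  have := succ (a + b) le_self_add hb
  rwa [add_assoc] at this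

theorem exists_least (P : N → Prop) [hP : Dec P] {x : N} (hx : P x) :
    ∃ y, P y ∧ ∀ z < y, ¬ P z := by
  by_contra! h
  have : Dec fun z => P (SOA.fst z) := hP.comp inferInstance
  have key := dec_induction (fun x => ∀ z < x, ¬ P z) (fun z hz => (not_lt_zero hz).elim)
    (fun x ih z hz => by
      rcases (lt_add_one_iff'.1 hz).lt_or_eq with hz | rfl
      · exact ih z hz
      · intro hz
        obtain ⟨y, hy, hy'⟩ := h z hz
        exact ih y hy hy')
  exact key (x + 1) x (lt_add_one_iff'.2 le_rfl) hx

/-- Unbounded search. -/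
theorem exists_rec_of_total (Q : N → N → Prop) [hQ : Dec fun z => Q (SOA.fst z) (SOA.snd z)]
    (h : ∀ x, ∃ y, Q x y) : ∃ f : N → N, Rec f ∧ ∀ x, Q x (f x) := by
  have h' : ∀ x, ∃ y, Q x y ∧ ∀ z < y, ¬ Q x z := fun x => by
    have : Dec (Q x) := hQ.comp₂ (fun _ => x) (fun y => y)
    obtain ⟨y, hy⟩ := h x
    exact exists_least (Q x) hy
  choose f hf using h'
  have hQ' : ∀ {g k : N → N} [Rec g] [Rec k], Dec fun x => Q (g x) (k x) :=
    fun {g k} _ _ => hQ.comp₂ g k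
  refine ⟨f, ?_, fun x => (hf x).1⟩
  refine rec_of_dec (Q := fun p => Q (SOA.fst p) (SOA.snd p) ∧
    ∀ z < SOA.snd p, ¬ Q (SOA.fst p) z) inferInstance fun x y => ?_
  simp only [fst_pr, snd_pr]
  refine ⟨fun ⟨h₁, h₂⟩ => ?_, by rintro rfl; exact hf x⟩
  rcases lt_trichotomy y (f x) with h | h | h
  · exact ((hf x).2 y h h₁).elim
  · exact h
  · exact (h₂ _ h (hf x).1).elim

theorem Rec.dec_eq {f : N → N} (hf : Rec f) : Dec fun z => SOA.snd z = f (SOA.fst z) := by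
  have : Rec fun z => f (SOA.fst z) := hf.comp inferInstance
  infer_instance

/-- Finiteness is meant in the metatheory: membership is then a finite disjunction of equations with
parameters. This is how externally defined finite objects enter the model. -/
theorem dec_of_finite {F : Set N} (hF : F.Finite) : Dec fun x => x ∈ F := by
  induction F, hF using Set.Finite.induction_on with
  | empty => exact (Dec.const (p := False)).congr fun _ => by simp
  | @insert a s _ _ ih => exact (inferInstance : Dec fun x => x = a ∨ x ∈ s).congr fun _ => by simp

end Closure

/-! ## Codes of finite sets -/

section Codes

variable {N : Type} [Model N]

/-- `i` belongs to the finite set coded by `e`. -/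
def Code (i e : N) : Prop :=
  ∃ k m n q, e = pr (pr k m) n ∧ i < k ∧ (m * (i + 1) + 1) * q = n

theorem code_pr {i k m n : N} : Code i (pr (pr k m) n) ↔ i < k ∧ m * (i + 1) + 1 ∣ n := by
  constructor
  · rintro ⟨k', m', n', q, h, hi, rfl⟩
    obtain ⟨h', rfl⟩ := pr_inj.1 h
    obtain ⟨rfl, rfl⟩ := pr_inj.1 h'
    exact ⟨hi, q, rfl⟩
  · rintro ⟨hi, q, rfl⟩
    exact ⟨k, m, _, q, rfl, hi, rfl⟩

theorem Code.lt {i e : N} (h : Code i e) : i < e := by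
  obtain ⟨k, m, n, q, rfl, hi, -⟩ := h
  exact hi.trans_le ((left_le_pr _ _).trans (left_le_pr _ _))

theorem le_succ_mul (a b : N) : b ≤ (a + 1) * b :=
  le_mul_of_one_le_left zero_le le_add_self

theorem dec_code : Dec fun z : N => Code (fst z) (snd z) := by
  have : Dec fun z : N => ∃ k < snd z + 1, ∃ m < snd z + 1, ∃ n < snd z + 1, ∃ q < snd z + 1,
      snd z = pr (pr k m) n ∧ fst z < k ∧ (m * (fst z + 1) + 1) * q = n := inferInstance
  refine this.congr fun z => ⟨?_, ?_⟩
  · rintro ⟨k, -, m, -, n, -, q, -, h⟩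
    exact ⟨k, m, n, q, h⟩
  · rintro ⟨k, m, n, q, h, hi, hq⟩
    rw [h]
    have hk := (left_le_pr k m).trans (left_le_pr _ n)
    have hm := (right_le_pr k m).trans (left_le_pr _ n)
    have hn := right_le_pr (pr k m) n
    have hq' : q ≤ n := hq ▸ le_succ_mul _ q
    exact ⟨k, lt_add_one_iff'.2 hk, m, lt_add_one_iff'.2 hm, n, lt_add_one_iff'.2 hn, q,
      lt_add_one_iff'.2 (hq'.trans hn), rfl, hi, hq⟩

instance Dec.code {f g : N → N} [Rec f] [Rec g] : Dec fun x => Code (f x) (g x) :=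
  dec_code.comp₂ f g

theorem dvd_of_dvd_add {a b c : N} (h : a ∣ b + c) (hc : a ∣ c) : a ∣ b := by
  obtain ⟨u, hu⟩ := h
  obtain ⟨v, rfl⟩ := hc
  rcases le_total v u with h | h
  · obtain ⟨w, rfl⟩ := exists_add_of_le h
    refine ⟨w, add_right_cancel (b := a * v) ?_⟩
    rw [hu]; ring
  · obtain ⟨w, rfl⟩ := exists_add_of_le h
    have h0 : b + a * w = 0 := by
      refine add_right_cancel (b := a * u) ?_
      rw [zero_add]
      calc b + a * w + a * u = b + a * (u + w) := by ring
        _ = a * u := hu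
    rw [(add_eq_zero.1 h0).1]
    exact dvd_zero a

/-- The induction builds the factorial of `k`. Divisibility is written with a bounded quotient so
that `Σ⁰₁` induction applies. -/
theorem exists_common_multiple (k : N) : ∃ m, 0 < m ∧ ∀ i < k, i + 1 ∣ m := by
  obtain ⟨m, hm, h⟩ := sigma_induction
    (fun k m : N => 0 < m ∧ ∀ i < k, ∃ d < m + 1, (i + 1) * d = m)
    ⟨1, zero_lt_one, fun i hi => (not_lt_zero hi).elim⟩
    (fun k ⟨m, hm, h⟩ => ⟨(k + 1) * m, mul_pos (lt_add_one_iff'.2 zero_le) hm, fun i hi => by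
      rcases (lt_add_one_iff'.1 hi).lt_or_eq with hi | rfl
      · obtain ⟨d, -, rfl⟩ := h i hi
        refine ⟨(k + 1) * d, lt_add_one_iff'.2 ?_, by ring⟩
        rw [mul_left_comm]; exact le_succ_mul _ _
      · exact ⟨m, lt_add_one_iff'.2 (le_succ_mul _ _), rfl⟩⟩) k
  exact ⟨m, hm, fun i hi => by obtain ⟨d, -, rfl⟩ := h i hi; exact ⟨d, rfl⟩⟩

/-- The coprimality of Gödel's moduli, without subtraction or gcd. Put `z = m * (i + 1)`. The two
moduli differ by `m * (d + 1)`, where `d + 1` is the distance of `i` and `j` and divides `m`. Hence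
`z + 1` divides `n * (m * (d + 1))` and so its multiple `n * z * z`; since `z * z` is `1` modulo `z
+ 1`, it divides `n`. -/
theorem dvd_of_dvd_mul_of_ne {b m i j n : N} (hm : ∀ i < b, i + 1 ∣ m) (hi : i < b) (hj : j < b)
    (hij : i ≠ j) (h : m * (i + 1) + 1 ∣ n * (m * (j + 1) + 1)) : m * (i + 1) + 1 ∣ n := by
  obtain ⟨d, hd, h'⟩ : ∃ d < b, m * (i + 1) + 1 ∣ n * (m * (d + 1)) := by
    rcases hij.lt_or_gt with hlt | hlt
    · obtain ⟨d, rfl⟩ := exists_add_of_le (add_one_le_iff'.2 hlt)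
      refine ⟨d, lt_of_le_of_lt le_add_self hj, dvd_of_dvd_add (c := n * (m * (i + 1) + 1)) ?_
        (dvd_mul_left _ _)⟩
      convert h using 1; ring
    · obtain ⟨d, rfl⟩ := exists_add_of_le (add_one_le_iff'.2 hlt)
      refine ⟨d, lt_of_le_of_lt le_add_self hi, dvd_of_dvd_add (c := n * (m * (j + 1) + 1)) ?_ h⟩
      exact ⟨n, by ring⟩
  obtain ⟨q, hq⟩ := hm d hd
  have h₂ : m * (i + 1) + 1 ∣ n * (m * (i + 1)) * (m * (i + 1)) := by
    obtain ⟨r, hr⟩ := h'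
    refine ⟨r * (q * ((i + 1) * (i + 1))), ?_⟩
    calc n * (m * (i + 1)) * (m * (i + 1))
        = n * (m * (i + 1)) * ((d + 1) * q * (i + 1)) := by rw [← hq]
      _ = n * (m * (d + 1)) * (q * ((i + 1) * (i + 1))) := by ring
      _ = _ := by rw [hr]; ring
  refine dvd_of_dvd_add (c := n * (m * (i + 1)) * (m * (i + 1) + 1)) ?_ (dvd_mul_left _ _)
  obtain ⟨r, hr⟩ := h₂
  refine ⟨r + n, ?_⟩
  calc n + n * (m * (i + 1)) * (m * (i + 1) + 1)
      = n * (m * (i + 1)) * (m * (i + 1)) + n * (m * (i + 1) + 1) := by ring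
    _ = _ := by rw [hr]; ring

/-- Every bounded recursive set has a code. -/
theorem exists_code (P : N → Prop) [hP : Dec P] (b : N) :
    ∃ e, ∀ w, Code w e ↔ w < b ∧ P w := by
  obtain ⟨m, hm₀, hm⟩ := exists_common_multiple b
  have hP' : ∀ {f : N → N} [Rec f], Dec fun x => P (f x) := fun {f} hf => hP.comp hf
  have hdvd : ∀ i n : N, (∃ q < n + 1, (m * (i + 1) + 1) * q = n) ↔ m * (i + 1) + 1 ∣ n := by
    intro i n
    constructor
    · rintro ⟨q, -, rfl⟩
      exact ⟨q, rfl⟩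
    · rintro ⟨q, rfl⟩
      exact ⟨q, lt_add_one_iff'.2 (le_succ_mul _ _), rfl⟩
  -- At stage `j` the number `n` is the product of the moduli `m * (i + 1) + 1` over the `i < j`, `i
  -- < b`, that satisfy `P`. It starts at `1`, which no modulus divides because `m` is positive.
  obtain ⟨n, hn⟩ := sigma_induction
    (fun j n : N => ∀ i < b, ((∃ q < n + 1, (m * (i + 1) + 1) * q = n) ↔ i < j ∧ P i))
    ⟨1, fun i hi => by
      rw [hdvd]
      refine iff_of_false (fun h => ?_) (by rintro ⟨h, -⟩; exact not_lt_zero h)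
      obtain ⟨q, hq⟩ := h
      rcases eq_or_ne q 0 with rfl | hq0
      · simp at hq
      · have h1 : m * (i + 1) + 1 ≤ 1 := by
          have := add_one_le_iff'.2 (pos_iff_ne_zero.2 hq0)
          rw [zero_add] at this
          exact (le_mul_of_one_le_right zero_le this).trans hq.symm.le
        have h2 : 0 < m * (i + 1) := mul_pos hm₀ (lt_add_one_iff'.2 zero_le)
        have h3 := add_one_le_iff'.1 h1
        exact absurd h3 (not_lt.2 (by
          have := add_one_le_iff'.2 h2
          rwa [zero_add] at this))⟩
    (fun j ⟨n, hn⟩ => by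
      simp only [hdvd] at hn ⊢
      by_cases hj : j < b ∧ P j
      · refine ⟨n * (m * (j + 1) + 1), fun i hi => ?_⟩
        rw [lt_add_one_iff', le_iff_lt_or_eq]
        rcases eq_or_ne i j with rfl | hij
        · exact iff_of_true (dvd_mul_left _ _) ⟨Or.inr rfl, hj.2⟩
        · simp only [hij, or_false]
          rw [← hn i hi]
          exact ⟨dvd_of_dvd_mul_of_ne hm hi hj.1 hij, fun h => h.mul_right _⟩
      · refine ⟨n, fun i hi => ?_⟩
        rw [hn i hi, lt_add_one_iff', le_iff_lt_or_eq]
        refine and_congr_left fun hPi => ⟨Or.inl, ?_⟩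
        rintro (h | rfl)
        · exact h
        · exact (hj ⟨hi, hPi⟩).elim) b
  refine ⟨pr (pr b m) n, fun w => ?_⟩
  rw [code_pr]
  refine and_congr_right fun hw => ?_
  rw [← hdvd, hn w hw]
  exact and_iff_right hw

end Codes

/-! ## Iteration of recursive functions -/

section Iteration

variable {N : Type} [Model N]

/-- Every element of the set coded by `e` is obtained in finitely many steps of the iteration of
`f` that starts at `a`. -/
def IsComputation (f : N → N) (a e : N) : Prop :=
  ∀ w < e, Code w e → w = pr 0 a ∨ ∃ i < e, ∃ y < e, Code (pr i y) e ∧ w = pr (i + 1) (f y)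

/-- Every entry can be traced back to the starting value, so induction on the step shows that two
computations agree. The bounds in the induction formula lose nothing: an element is smaller than the
code of its set. -/
theorem IsComputation.unique {f : N → N} {a e e' : N} (h : IsComputation f a e)
    (h' : IsComputation f a e') {j y y' : N} (hy : Code (pr j y) e) (hy' : Code (pr j y') e') :
    y = y' := by
  have key := dec_induction (fun j => ∀ y < e, ∀ y' < e', Code (pr j y) e → Code (pr j y') e' →
      y = y')
    (fun y _ y' _ hy hy' => by
      have h₀ : ∀ {b i z : N}, pr 0 b ≠ pr (i + 1) z := fun e =>
        (lt_add_one_iff'.2 (zero_le)).ne (pr_inj.1 e).1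
      rcases h _ hy.lt hy with e₁ | ⟨i, -, u, -, -, e₁⟩
      · rcases h' _ hy'.lt hy' with e₂ | ⟨i, -, u, -, -, e₂⟩
        · rw [(pr_inj.1 e₁).2, (pr_inj.1 e₂).2]
        · exact (h₀ e₂).elim
      · exact (h₀ e₁).elim)
    (fun j ih y _ y' _ hy hy' => by
      have h₀ : ∀ {b z : N}, pr (j + 1) z ≠ pr 0 b := fun e =>
        (lt_add_one_iff'.2 (zero_le)).ne' (pr_inj.1 e).1
      rcases h _ hy.lt hy with e₁ | ⟨i, -, u, hu, hc, e₁⟩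
      · exact (h₀ e₁).elim
      rcases h' _ hy'.lt hy' with e₂ | ⟨i', -, u', hu', hc', e₂⟩
      · exact (h₀ e₂).elim
      obtain ⟨d₁, rfl⟩ := pr_inj.1 e₁
      obtain ⟨d₂, rfl⟩ := pr_inj.1 e₂
      obtain rfl := add_right_cancel d₁
      obtain rfl := add_right_cancel d₂
      rw [ih u hu u' hu' hc hc']) j
  exact key y ((right_le_pr _ _).trans_lt hy.lt) y' ((right_le_pr _ _).trans_lt hy'.lt) hy hy'

theorem IsComputation.exists_zero (f : N → N) (a : N) :
    ∃ e, IsComputation f a e ∧ Code (pr 0 a) e := by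
  obtain ⟨e, he⟩ := exists_code (fun w => w = pr 0 a) (pr 0 a + 1)
  exact ⟨e, fun w _ hw => Or.inl ((he w).1 hw).2, (he _).2 ⟨lt_add_one_iff'.2 le_rfl, rfl⟩⟩

theorem IsComputation.exists_succ {f : N → N} {a e j y : N} (h : IsComputation f a e)
    (hy : Code (pr j y) e) : ∃ e', IsComputation f a e' ∧ Code (pr (j + 1) (f y)) e' := by
  obtain ⟨e', he'⟩ := exists_code (fun w => Code w e ∨ w = pr (j + 1) (f y))
    (e + (pr (j + 1) (f y) + 1))
  have hsub : ∀ {w}, Code w e → Code w e' := fun hw =>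
    (he' _).2 ⟨hw.lt.trans_le le_self_add, Or.inl hw⟩
  refine ⟨e', fun w _ hw => ?_, (he' _).2
    ⟨lt_of_lt_of_le (lt_add_one_iff'.2 le_rfl) le_add_self, Or.inr rfl⟩⟩
  rcases ((he' w).1 hw).2 with hw | rfl
  · refine (h w hw.lt hw).imp_right ?_
    rintro ⟨i, -, y, -, hc, rfl⟩
    have := hsub hc
    exact ⟨i, (left_le_pr _ _).trans_lt this.lt, y, (right_le_pr _ _).trans_lt this.lt, this, rfl⟩
  · have := hsub hy
    exact Or.inr ⟨j, (left_le_pr _ _).trans_lt this.lt, y, (right_le_pr _ _).trans_lt this.lt,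
      this, rfl⟩

/-- The value at step `j` is `y` if and only if some computation contains `(j, y)`, and also if and
only if every computation with an entry at `j` has `y` there. This makes the graph `Δ⁰₁`; existence
of computations is a `Σ⁰₁` induction. -/
theorem exists_iterate (f : N → N) [hf : Rec f] :
    ∃ it : N → N → N, (Rec fun z => it (fst z) (snd z)) ∧ (∀ a, it a 0 = a) ∧
      ∀ a j, it a (j + 1) = f (it a j) := by
  have hf' : ∀ {g : N → N} [Rec g], Rec fun x => f (g x) := fun {g} hg => hf.comp hg
  have hJ : ∀ {g k : N → N} [Rec g] [Rec k], Dec fun x => IsComputation f (g x) (k x) := by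
    intro g k _ _
    refine Dec.comp₂ (Q := IsComputation f) ?_ g k
    unfold IsComputation
    infer_instance
  have total : ∀ a j, ∃ y e, IsComputation f a e ∧ Code (pr j y) e := by
    intro a j
    obtain ⟨e, he, y, -, hy⟩ := sigma_induction
      (fun j e => IsComputation f a e ∧ ∃ y < e, Code (pr j y) e)
      (by
        obtain ⟨e, he, hc⟩ := IsComputation.exists_zero f a
        exact ⟨e, he, a, (right_le_pr _ _).trans_lt hc.lt, hc⟩)
      (fun j ⟨e, he, y, _, hy⟩ => by
        obtain ⟨e', he', hc⟩ := he.exists_succ hy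
        exact ⟨e', he', _, (right_le_pr _ _).trans_lt hc.lt, hc⟩) j
    exact ⟨y, e, he, hy⟩
  choose it hit using total
  refine ⟨it, ?_, fun a => ?_, fun a j => ?_⟩
  · refine rec_of_dec (Q := fun p => ∃ e, IsComputation f (fst (fst p)) e ∧
      Code (pr (snd (fst p)) (snd p)) e) ?_ fun x y => ?_
    · refine dec_of_exists_forall
        (fun p e => IsComputation f (fst (fst p)) e ∧ Code (pr (snd (fst p)) (snd p)) e)
        (fun p e => ∀ y < e, IsComputation f (fst (fst p)) e → Code (pr (snd (fst p)) y) e →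
          snd p = y) (fun p => Iff.rfl) fun p => ⟨?_, fun h => ?_⟩
      · rintro ⟨e, he, hc⟩ e' y - he' hc'
        exact he.unique he' hc hc'
      · obtain ⟨e, he, hc⟩ := hit (fst (fst p)) (snd (fst p))
        refine ⟨e, he, ?_⟩
        rw [h e _ ((right_le_pr _ _).trans_lt hc.lt) he hc]
        exact hc
    · simp only [fst_pr, snd_pr]
      constructor
      · rintro ⟨e, he, hc⟩
        obtain ⟨e', he', hc'⟩ := hit (fst x) (snd x)
        exact he.unique he' hc hc'
      · rintro rfl
        exact hit _ _
  · obtain ⟨e, he, hc⟩ := hit a 0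
    obtain ⟨e', he', hc'⟩ := IsComputation.exists_zero f a
    exact he.unique he' hc hc'
  · obtain ⟨e, he, hc⟩ := hit a (j + 1)
    obtain ⟨e₁, he₁, hc₁⟩ := hit a j
    obtain ⟨e', he', hc'⟩ := he₁.exists_succ hc₁
    exact he.unique he' hc hc'

end Iteration

/-! ## The triangle Ramsey theorem in a model -/

section TriangleRamsey

variable {N : Type} [Model N]

/-- If every fibre were bounded, the maximum of the bounds over the externally finite `F` would
bound `P`. Neither `P` nor `c` has to be given by a set of the model. -/
theorem exists_unbounded_fiber {P : N → Prop} (hP : ∀ n, ∃ m, n < m ∧ P m) (c : N → N)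
    (F : Finset N) (hc : ∀ m, P m → c m ∈ F) : ∃ i ∈ F, ∀ n, ∃ m, n < m ∧ P m ∧ c m = i := by
  by_contra! h
  choose! b hb using h
  obtain ⟨n, hn⟩ : ∃ n, ∀ i ∈ F, b i ≤ n := by
    obtain ⟨n, hn⟩ := (F.image b).exists_le
    exact ⟨n, fun i hi => hn _ (Finset.mem_image_of_mem b hi)⟩
  obtain ⟨m, hm, hPm⟩ := hP n
  exact hb (c m) (hc m hPm) m ((hn _ (hc m hPm)).trans_lt hm) hPm rfl

theorem exists_star (c : N → N → N) (hc : ∀ t i, Dec fun m => c t m = i) (F : Finset N) :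
    ∀ X : N → Prop, Dec X → (∀ n, ∃ m, n < m ∧ X m) →
      (∀ m l, X m → X l → m < l → c m l ∈ F) →
      ∃ i ∈ F, ∃ t, ∀ n, ∃ m l, n < m ∧ m < l ∧ t < m ∧ c t m = i ∧ c t l = i ∧ c m l = i := by
  induction F using Finset.strongInduction with
  | H F ih =>
    intro X hX hinf hF
    obtain ⟨t, -, ht⟩ := hinf 0
    obtain ⟨i, hi, hi'⟩ := exists_unbounded_fiber (P := fun m => t < m ∧ X m)
      (fun n => by
        obtain ⟨m, hm, hXm⟩ := hinf (max n t)
        exact ⟨m, (le_max_left _ _).trans_lt hm, (le_max_right _ _).trans_lt hm, hXm⟩)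
      (c t) F fun m hm => hF t m ht hm.2 hm.1
    by_cases h : ∀ n, ∃ m l, n < m ∧ m < l ∧ t < m ∧ c t m = i ∧ c t l = i ∧ c m l = i
    · exact ⟨i, hi, t, h⟩
    push Not at h
    obtain ⟨n, hn⟩ := h
    have h₁ : Dec fun m => c t m = i := hc t i
    -- Beyond `n` no two `i`-neighbours of `t` in `X` are joined by colour `i`, so the colour `i`
    -- can be dropped.
    obtain ⟨j, hj, h⟩ := ih (F.erase i) (Finset.erase_ssubset hi)
      (fun m => n < m ∧ (t < m ∧ X m) ∧ c t m = i) inferInstance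
      (fun k => by
        obtain ⟨m, hm, h⟩ := hi' (max n k)
        exact ⟨m, (le_max_right _ _).trans_lt hm, (le_max_left _ _).trans_lt hm, h⟩)
      (fun m l hm hl hml => Finset.mem_erase.2
        ⟨hn m l hm.1 hml hm.2.1.1 hm.2.2 hl.2.2, hF m l hm.2.1.2 hl.2.1.2 hml⟩)
    exact ⟨j, (Finset.mem_erase.1 hj).2, h⟩

end TriangleRamsey

/-! ## Size-change graphs in a model -/

section Graphs

variable {N : Type} [Model N]

theorem rec_of_finite_support {f : N → N} {F : Set N} (hF : F.Finite) (hf : ∀ x, x ∉ F → f x = 0) :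
    Rec f := by
  have h₁ : Dec fun p => p ∈ (fun x => pr x (f x)) '' F := dec_of_finite (hF.image _)
  have h₂ : Dec fun p => fst p ∈ F := (dec_of_finite hF).comp inferInstance
  refine rec_of_dec
    (Q := fun p => p ∈ (fun x => pr x (f x)) '' F ∨ (¬ fst p ∈ F ∧ snd p = 0)) inferInstance
    fun x y => ?_
  simp only [fst_pr, snd_pr]
  constructor
  · rintro (⟨x', hx', h⟩ | ⟨h, rfl⟩)
    · obtain ⟨rfl, rfl⟩ := pr_inj.1 h
      rfl
    · exact (hf x h).symm
  · rintro rfl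
    by_cases hx : x ∈ F
    · exact Or.inl ⟨x, hx, rfl⟩
    · exact Or.inr ⟨hx, hf x hx⟩

/-- The predicate `Q` may be any predicate of the metatheory, since only its trace on the finite set
`F` matters. -/
theorem dec_of_finite_range {f : N → N} (hf : Rec f) {F : Set N} (hF : F.Finite)
    (h : ∀ x, f x ∈ F) (Q : N → Prop) : Dec fun x => Q (f x) :=
  ((dec_of_finite (hF.subset (Set.sep_subset F Q))).comp hf).congr fun x =>
    ⟨fun h' => h'.2, fun h' => ⟨h x, h'⟩⟩

theorem finite_lt_natCast (n : ℕ) : {x : N | x < n}.Finite := by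
  induction n with
  | zero => simp
  | succ n ih =>
    refine (ih.insert (n : N)).subset fun x hx => ?_
    rw [Set.mem_ofPred_eq, Nat.cast_succ, lt_add_one_iff'] at hx
    exact hx.eq_or_lt

/-- `e` is the least code of the set that it codes. -/
def IsCode (e : N) : Prop := ∀ e' < e, ∃ i, ¬ (Code i e' ↔ Code i e)

theorem IsCode.ext {e e' : N} (h : IsCode e) (h' : IsCode e') (hc : ∀ i, Code i e ↔ Code i e') :
    e = e' := by
  rcases lt_trichotomy e e' with hlt | heq | hlt
  · obtain ⟨i, hi⟩ := h' e hlt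
    exact (hi (hc i)).elim
  · exact heq
  · obtain ⟨i, hi⟩ := h e' hlt
    exact (hi (hc i).symm).elim

theorem exists_isCode {A : Set N} (hA : A.Finite) : ∃ e, IsCode e ∧ ∀ i, Code i e ↔ i ∈ A := by
  have hA' : ∀ {f : N → N} [Rec f], Dec fun x => f x ∈ A := fun {f} hf => (dec_of_finite hA).comp hf
  obtain ⟨b, hb⟩ : ∃ b, ∀ i ∈ A, i < b := by
    obtain ⟨b, hb⟩ := hA.bddAbove
    exact ⟨b + 1, fun i hi => lt_add_one_iff'.2 (hb hi)⟩
  -- The bound `b + e` exceeds all elements of `A` and of the set coded by `e`; it makes "`e` codes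
  -- `A`" recursive, so that a least such `e` exists.
  have hcode : ∀ e, (∀ i < b + e, (Code i e ↔ i ∈ A)) ↔ ∀ i, Code i e ↔ i ∈ A := fun e =>
    ⟨fun h i => ⟨fun hi => (h i (hi.lt.trans_le le_add_self)).1 hi,
      fun hi => (h i ((hb i hi).trans_le le_self_add)).2 hi⟩, fun h i _ => h i⟩
  obtain ⟨e, he⟩ := exists_code (fun i => i ∈ A) b
  obtain ⟨e', h₁, h₂⟩ := exists_least (fun e => ∀ i < b + e, (Code i e ↔ i ∈ A)) (x := e)
    ((hcode e).2 fun i => (he i).trans ⟨fun h => h.2, fun h => ⟨hb i h, h⟩⟩)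
  rw [hcode] at h₁
  refine ⟨e', fun e'' hlt => ?_, h₁⟩
  by_contra! hcon
  exact h₂ e'' hlt ((hcode e'').2 fun i => (hcon i).trans (h₁ i))

/-- The source of a size-change graph. -/
noncomputable def src (G : N) : N := fst (fst G)

/-- The target of a size-change graph. -/
noncomputable def tgt (G : N) : N := snd (fst G)

instance Rec.src {f : N → N} [Rec f] : Rec fun x => src (f x) := by unfold SOA.src; infer_instance

instance Rec.tgt {f : N → N} [Rec f] : Rec fun x => tgt (f x) := by unfold SOA.tgt; infer_instance

@[simp] theorem src_pr (f g e : N) : src (pr (pr f g) e) = f := by simp [src]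

@[simp] theorem tgt_pr (f g e : N) : tgt (pr (pr f g) e) = g := by simp [tgt]

/-- `G` has an arc of kind `r` from `x` to `y`. -/
def Arc (G x r y : N) : Prop := ∃ f g e, G = pr (pr f g) e ∧ Code (pr (pr x r) y) e

theorem arc_iff {G x r y : N} :
    Arc G x r y ↔ G = pr (pr (src G) (tgt G)) (snd G) ∧ Code (pr (pr x r) y) (snd G) := by
  constructor
  · rintro ⟨f, g, e, rfl, h⟩
    simpa using h
  · rintro ⟨h, h'⟩
    exact ⟨_, _, _, h, h'⟩

instance Dec.arc {G x r y : N → N} [Rec G] [Rec x] [Rec r] [Rec y] :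
    Dec fun z => Arc (G z) (x z) (r z) (y z) := by
  simp only [arc_iff]
  infer_instance

/-- `G` has an arc from `x` to `y`. -/
def Weak (G x y : N) : Prop := Arc G x 0 y ∨ Arc G x 1 y

/-- `G` is a size-change graph. -/
def IsGraph (G : N) : Prop :=
  ∃ p a q b e, G = pr (pr (pr p a) (pr q b)) e ∧ IsCode e ∧
    (∀ z, Code z e → ∃ x r y, x < a ∧ (r = 0 ∨ r = 1) ∧ y < b ∧ z = pr (pr x r) y) ∧
    ∀ x y, ¬ (Code (pr (pr x 0) y) e ∧ Code (pr (pr x 1) y) e)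

theorem IsGraph.eq_pr {G : N} (h : IsGraph G) : G = pr (pr (src G) (tgt G)) (snd G) := by
  obtain ⟨p, a, q, b, e, rfl, -⟩ := h
  simp

theorem IsGraph.isCode {G : N} (h : IsGraph G) : IsCode (snd G) := by
  obtain ⟨p, a, q, b, e, rfl, h, -⟩ := h
  simpa using h

theorem IsGraph.src_eq {G : N} (h : IsGraph G) : src G = pr (fst (src G)) (snd (src G)) := by
  obtain ⟨p, a, q, b, e, rfl, -⟩ := h
  simp

theorem IsGraph.tgt_eq {G : N} (h : IsGraph G) : tgt G = pr (fst (tgt G)) (snd (tgt G)) := by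
  obtain ⟨p, a, q, b, e, rfl, -⟩ := h
  simp

theorem IsGraph.arc_lt {G x r y : N} (h : IsGraph G) (h' : Arc G x r y) :
    x < snd (src G) ∧ (r = 0 ∨ r = 1) ∧ y < snd (tgt G) := by
  obtain ⟨p, a, q, b, e, rfl, -, h, -⟩ := h
  rw [arc_iff] at h'
  simp only [snd_pr, src_pr, tgt_pr] at h' ⊢
  obtain ⟨x', r', y', h₁, h₂, h₃, h₄⟩ := h _ h'.2
  obtain ⟨h₅, rfl⟩ := pr_inj.1 h₄
  obtain ⟨rfl, rfl⟩ := pr_inj.1 h₅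
  exact ⟨h₁, h₂, h₃⟩

theorem IsGraph.weak_lt {G x y : N} (h : IsGraph G) (h' : Weak G x y) :
    x < snd (src G) ∧ y < snd (tgt G) := by
  rcases h' with h' | h'
  · exact ⟨(h.arc_lt h').1, (h.arc_lt h').2.2⟩
  · exact ⟨(h.arc_lt h').1, (h.arc_lt h').2.2⟩

theorem IsGraph.not_both {G x y : N} (h : IsGraph G) : ¬ (Arc G x 0 y ∧ Arc G x 1 y) := by
  obtain ⟨p, a, q, b, e, rfl, -, -, h⟩ := h
  simpa [arc_iff] using h x y

theorem IsGraph.arc_zero_iff {G x y : N} (h : IsGraph G) :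
    Arc G x 0 y ↔ Weak G x y ∧ ¬ Arc G x 1 y := by
  have := h.not_both (x := x) (y := y)
  unfold Weak
  tauto

theorem IsGraph.weak_of_arc {G x r y : N} (h : IsGraph G) (h' : Arc G x r y) : Weak G x y := by
  rcases (h.arc_lt h').2.1 with rfl | rfl
  · exact Or.inl h'
  · exact Or.inr h'

/-- Uniqueness of least codes makes graphs extensional; equality of compositions and finiteness of
the closure rest on this. -/
theorem IsGraph.ext {G H : N} (hG : IsGraph G) (hH : IsGraph H) (hs : src G = src H)
    (ht : tgt G = tgt H) (harc : ∀ x r y, Arc G x r y ↔ Arc H x r y) : G = H := by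
  rw [hG.eq_pr, hH.eq_pr, hs, ht]
  congr 1
  refine hG.isCode.ext hH.isCode fun i => ?_
  have key : ∀ {G H : N}, IsGraph G → IsGraph H → (∀ x r y, Arc G x r y ↔ Arc H x r y) →
      Code i (snd G) → Code i (snd H) := by
    intro G H hG hH harc hi
    have hG' := hG
    obtain ⟨p, a, q, b, e, rfl, -, h, -⟩ := hG'
    rw [snd_pr] at hi
    obtain ⟨x, r, y, -, -, -, rfl⟩ := h i hi
    exact (arc_iff.1 ((harc x r y).1 ⟨_, _, _, rfl, hi⟩)).2
  exact ⟨key hG hH harc, key hH hG fun x r y => (harc x r y).symm⟩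

theorem IsGraph.ext_weak {G H : N} (hG : IsGraph G) (hH : IsGraph H) (hs : src G = src H)
    (ht : tgt G = tgt H) (hw : ∀ x y, Weak G x y ↔ Weak H x y)
    (hst : ∀ x y, Arc G x 1 y ↔ Arc H x 1 y) : G = H := by
  refine hG.ext hH hs ht fun x r y => ?_
  by_cases hr : r = 0 ∨ r = 1
  · rcases hr with rfl | rfl
    · rw [hG.arc_zero_iff, hH.arc_zero_iff, hw, hst]
    · exact hst x y
  · exact iff_of_false (fun h => hr (hG.arc_lt h).2.1) fun h => hr (hH.arc_lt h).2.1

theorem exists_isGraph (p q : N) {a b : N} {n : ℕ} (ha : a < n + 1) (hb : b < n + 1)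
    (R : N → N → N → Prop)
    (hR : ∀ x r y, R x r y → x < a ∧ (r = 0 ∨ r = 1) ∧ y < b) (hR' : ∀ x y, ¬ (R x 0 y ∧ R x 1 y)) :
    ∃ G, IsGraph G ∧ src G = pr p a ∧ tgt G = pr q b ∧ ∀ x r y, Arc G x r y ↔ R x r y := by
  have hI := finite_lt_natCast (N := N) (n + 1)
  have hA : {z : N | ∃ x r y, z = pr (pr x r) y ∧ R x r y}.Finite := by
    refine ((hI.prod ((Set.finite_singleton (1 : N)).insert 0 |>.prod hI)).image
      fun u => pr (pr u.1 u.2.1) u.2.2).subset ?_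
    rintro _ ⟨x, r, y, rfl, h⟩
    obtain ⟨h₁, h₂, h₃⟩ := hR x r y h
    refine ⟨(x, r, y), ⟨?_, h₂, ?_⟩, rfl⟩
    · exact (h₁.trans ha).trans_eq (Nat.cast_succ n).symm
    · exact (h₃.trans hb).trans_eq (Nat.cast_succ n).symm
  obtain ⟨e, he, hmem⟩ := exists_isCode hA
  have hmem' : ∀ x r y, Code (pr (pr x r) y) e ↔ R x r y := by
    intro x r y
    rw [hmem]
    constructor
    · rintro ⟨x', r', y', h, hr⟩
      obtain ⟨h', rfl⟩ := pr_inj.1 h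
      obtain ⟨rfl, rfl⟩ := pr_inj.1 h'
      exact hr
    · exact fun h => ⟨x, r, y, rfl, h⟩
  refine ⟨pr (pr (pr p a) (pr q b)) e, ⟨p, a, q, b, e, rfl, he, fun z hz => ?_, fun x y => ?_⟩,
    by simp, by simp, fun x r y => by simp [arc_iff, hmem']⟩
  · obtain ⟨x, r, y, rfl, h⟩ := (hmem z).1 hz
    obtain ⟨h₁, h₂, h₃⟩ := hR x r y h
    exact ⟨x, r, y, h₁, h₂, h₃, rfl⟩
  · rw [hmem', hmem']
    exact hR' x y

/-- `K` is the composition of the size-change graphs `G` and `H`. -/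
structure IsComp (G H K : N) : Prop where
  isGraph : IsGraph K
  mid : tgt G = src H
  src_eq : src K = src G
  tgt_eq : tgt K = tgt H
  weak x z : Weak K x z ↔ ∃ y, Weak G x y ∧ Weak H y z
  strict x z : Arc K x 1 z ↔ ∃ y, Arc G x 1 y ∧ Weak H y z ∨ Weak G x y ∧ Arc H y 1 z

theorem IsComp.unique {G H K K' : N} (h : IsComp G H K) (h' : IsComp G H K') : K = K' :=
  h.isGraph.ext_weak h'.isGraph (h.src_eq.trans h'.src_eq.symm) (h.tgt_eq.trans h'.tgt_eq.symm)
    (fun x y => (h.weak x y).trans (h'.weak x y).symm)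
    fun x y => (h.strict x y).trans (h'.strict x y).symm

theorem exists_isComp {G H : N} {n : ℕ} (hG : IsGraph G) (hH : IsGraph H) (h : tgt G = src H)
    (ha : snd (src G) < n + 1) (hb : snd (tgt H) < n + 1) : ∃ K, IsComp G H K := by
  obtain ⟨K, hK, hs, ht, harc⟩ := exists_isGraph (fst (src G)) (fst (tgt H)) ha hb
    (fun x r z => (r = 1 ∧ ∃ y, Arc G x 1 y ∧ Weak H y z ∨ Weak G x y ∧ Arc H y 1 z) ∨
      (r = 0 ∧ (∃ y, Weak G x y ∧ Weak H y z) ∧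
        ¬ ∃ y, Arc G x 1 y ∧ Weak H y z ∨ Weak G x y ∧ Arc H y 1 z))
    (by
      rintro x r z (⟨rfl, y, h | h⟩ | ⟨rfl, ⟨y, h⟩, -⟩)
      · exact ⟨(hG.arc_lt h.1).1, Or.inr rfl, (hH.weak_lt h.2).2⟩
      · exact ⟨(hG.weak_lt h.1).1, Or.inr rfl, (hH.arc_lt h.2).2.2⟩
      · exact ⟨(hG.weak_lt h.1).1, Or.inl rfl, (hH.weak_lt h.2).2⟩)
    (by
      rintro x z ⟨h₁, h₂⟩
      rcases h₁ with h₁ | h₁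
      · exact zero_ne_one h₁.1
      · rcases h₂ with h₂ | h₂
        · exact h₁.2.2 h₂.2
        · exact one_ne_zero h₂.1)
  have hst : ∀ x z, Arc K x 1 z ↔ ∃ y, Arc G x 1 y ∧ Weak H y z ∨ Weak G x y ∧ Arc H y 1 z :=
    fun x z => by simp [harc]
  refine ⟨K, hK, h, hs.trans hG.src_eq.symm, ht.trans hH.tgt_eq.symm, fun x z => ?_, hst⟩
  have h₀ : Arc K x 0 z ↔ (∃ y, Weak G x y ∧ Weak H y z) ∧
      ¬ ∃ y, Arc G x 1 y ∧ Weak H y z ∨ Weak G x y ∧ Arc H y 1 z := by simp [harc]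
  rw [Weak, h₀, hst]
  constructor
  · rintro (h | ⟨y, h | h⟩)
    · exact h.1
    · exact ⟨y, Or.inr h.1, h.2⟩
    · exact ⟨y, h.1, Or.inr h.2⟩
  · intro h
    by_cases h' : ∃ y, Arc G x 1 y ∧ Weak H y z ∨ Weak G x y ∧ Arc H y 1 z
    · exact Or.inr h'
    · exact Or.inl ⟨h, h'⟩

/-- In terms of `Weak` and strict arcs, composition is composition of relations, so associativity
amounts to rearranging the intermediate parameters. -/
theorem IsComp.assoc {G H J A B C : N} (hA : IsComp G H A) (hB : IsComp A J B) (hC : IsComp H J C) :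
    IsComp G C B where
  isGraph := hB.isGraph
  mid := hA.mid.trans hC.src_eq.symm
  src_eq := hB.src_eq.trans hA.src_eq
  tgt_eq := hB.tgt_eq.trans hC.tgt_eq.symm
  weak x z := by
    simp only [hB.weak, hA.weak, hC.weak]
    constructor
    · rintro ⟨y, ⟨u, h₁, h₂⟩, h₃⟩
      exact ⟨u, h₁, y, h₂, h₃⟩
    · rintro ⟨u, h₁, y, h₂, h₃⟩
      exact ⟨y, ⟨u, h₁, h₂⟩, h₃⟩
  strict x z := by
    simp only [hB.strict, hA.weak, hC.weak, hA.strict, hC.strict]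
    constructor
    · rintro ⟨y, ⟨⟨u, ⟨h₁, h₂⟩ | ⟨h₁, h₂⟩⟩, h₃⟩ | ⟨⟨u, h₁, h₂⟩, h₃⟩⟩
      · exact ⟨u, Or.inl ⟨h₁, y, h₂, h₃⟩⟩
      · exact ⟨u, Or.inr ⟨h₁, y, Or.inl ⟨h₂, h₃⟩⟩⟩
      · exact ⟨u, Or.inr ⟨h₁, y, Or.inr ⟨h₂, h₃⟩⟩⟩
    · rintro ⟨u, ⟨h₁, y, h₂, h₃⟩ | ⟨h₁, y, ⟨h₂, h₃⟩ | ⟨h₂, h₃⟩⟩⟩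
      · exact ⟨y, Or.inl ⟨⟨u, Or.inl ⟨h₁, h₂⟩⟩, h₃⟩⟩
      · exact ⟨y, Or.inl ⟨⟨u, Or.inr ⟨h₁, h₂⟩⟩, h₃⟩⟩
      · exact ⟨y, Or.inr ⟨⟨u, h₁, h₂⟩, h₃⟩⟩

/-- The closure of a set of size-change graphs under composition. -/
inductive Closure (A : N → Prop) : N → Prop
  | base {G : N} : A G → Closure A G
  | comp {G H K : N} : Closure A G → Closure A H → IsComp G H K → Closure A K

/-- A finite set of size-change graphs between functions of arity at most `n`. -/
structure IsGraphSet (A : N → Prop) (n : ℕ) : Prop where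
  finite : {G | A G}.Finite
  isGraph {G : N} : A G → IsGraph G
  src_lt {G : N} : A G → snd (src G) < n + 1
  tgt_lt {G : N} : A G → snd (tgt G) < n + 1

variable {A : N → Prop} {n : ℕ}

theorem IsGraphSet.isGraph_closure (hA : IsGraphSet A n) {G : N} (h : Closure A G) : IsGraph G := by
  cases h with
  | base h => exact hA.isGraph h
  | comp _ _ h => exact h.isGraph

theorem Closure.src_mem {G : N} (h : Closure A G) : src G ∈ src '' {G | A G} := by
  induction h with
  | base h => exact ⟨_, h, rfl⟩
  | comp _ _ h ih _ => rw [h.src_eq]; exact ih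

theorem Closure.tgt_mem {G : N} (h : Closure A G) : tgt G ∈ tgt '' {G | A G} := by
  induction h with
  | base h => exact ⟨_, h, rfl⟩
  | comp _ _ h _ ih => rw [h.tgt_eq]; exact ih

theorem IsGraphSet.closure (hA : IsGraphSet A n) : IsGraphSet (Closure A) n where
  isGraph := hA.isGraph_closure
  src_lt h := by
    obtain ⟨G, hG, e⟩ := h.src_mem
    rw [← e]; exact hA.src_lt hG
  tgt_lt h := by
    obtain ⟨G, hG, e⟩ := h.tgt_mem
    rw [← e]; exact hA.tgt_lt hG
  finite := by
    have hI := finite_lt_natCast (N := N) (n + 1)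
    -- By extensionality a graph is determined by source, target and arcs. Composition creates no
    -- new sources or targets, and the arcs form a subset of a fixed finite set.
    refine Set.Finite.of_injOn
      (f := fun G => (src G, tgt G, {u : N × N × N | Arc G u.1 u.2.1 u.2.2}))
      (t := (src '' {G | A G}) ×ˢ (tgt '' {G | A G}) ×ˢ
        {B | B ⊆ {x : N | x < (n + 1 : ℕ)} ×ˢ ({0, 1} : Set N) ×ˢ {x : N | x < (n + 1 : ℕ)}})
      (fun G hG => ⟨hG.src_mem, hG.tgt_mem, ?_⟩) (fun G hG H hH h => ?_)
      ((hA.finite.image _).prod ((hA.finite.image _).prod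
        ((hI.prod (((Set.finite_singleton (1 : N)).insert 0).prod hI)).finite_subsets)))
    · rintro ⟨x, r, y⟩ hu
      have h := (hA.isGraph_closure hG).arc_lt hu
      obtain ⟨G', hG', e⟩ := Closure.src_mem hG
      obtain ⟨G'', hG'', e'⟩ := Closure.tgt_mem hG
      refine ⟨?_, h.2.1, ?_⟩
      · have := hA.src_lt hG'
        rw [e] at this
        exact (h.1.trans this).trans_eq (Nat.cast_succ n).symm
      · have := hA.tgt_lt hG''
        rw [e'] at this
        exact (h.2.2.trans this).trans_eq (Nat.cast_succ n).symm
    · simp only [Prod.mk.injEq] at h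
      refine (hA.isGraph_closure hG).ext (hA.isGraph_closure hH) h.1 h.2.1 fun x r y => ?_
      exact Set.ext_iff.1 h.2.2 (x, r, y)

theorem IsGraphSet.exists_comp (hA : IsGraphSet A n) {G H : N} (hG : Closure A G)
    (hH : Closure A H) (h : tgt G = src H) : ∃ K, Closure A K ∧ IsComp G H K := by
  obtain ⟨K, hK⟩ := exists_isComp (hA.closure.isGraph hG) (hA.closure.isGraph hH) h
    (hA.closure.src_lt hG) (hA.closure.tgt_lt hH)
  exact ⟨K, .comp hG hH hK, hK⟩

/-- The path of size-change graphs `M` has infinite descent. -/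
def HasDescent (M : N → N) : Prop :=
  ∃ (t : N) (H : N → N), Rec H ∧ (∀ s, Weak (M (t + s)) (H s) (H (s + 1))) ∧
    ∀ n, ∃ s, n < s ∧ Arc (M (t + s)) (H s) 1 (H (s + 1))

/-- Every recursive path of graphs in `A` has infinite descent. -/
def IsSCT (A : N → Prop) : Prop :=
  ∀ M : N → N, Rec M → (∀ s, A (M s)) → (∀ s, tgt (M s) = src (M (s + 1))) → HasDescent M

end Graphs

/-! ## From strict loops to infinite descent -/

section Descent

variable {N : Type} [Model N] {A : N → Prop} {n : ℕ}

/-- Truncated subtraction is recursive. -/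
theorem exists_sub : ∃ sub : N → N → N, (Rec fun z => sub (fst z) (snd z)) ∧
    ∀ a b, sub (a + b) a = b := by
  obtain ⟨f, hf, h⟩ := exists_rec_of_total
    (fun z y : N => snd z ≤ fst z → fst z = snd z + y) (fun z => by
      by_cases hz : snd z ≤ fst z
      · obtain ⟨y, hy⟩ := exists_add_of_le hz
        exact ⟨y, fun _ => hy⟩
      · exact ⟨0, fun h => (hz h).elim⟩)
  refine ⟨fun a b => f (pr a b), hf.comp inferInstance, fun a b => ?_⟩
  have := h (pr (a + b) a)
  simp only [fst_pr, snd_pr] at this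
  exact (add_left_cancel (this le_self_add)).symm

/-- The compositions of the segments of a path. -/
theorem exists_segments (hA : IsGraphSet A n) (M : N → N) (hM : Rec M) (hMA : ∀ s, A (M s))
    (hMc : ∀ s, tgt (M s) = src (M (s + 1))) :
    ∃ c : N → N → N, (Rec fun z => c (fst z) (snd z)) ∧ (∀ s, c s (s + 1) = M s) ∧
      (∀ s m, s < m → Closure A (c s m)) ∧
      ∀ s m l, s < m → m < l → IsComp (c s m) (c m l) (c s l) := by
  classical
  have hM' : ∀ {g : N → N} [Rec g], Rec fun x => M (g x) := fun {g} hg => hM.comp hg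
  have hfin := hA.closure.finite
  have hcl : ∀ {g : N → N} [Rec g], Dec fun x => Closure A (g x) :=
    fun {g} hg => (dec_of_finite hfin).comp hg
  -- Composition as a total function with default value `0`. The last condition excludes numbers
  -- that are not pairs, so the support is finite; hence `mul` is recursive although its values are
  -- chosen.
  let mul : N → N := fun z =>
    if h : Closure A (fst z) ∧ Closure A (snd z) ∧ tgt (fst z) = src (snd z) ∧
        z = pr (fst z) (snd z)
    then (hA.exists_comp h.1 h.2.1 h.2.2.1).choose else 0
  have hmul : ∀ G H, Closure A G → Closure A H → tgt G = src H →
      Closure A (mul (pr G H)) ∧ IsComp G H (mul (pr G H)) := by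
    intro G H hG hH h
    have h' : Closure A (fst (pr G H)) ∧ Closure A (snd (pr G H)) ∧
        tgt (fst (pr G H)) = src (snd (pr G H)) ∧ pr G H = pr (fst (pr G H)) (snd (pr G H)) := by
      simp [hG, hH, h]
    have := (hA.exists_comp h'.1 h'.2.1 h'.2.2.1).choose_spec
    simp only [mul, dif_pos h']
    simpa using this
  have hmulRec : Rec mul := by
    refine rec_of_finite_support ((hfin.prod hfin).image fun u => pr u.1 u.2) fun z hz => ?_
    simp only [mul]
    rw [dif_neg]
    rintro ⟨h₁, h₂, -, h₃⟩
    exact hz ⟨(fst z, snd z), ⟨h₁, h₂⟩, h₃.symm⟩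
  have hmulRec' : ∀ {g : N → N} [Rec g], Rec fun x => mul (g x) := fun {g} hg => hmulRec.comp hg
  obtain ⟨it, hit, hit0, hits⟩ := exists_iterate
    (fun z => pr (fst z + 1) (mul (pr (snd z) (M (fst z)))))
  obtain ⟨sub, hsub, hsub'⟩ := exists_sub (N := N)
  have hsubR : ∀ {f g : N → N} [Rec f] [Rec g], Rec fun x => sub (f x) (g x) :=
    fun {f g} _ _ => hsub.comp₂ f g
  have hitR : ∀ {f g : N → N} [Rec f] [Rec g], Rec fun x => it (f x) (g x) :=
    fun {f g} _ _ => hit.comp₂ f g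
  -- The iterated state consists of the next position and the composition so far; `c s m` composes
  -- `M s, …, M (m - 1)`.
  let c : N → N → N := fun s m => snd (it (pr (s + 1) (M s)) (sub m (s + 1)))
  have hcR : Rec fun z => c (fst z) (snd z) := by
    simp only [c]; infer_instance
  have hcR' : ∀ {f g : N → N} [Rec f] [Rec g], Rec fun x => c (f x) (g x) :=
    fun {f g} _ _ => hcR.comp₂ f g
  have hfst : ∀ s j, fst (it (pr (s + 1) (M s)) j) = s + 1 + j := by
    intro s
    refine dec_induction _ (by simp [hit0]) fun j ih => ?_
    rw [hits, fst_pr, ih, add_assoc]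
  have hc0 : ∀ s, c s (s + 1) = M s := by
    intro s
    have := hsub' (s + 1) 0
    rw [add_zero] at this
    simp only [c, this, hit0, snd_pr]
  have hcs : ∀ s m, s < m → c s (m + 1) = mul (pr (c s m) (M m)) := by
    intro s m hsm
    obtain ⟨j, rfl⟩ := exists_add_of_le (add_one_le_iff'.2 hsm)
    simp only [c]
    rw [hsub', add_assoc (s + 1), hsub', hits, snd_pr, hfst]
  have hinv : ∀ s m, s < m →
      Closure A (c s m) ∧ src (c s m) = src (M s) ∧ tgt (c s m) = src (M m) := by
    intro s m hsm
    refine dec_induction_from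
      (fun m => Closure A (c s m) ∧ src (c s m) = src (M s) ∧ tgt (c s m) = src (M m)) (s + 1)
      ?_ (fun m hm ih => ?_) m (add_one_le_iff'.2 hsm)
    · rw [hc0]
      exact ⟨.base (hMA s), rfl, hMc s⟩
    · obtain ⟨h₁, h₂⟩ := hmul _ _ ih.1 (.base (hMA m)) ih.2.2
      rw [hcs s m (add_one_le_iff'.1 hm)]
      exact ⟨h₁, h₂.src_eq.trans ih.2.1, h₂.tgt_eq.trans (hMc m)⟩
  have hstep : ∀ s m, s < m → IsComp (c s m) (M m) (c s (m + 1)) := by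
    intro s m hsm
    rw [hcs s m hsm]
    exact (hmul _ _ (hinv s m hsm).1 (.base (hMA m)) (hinv s m hsm).2.2).2
  refine ⟨c, hcR, hc0, fun s m h => (hinv s m h).1, fun s m l hsm hml => ?_⟩
  have hcomp : ∀ l, m < l → IsComp (c s m) (c m l) (mul (pr (c s m) (c m l))) := fun l hml =>
    (hmul _ _ (hinv s m hsm).1 (hinv m l hml).1
      ((hinv s m hsm).2.2.trans (hinv m l hml).2.1.symm)).2
  -- The claim is phrased as an equation between recursive functions, so that induction in the model
  -- applies.
  have key := dec_induction_from (fun l => c s l = mul (pr (c s m) (c m l))) (m + 1)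
    (by rw [hc0, hcs s m hsm]) (fun l hl ih => by
      have hml := add_one_le_iff'.1 hl
      have h₁ := hcomp l hml
      rw [← ih] at h₁
      exact (IsComp.assoc h₁ (hstep s l (hsm.trans hml)) (hstep m l hml)).unique
        (hcomp (l + 1) (hml.trans (lt_add_one_iff'.2 le_rfl)))) l (add_one_le_iff'.2 hml)
  rw [key]
  exact hcomp l hml

theorem isSCT_of_strict_loops (hA : IsGraphSet A n)
    (h : ∀ G, Closure A G → IsComp G G G → ∃ x, Arc G x 1 x) : IsSCT A := by
  intro M hM hMA hMc
  obtain ⟨c, hcR, hc0, hcl, hcomp⟩ := exists_segments hA M hM hMA hMc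
  have hM' : ∀ {g : N → N} [Rec g], Rec fun x => M (g x) := fun {g} hg => hM.comp hg
  have hcR' : ∀ {f g : N → N} [Rec f] [Rec g], Rec fun x => c (f x) (g x) :=
    fun {f g} _ _ => hcR.comp₂ f g
  obtain ⟨G, -, t, hstar⟩ := exists_star c
    (fun t i => Dec.eq (hf := hcR' (f := fun _ => t) (g := fun m => m)) (g := fun _ => i))
    hA.closure.finite.toFinset (fun _ => True) inferInstance
    (fun n => ⟨n + 1, lt_add_one_iff'.2 le_rfl, trivial⟩)
    fun m l _ _ hml => hA.closure.finite.mem_toFinset.2 (hcl m l hml)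
  let Good : N → N → Prop := fun m l => t < m ∧ m < l ∧ c t m = G ∧ c t l = G ∧ c m l = G
  have hGood : ∀ b, ∃ m l, b < m ∧ Good m l := fun b => by
    obtain ⟨m, l, h₁, h₂, h₃, h₄⟩ := hstar b
    exact ⟨m, l, h₁, h₃, h₂, h₄⟩
  -- Choose the next good pair beyond `l`. Since `c m l` and `c t l` are both `G`, continuing from
  -- `l` to `m'` gives `c m m' = c t m' = G`.
  have hnext : ∀ m l, Good m l → ∃ m' l', m < m' ∧ Good m' l' ∧ c m m' = G := by
    rintro m l ⟨h₁, h₂, h₃, h₄, h₅⟩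
    obtain ⟨m', l', hm', hg⟩ := hGood l
    refine ⟨m', l', h₂.trans hm', hg, ?_⟩
    have e₁ := hcomp m l m' h₂ hm'
    have e₂ := hcomp t l m' (h₁.trans h₂) hm'
    rw [h₅] at e₁
    rw [h₄] at e₂
    exact (e₁.unique e₂).trans hg.2.2.1
  obtain ⟨m₀, l₀, -, hg₀⟩ := hGood 0
  obtain ⟨m₁, l₁, hm₁, hg₁, hc₁⟩ := hnext m₀ l₀ hg₀
  have hGcl : Closure A G := hc₁ ▸ hcl m₀ m₁ hm₁
  have hGG : IsComp G G G := by
    obtain ⟨h₁, h₂, h₃, h₄, h₅⟩ := hg₀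
    have := hcomp t m₀ l₀ h₁ h₂
    rwa [h₃, h₄, h₅] at this
  obtain ⟨x, hx⟩ := h G hGcl hGG
  -- states `((p, y), (m, l))`
  let V : N → Prop := fun z => fst (fst z) < fst (snd z) ∧
    Arc (c (fst (fst z)) (fst (snd z))) (snd (fst z)) 1 x ∧ Good (fst (snd z)) (snd (snd z))
  -- At position `p` the thread is at `y` and a strict arc from `y` to `x` is still owed by the
  -- checkpoint `m`. The checkpoint may change only when the step taken is strict. The premise `V z`
  -- makes the search total.
  let Q : N → N → Prop := fun z z' => V z → V z' ∧ fst (fst z') = fst (fst z) + 1 ∧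
    ((Arc (M (fst (fst z))) (snd (fst z)) 0 (snd (fst z')) ∧ fst (snd z') = fst (snd z)) ∨
      Arc (M (fst (fst z))) (snd (fst z)) 1 (snd (fst z')))
  have hVd : ∀ {f : N → N} [Rec f], Dec fun z => V (f z) := fun {f} _ => by
    simp only [V, Good]; infer_instance
  have hQd : Dec fun z => Q (fst z) (snd z) := by
    simp only [Q]; infer_instance
  have hQ : ∀ z, ∃ z', Q z z' := by
    intro z
    by_cases hz : V z
    · obtain ⟨hlt, harc, hg⟩ := hz
      set p := fst (fst z)
      set y := snd (fst z)
      set m := fst (snd z)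
      set l := snd (snd z)
      suffices ∃ y' m' l', p + 1 < m' ∧ Arc (c (p + 1) m') y' 1 x ∧ Good m' l' ∧
          ((Arc (M p) y 0 y' ∧ m' = m) ∨ Arc (M p) y 1 y') by
        obtain ⟨y', m', l', h₁, h₂, h₃, h₄⟩ := this
        exact ⟨pr (pr (p + 1) y') (pr m' l'), fun _ => by simpa [V] using ⟨⟨h₁, h₂, h₃⟩, rfl, h₄⟩⟩
      obtain ⟨m', l', hm', hg', hc'⟩ := hnext m l hg
      -- At the checkpoint, or after a strict step, the next segment with composition `G` takes
      -- over, and the strict loop at `x` supplies the strict arc that is owed there.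
      rcases (add_one_le_iff'.2 hlt).eq_or_lt with heq | hlt'
      · refine ⟨x, m', l', heq ▸ hm', ?_, hg', Or.inr ?_⟩
        · rw [heq, hc']; exact hx
        · rwa [← heq, hc0] at harc
      · have hp : p < p + 1 := lt_add_one_iff'.2 le_rfl
        have hcp := hcomp p (p + 1) m hp hlt'
        rw [hc0] at hcp
        obtain ⟨y', hy' | hy'⟩ := (hcp.strict y x).1 harc
        · refine ⟨y', m', l', hlt'.trans hm', ?_, hg', Or.inr hy'.1⟩
          refine ((hcomp (p + 1) m m' hlt' hm').strict y' x).2 ⟨x, Or.inr ⟨hy'.2, ?_⟩⟩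
          rw [hc']; exact hx
        · rcases hy'.1 with h₀ | h₀
          · exact ⟨y', m, l, hlt', hy'.2, hg, Or.inl ⟨h₀, rfl⟩⟩
          · exact ⟨y', m, l, hlt', hy'.2, hg, Or.inr h₀⟩
    · exact ⟨0, fun h => (hz h).elim⟩
  obtain ⟨f, hf, hfQ⟩ := exists_rec_of_total Q hQ
  obtain ⟨it, hit, hit0, hits⟩ := exists_iterate f
  let z₀ : N := pr (pr m₀ x) (pr m₁ l₁)
  have hV₀ : V z₀ := by
    simp only [V, z₀, fst_pr, snd_pr, hc₁]
    exact ⟨hm₁, hx, hg₁⟩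
  have hZ : ∀ {g : N → N} [Rec g], Rec fun j => it z₀ (g j) := fun {g} _ =>
    hit.comp₂ (fun _ => z₀) g
  have hZ₀ : Rec (it z₀) := hZ (g := fun j => j)
  have hV : ∀ j, V (it z₀ j) := dec_induction (fun j => V (it z₀ j)) (by rw [hit0]; exact hV₀)
    fun j hj => by rw [hits]; exact (hfQ _ hj).1
  have hp : ∀ j, fst (fst (it z₀ j)) = m₀ + j := dec_induction _ (by simp [hit0, z₀])
    fun j hj => by rw [hits, (hfQ _ (hV j)).2.1, hj, add_assoc]
  have hstep : ∀ j, (Arc (M (m₀ + j)) (snd (fst (it z₀ j))) 0 (snd (fst (it z₀ (j + 1)))) ∧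
      fst (snd (it z₀ (j + 1))) = fst (snd (it z₀ j))) ∨
      Arc (M (m₀ + j)) (snd (fst (it z₀ j))) 1 (snd (fst (it z₀ (j + 1)))) := fun j => by
    have := (hfQ _ (hV j)).2.2
    rwa [hp, ← hits] at this
  refine ⟨m₀, fun j => snd (fst (it z₀ j)), inferInstance, fun j => ?_, fun k => ?_⟩
  · rcases hstep j with h | h
    · exact Or.inl h.1
    · exact Or.inr h
  · by_contra! hcon
    -- Without strict steps after `k` the checkpoint would stay fixed, but the position, which grows
    -- by one at each step, must remain below it.
    have key := dec_induction (fun i => fst (snd (it z₀ (k + 1 + i))) = fst (snd (it z₀ (k + 1))))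
      (by rw [add_zero]) (fun i ih => by
        rcases hstep (k + 1 + i) with h | h
        · rw [← add_assoc, h.2, ih]
        · exact (hcon (k + 1 + i) ((lt_add_one_iff'.2 le_rfl).trans_le le_self_add) h).elim)
      (fst (snd (it z₀ (k + 1))))
    have h₁ := (hV (k + 1 + fst (snd (it z₀ (k + 1))))).1
    rw [key, hp] at h₁
    exact absurd h₁ (not_lt.2 (le_add_self.trans le_add_self))

end Descent

/-! ## From infinite descent to strict loops -/

section StrictLoops

variable {N : Type} [Model N] {A : N → Prop} {n : ℕ}

/-- The compositions of finite sequences from `A`, built from the left. -/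
inductive LeftClosure (A : N → Prop) : N → Prop
  | base {G : N} : A G → LeftClosure A G
  | snoc {G H K : N} : LeftClosure A G → A H → IsComp G H K → LeftClosure A K

theorem LeftClosure.closure {G : N} (h : LeftClosure A G) : Closure A G := by
  induction h with
  | base h => exact .base h
  | snoc _ h h' ih => exact .comp ih (.base h) h'

/-- Associativity re-brackets the composition to the left; the intermediate compositions exist
because the closure is closed under composition of composable graphs. -/
theorem LeftClosure.comp (hA : IsGraphSet A n) {G H : N} (hG : LeftClosure A G)
    (hH : LeftClosure A H) : ∀ {K}, IsComp G H K → LeftClosure A K := by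
  induction hH with
  | base h => exact fun hK => .snoc hG h hK
  | @snoc H J L hH hJ hL ih =>
    intro K hK
    obtain ⟨B, -, hB⟩ := hA.exists_comp hG.closure hH.closure (hK.mid.trans hL.src_eq)
    have hB' := ih hB
    obtain ⟨C, -, hC⟩ := hA.exists_comp hB'.closure (.base hJ) (hB.tgt_eq.trans hL.mid)
    rw [hK.unique (hB.assoc hC hL)]
    exact .snoc hB' hJ hC

theorem Closure.left (hA : IsGraphSet A n) {G : N} (h : Closure A G) : LeftClosure A G := by
  induction h with
  | base h => exact .base h
  | comp _ _ h ih₁ ih₂ => exact ih₁.comp hA ih₂ h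

theorem LeftClosure.exists_sequence {G : N} (h : LeftClosure A G) :
    ∃ (r : ℕ) (L P : ℕ → N), (∀ i ≤ r, A (L i)) ∧ P 0 = L 0 ∧
      (∀ i < r, IsComp (P i) (L (i + 1)) (P (i + 1))) ∧ P r = G := by
  induction h with
  | @base G h => exact ⟨0, fun _ => G, fun _ => G, fun _ _ => h, rfl, by simp, rfl⟩
  | @snoc G H K _ hH hK ih =>
    obtain ⟨r, L, P, hL, h0, hP, rfl⟩ := ih
    refine ⟨r + 1, fun i => if i ≤ r then L i else H, fun i => if i ≤ r then P i else K,
      fun i _ => ?_, by simp [h0], fun i hi => ?_, by simp⟩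
    · dsimp only
      split_ifs with h
      · exact hL i h
      · exact hH
    · rcases (Nat.lt_succ_iff.1 hi).lt_or_eq with h | rfl
      · simpa [h.le, Nat.succ_le_iff.2 h] using hP i h
      · simpa using hK

/-- Periodic sequences are recursive. -/
theorem exists_cyclic (r : ℕ) : ∃ ι : N → ℕ, ι 0 = 0 ∧
    (∀ s, ι (s + 1) = if ι s = r then 0 else ι s + 1) ∧ (∀ s, ι s ≤ r) ∧
    ∀ L : ℕ → N, Rec fun s => L (ι s) := by
  classical
  have hf : Rec fun x : N => if x = r then 0 else x + 1 := by
    refine rec_of_dec (Q := fun p => (fst p = (r : N) ∧ snd p = 0) ∨ (fst p ≠ (r : N) ∧ snd p = fst p + 1))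
      inferInstance fun x y => ?_
    simp only [fst_pr, snd_pr]
    by_cases h : x = r <;> simp [h]
  obtain ⟨it, hit, hit0, hits⟩ := exists_iterate (fun x : N => if x = r then 0 else x + 1)
  have hfin : {x : N | ∃ i ≤ r, x = (i : ℕ)}.Finite :=
    ((Set.finite_le_nat r).image (Nat.cast : ℕ → N)).subset (by
      rintro _ ⟨i, hi, rfl⟩; exact ⟨i, hi, rfl⟩)
  have hitR : Rec (it 0) := hit.comp₂ (fun _ => 0) (fun x => x)
  have hd : Dec fun s => ∃ i ≤ r, it 0 s = (i : ℕ) := (dec_of_finite hfin).comp hitR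
  have hex : ∀ s, ∃ i ≤ r, it 0 s = (i : ℕ) := by
    -- Even at nonstandard `s` the counter has one of the standard values `0, …, r`: this is a
    -- property given by a finite set, so induction in the model proves it.
    refine dec_induction (fun s => ∃ i ≤ r, it 0 s = (i : ℕ)) ⟨0, by simp [hit0]⟩ fun s => ?_
    rintro ⟨i, hi, h⟩
    rw [hits, h]
    by_cases hir : i = r
    · exact ⟨0, by simp [hir]⟩
    · exact ⟨i + 1, by omega, by simp [hir]⟩
  choose ι hι hιc using hex
  have hinj : Function.Injective (Nat.cast : ℕ → N) := Nat.cast_injective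
  refine ⟨ι, ?_, fun s => ?_, hι, fun L => ?_⟩
  · apply hinj
    rw [← hιc, hit0, Nat.cast_zero]
  · apply hinj
    rw [← hιc, hits, hιc]
    by_cases h : ι s = r <;> simp [h]
  · have hL : Rec fun x : N => if h : ∃ i ≤ r, x = (i : ℕ) then L h.choose else 0 :=
      rec_of_finite_support hfin fun x hx => dif_neg hx
    refine (hL.comp hitR).congr fun s => ?_
    have h : ∃ i ≤ r, it 0 s = (i : ℕ) := ⟨ι s, hι s, hιc s⟩
    rw [dif_pos h]
    congr 1
    apply hinj
    rw [← h.choose_spec.2, hιc]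

/-- The parameters that can be reached from `x` after `i` graphs of the sequence with compositions
`P`, possibly after a passage through `G`. -/
def ReachWeak (G : N) (P : ℕ → N) (x : N) : ℕ → N → Prop
  | 0, y => x = y ∨ Weak G x y
  | i + 1, y => ∃ u, (x = u ∨ Weak G x u) ∧ Weak (P i) u y

/-- The parameters that can be reached from `x` with a strict arc. -/
def ReachStrict (G : N) (P : ℕ → N) (x : N) : ℕ → N → Prop
  | 0, y => Arc G x 1 y
  | i + 1, y => ∃ u, (x = u ∨ Weak G x u) ∧ Arc (P i) u 1 y ∨ Arc G x 1 u ∧ Weak (P i) u y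

/-- The invariants `ReachWeak` and `ReachStrict` compress all completed periods into at most one
passage through `G`, which idempotence permits; so they have finitely many states, however many
periods pass. -/
theorem strict_loop_of_isSCT (hA : IsGraphSet A n) (hS : IsSCT A) {G : N} (hG : Closure A G)
    (hGG : IsComp G G G) : ∃ x, Arc G x 1 x := by
  obtain ⟨r, L, P, hL, hP0, hP, hPr⟩ := (hG.left hA).exists_sequence
  obtain ⟨ι, hι0, hιs, hιr, hιR⟩ := exists_cyclic (N := N) r
  have hPtgt : ∀ i ≤ r, tgt (P i) = tgt (L i) := by
    rintro (_ | i) hi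
    · rw [hP0]
    · exact (hP i hi).tgt_eq
  have hPsrc : ∀ i ≤ r, src (P i) = src (L 0) := by
    intro i
    induction i with
    | zero => intro _; rw [hP0]
    | succ i ih => intro hi; rw [(hP i hi).src_eq, ih (by omega)]
  obtain ⟨t, H, hH, hw, hst⟩ := hS (fun s => L (ι s)) (hιR L) (fun s => hL _ (hιr s)) fun s => by
    rw [hιs]
    split_ifs with h
    · rw [h, ← hPtgt r le_rfl, ← hPsrc r le_rfl, hPr]
      exact hGG.mid
    · have := hιr s
      rw [← hPtgt _ (hιr s)]
      exact (hP (ι s) (by omega)).mid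
  -- the effect of one step
  have hmidW : ∀ x i y y', i ≤ r → ReachWeak G P x i y → Weak (L i) y y' →
      ReachWeak G P x (i + 1) y' := by
    rintro x (_ | i) y y' hi h h'
    · exact ⟨y, h, by rwa [hP0]⟩
    · obtain ⟨u, hu, h⟩ := h
      exact ⟨u, hu, ((hP i hi).weak u y').2 ⟨y, h, h'⟩⟩
  have hmidS : ∀ x i y y', i ≤ r → ReachStrict G P x i y → Weak (L i) y y' →
      ReachStrict G P x (i + 1) y' := by
    rintro x (_ | i) y y' hi h h'
    · exact ⟨y, Or.inr ⟨h, by rwa [hP0]⟩⟩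
    · obtain ⟨u, ⟨hu, h⟩ | ⟨hu, h⟩⟩ := h
      · exact ⟨u, Or.inl ⟨hu, ((hP i hi).strict u y').2 ⟨y, Or.inl ⟨h, h'⟩⟩⟩⟩
      · exact ⟨u, Or.inr ⟨hu, ((hP i hi).weak u y').2 ⟨y, h, h'⟩⟩⟩
  have hmidWS : ∀ x i y y', i ≤ r → ReachWeak G P x i y → Arc (L i) y 1 y' →
      ReachStrict G P x (i + 1) y' := by
    rintro x (_ | i) y y' hi h h'
    · exact ⟨y, Or.inl ⟨h, by rwa [hP0]⟩⟩
    · obtain ⟨u, hu, h⟩ := h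
      exact ⟨u, Or.inl ⟨hu, ((hP i hi).strict u y').2 ⟨y, Or.inr ⟨h, h'⟩⟩⟩⟩
  have hwrapW : ∀ x y, ReachWeak G P x (r + 1) y → ReachWeak G P x 0 y := by
    rintro x y ⟨u, rfl | hu, h⟩
    · rw [hPr] at h; exact Or.inr h
    · rw [hPr] at h; exact Or.inr ((hGG.weak x y).2 ⟨u, hu, h⟩)
  have hwrapS : ∀ x y, ReachStrict G P x (r + 1) y → ReachStrict G P x 0 y := by
    rintro x y ⟨u, ⟨rfl | hu, h⟩ | ⟨hu, h⟩⟩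
    · rw [hPr] at h; exact h
    · rw [hPr] at h; exact (hGG.strict x y).2 ⟨u, Or.inr ⟨hu, h⟩⟩
    · rw [hPr] at h; exact (hGG.strict x y).2 ⟨u, Or.inl ⟨hu, h⟩⟩
  -- definability
  have hI := finite_lt_natCast (N := N) (n + 1)
  have hHI : ∀ s, H s ∈ {x : N | x < (n + 1 : ℕ)} := fun s => by
    have hLs := hL _ (hιr (t + s))
    exact (((hA.isGraph hLs).weak_lt (hw s)).1.trans (hA.src_lt hLs)).trans_eq
      (Nat.cast_succ n).symm
  have hιR' : Rec fun s => ((ι (t + s) : ℕ) : N) := (hιR Nat.cast).comp (g := fun s => t + s)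
    inferInstance
  have hdec : ∀ R : ℕ → N → Prop, Dec fun s => R (ι (t + s)) (H s) := by
    intro R
    have hfin : ((fun u : ℕ × N => pr (u.1 : N) u.2) ''
        {i | i ≤ r} ×ˢ {x : N | x < (n + 1 : ℕ)}).Finite := ((Set.finite_le_nat r).prod hI).image _
    -- The phase and the current parameter range over a finite set, so every external relation
    -- between them may be used in an induction in the model.
    refine (dec_of_finite_range (f := fun s => pr ((ι (t + s) : ℕ) : N) (H s)) inferInstance hfin
      (fun s => ⟨(ι (t + s), H s), ⟨hιr _, hHI s⟩, rfl⟩)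
      (fun z => ∃ i : ℕ, fst z = i ∧ R i (snd z))).congr fun s => ?_
    simp
  -- a parameter that is visited infinitely often at the beginning of the period
  have hunb : ∀ (d : ℕ) (s : N), r - ι (t + s) = d → ∃ m, s < m ∧ ι (t + m) = 0 := by
    intro d
    induction d with
    | zero =>
      intro s hs
      have := hιr (t + s)
      refine ⟨s + 1, lt_add_one_iff'.2 le_rfl, ?_⟩
      rw [← add_assoc, hιs, if_pos (by omega)]
    | succ d ih =>
      intro s hs
      obtain ⟨m, hm, h⟩ := ih (s + 1) (by
        rw [← add_assoc, hιs, if_neg (by omega)]; omega)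
      exact ⟨m, (lt_add_one_iff'.2 le_rfl).trans hm, h⟩
  obtain ⟨x, -, hx⟩ := exists_unbounded_fiber (P := fun s => ι (t + s) = 0)
    (fun s => hunb _ s rfl) H hI.toFinset fun s _ => hI.mem_toFinset.2 (hHI s)
  refine ⟨x, ?_⟩
  obtain ⟨s₀, -, hs₀, hHs₀⟩ := hx 0
  have hW := hdec (ReachWeak G P x)
  have hSd := hdec (ReachStrict G P x)
  have h₁ := dec_induction_from (fun s => ReachWeak G P x (ι (t + s)) (H s)) s₀
    (by rw [hs₀, hHs₀]; exact Or.inl rfl)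
    (fun s _ ih => by
      have h := hmidW x _ _ _ (hιr _) ih (hw s)
      rw [← add_assoc, hιs]
      split_ifs with hr
      · rw [hr] at h; exact hwrapW x _ h
      · exact h)
  obtain ⟨s₁, hs₁, hs₁'⟩ := hst s₀
  -- Strictness, acquired at `s₁`, persists. At the later visit `s₂` to `x` at the beginning of a
  -- period, the invariant reads `Arc G x 1 x`.
  have h₂ := dec_induction_from (fun s => ReachStrict G P x (ι (t + s)) (H s)) (s₁ + 1)
    (by
      have h := hmidWS x _ _ _ (hιr _) (h₁ s₁ hs₁.le) hs₁'
      rw [← add_assoc, hιs]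
      split_ifs with hr
      · rw [hr] at h; exact hwrapS x _ h
      · exact h)
    (fun s _ ih => by
      have h := hmidS x _ _ _ (hιr _) ih (hw s)
      rw [← add_assoc, hιs]
      split_ifs with hr
      · rw [hr] at h; exact hwrapS x _ h
      · exact h)
  obtain ⟨s₂, hs₂, hs₂', hHs₂⟩ := hx (s₁ + 1)
  have := h₂ s₂ hs₂.le
  rw [hs₂', hHs₂] at this
  exact this

end StrictLoops

/-! ## The meaning of the formulas in a model -/

section Meaning

variable {N : Type} [Model N] {v : ℕ → N} {w : ℕ → Model.Sets N}

theorem eval_num (k : ℕ) : (Tm.num k).eval v = (k : N) := by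
  induction k with
  | zero => exact Nat.cast_zero.symm
  | succ k ih => rw [Nat.cast_succ, ← ih]; rfl

theorem sat_isColoring {C : ℕ} {k : Tm} : (isColoring C k).Sat Model.mem v w ↔
    (∀ z, Model.mem z (w C) → ∃ x y i, x < y ∧ i < k.eval v ∧ z = pr (pr x y) i) ∧
    (∀ x y, x < y → ∃ i, Model.mem (pr (pr x y) i) (w C)) ∧
    ∀ x y i j, Model.mem (pr (pr x y) i) (w C) ∧ Model.mem (pr (pr x y) j) (w C) → i = j := by
  simp only [isColoring, sat_and, sat_all, sat_imp, sat_mem, sat_ex, sat_lt, sat_eq, Tm.eval_up,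
    eval_pair]
  rfl

theorem sat_triangleRamsey (k : ℕ) (v : ℕ → N) (w : ℕ → Model.Sets N) :
    (triangleRamsey (Tm.num k)).Sat Model.mem v w := by
  simp only [triangleRamsey, sat_allS, sat_imp, sat_isColoring, sat_ex, sat_and, sat_lt, sat_all,
    sat_mem, Tm.eval_up, eval_num, eval_pair]
  rintro C ⟨h₁, h₂, h₃⟩
  change ∀ z, Model.mem z C → _ at h₁
  change ∀ x y, x < y → ∃ i, Model.mem (pr (pr x y) i) C at h₂
  change ∀ x y i j, Model.mem (pr (pr x y) i) C ∧ Model.mem (pr (pr x y) j) C → i = j at h₃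
  classical
  choose! col hcol using h₂
  have hC : Dec fun z => Model.mem z C := ⟨C, fun _ => Iff.rfl⟩
  have hfin := finite_lt_natCast (N := N) k
  -- The value `0` off the domain is a default. Although `col` comes from choice, its fibres are
  -- recursive because colours are unique.
  obtain ⟨i, hi, t, h⟩ := exists_star (fun t m => if t < m then col t m else 0)
    (fun t i => by
      have : Dec fun m => Model.mem (pr (pr t m) i) C :=
        hC.comp (f := fun m => pr (pr t m) i) inferInstance
      refine (inferInstance : Dec fun m => (t < m ∧ Model.mem (pr (pr t m) i) C) ∨
        (¬ t < m ∧ 0 = i)).congr fun m => ?_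
      by_cases htm : t < m
      · simp only [htm, if_true, true_and, not_true_eq_false, false_and, or_false]
        exact ⟨fun h => h₃ t m _ _ ⟨hcol t m htm, h⟩, fun h => h ▸ hcol t m htm⟩
      · simp [htm])
    hfin.toFinset (fun _ => True) inferInstance
    (fun n => ⟨n + 1, lt_add_one_iff'.2 le_rfl, trivial⟩)
    (fun m l _ _ hml => by
      rw [if_pos hml, hfin.mem_toFinset]
      obtain ⟨x, y, i, -, hi, e⟩ := h₁ _ (hcol m l hml)
      rw [(pr_inj.1 e).2]
      exact hi)
  refine ⟨i, hfin.mem_toFinset.1 hi, t, fun n => ?_⟩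
  obtain ⟨m, l, hnm, hml, htm, e₁, e₂, e₃⟩ := h n
  rw [if_pos htm] at e₁
  rw [if_pos (htm.trans hml)] at e₂
  rw [if_pos hml] at e₃
  refine ⟨m, l, hnm, hml, htm, ?_, ?_, ?_⟩
  · exact e₁ ▸ hcol t m htm
  · exact e₂ ▸ hcol t l (htm.trans hml)
  · exact e₃ ▸ hcol m l hml

theorem sat_memCode {i e : Tm} :
    (memCode i e).Sat Model.mem v w ↔ Code (i.eval v) (e.eval v) := by
  simp only [memCode, sat_ex, sat_and, sat_eq, sat_lt, Tm.eval_up, eval_pair, eval_mul, eval_add,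
    eval_one]
  rfl

theorem sat_isCode {e : Tm} : (isCode e).Sat Model.mem v w ↔ IsCode (e.eval v) := by
  simp only [isCode, sat_all, sat_imp, sat_ex, sat_neg, sat_iff, sat_lt, sat_memCode, Tm.eval_up]
  rfl

theorem sat_isGraph {G : Tm} : (isGraph G).Sat Model.mem v w ↔ IsGraph (G.eval v) := by
  simp only [isGraph, sat_ex, sat_and, sat_eq, sat_all, sat_imp, sat_neg, sat_or, sat_lt,
    sat_memCode, sat_isCode, Tm.eval_up, eval_pair]
  rfl

/-- `G` has type `f → g`. -/
def HasType (G f g : N) : Prop := ∃ e, G = pr (pr f g) e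

theorem IsGraph.hasType_iff {G f g : N} (h : IsGraph G) :
    HasType G f g ↔ src G = f ∧ tgt G = g := by
  constructor
  · rintro ⟨e, rfl⟩
    simp
  · rintro ⟨rfl, rfl⟩
    exact ⟨_, h.eq_pr⟩

theorem sat_hasType {G f g : Tm} : (hasType G f g).Sat Model.mem v w ↔
    HasType (G.eval v) (f.eval v) (g.eval v) := by
  simp only [hasType, sat_ex, sat_eq, Tm.eval_up, eval_pair]
  rfl

theorem sat_arc {G x r y : Tm} : (arc G x r y).Sat Model.mem v w ↔
    Arc (G.eval v) (x.eval v) (r.eval v) (y.eval v) := by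
  simp only [arc, sat_ex, sat_and, sat_eq, sat_memCode, Tm.eval_up, eval_pair]
  rfl

theorem sat_composable {G H : Tm} : (composable G H).Sat Model.mem v w ↔
    ∃ f g h, HasType (G.eval v) f g ∧ HasType (H.eval v) g h := by
  simp only [composable, sat_ex, sat_and, sat_hasType, Tm.eval_up]
  rfl

theorem sat_isComp {G H K : Tm} : (isComp G H K).Sat Model.mem v w ↔
    IsGraph (K.eval v) ∧
    (∃ f g h, HasType (G.eval v) f g ∧ HasType (H.eval v) g h ∧ HasType (K.eval v) f h) ∧
    (∀ x z, Arc (K.eval v) x 1 z ↔ ∃ y r, (Arc (G.eval v) x 1 y ∧ Arc (H.eval v) y r z) ∨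
      (Arc (G.eval v) x r y ∧ Arc (H.eval v) y 1 z)) ∧
    ∀ x z, Arc (K.eval v) x 0 z ↔ (∃ y, Arc (G.eval v) x 0 y ∧ Arc (H.eval v) y 0 z) ∧
      ∀ y r r', Arc (G.eval v) x r y ∧ Arc (H.eval v) y r' z → r = 0 ∧ r' = 0 := by
  simp only [isComp, sat_ex, sat_and, sat_or, sat_imp, sat_eq, sat_iff, sat_all, sat_hasType,
    sat_arc, sat_isGraph, Tm.eval_up]
  rfl

/-- The formula quantifies over arbitrary arc kinds, and only for graphs are these limited to `0`
and `1`. Its clause for non-strict arcs then says that a weak connection exists and a strict one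
does not. -/
theorem sat_isComp_iff {G H K : Tm} (hG : IsGraph (G.eval v)) (hH : IsGraph (H.eval v)) :
    (isComp G H K).Sat Model.mem v w ↔ IsComp (G.eval v) (H.eval v) (K.eval v) := by
  rw [sat_isComp]
  generalize G.eval v = G at *
  generalize H.eval v = H at *
  generalize K.eval v = K at *
  have hstrict : ∀ x z, (∃ y r, (Arc G x 1 y ∧ Arc H y r z) ∨ (Arc G x r y ∧ Arc H y 1 z)) ↔
      ∃ y, Arc G x 1 y ∧ Weak H y z ∨ Weak G x y ∧ Arc H y 1 z := by
    intro x z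
    constructor
    · rintro ⟨y, r, h | h⟩
      · exact ⟨y, Or.inl ⟨h.1, hH.weak_of_arc h.2⟩⟩
      · exact ⟨y, Or.inr ⟨hG.weak_of_arc h.1, h.2⟩⟩
    · rintro ⟨y, ⟨h, h' | h'⟩ | ⟨h' | h', h⟩⟩
      · exact ⟨y, 0, Or.inl ⟨h, h'⟩⟩
      · exact ⟨y, 1, Or.inl ⟨h, h'⟩⟩
      · exact ⟨y, 0, Or.inr ⟨h', h⟩⟩
      · exact ⟨y, 1, Or.inr ⟨h', h⟩⟩
  have hzero : ∀ x z, ((∃ y, Arc G x 0 y ∧ Arc H y 0 z) ∧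
      ∀ y r r', Arc G x r y ∧ Arc H y r' z → r = 0 ∧ r' = 0) ↔
      (∃ y, Weak G x y ∧ Weak H y z) ∧
        ¬ ∃ y, Arc G x 1 y ∧ Weak H y z ∨ Weak G x y ∧ Arc H y 1 z := by
    intro x z
    constructor
    · rintro ⟨⟨y, h₁, h₂⟩, h⟩
      refine ⟨⟨y, Or.inl h₁, Or.inl h₂⟩, ?_⟩
      rw [← hstrict]
      rintro ⟨y, r, h' | h'⟩
      · exact one_ne_zero (h _ _ _ h').1
      · exact one_ne_zero (h _ _ _ h').2
    · rintro ⟨⟨y, h₁, h₂⟩, h⟩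
      refine ⟨⟨y, ?_, ?_⟩, fun y r r' hy => ⟨?_, ?_⟩⟩
      · exact h₁.resolve_right fun h' => h ⟨y, Or.inl ⟨h', h₂⟩⟩
      · exact h₂.resolve_right fun h' => h ⟨y, Or.inr ⟨h₁, h'⟩⟩
      · rcases (hG.arc_lt hy.1).2.1 with rfl | rfl
        · rfl
        · exact (h ⟨y, Or.inl ⟨hy.1, hH.weak_of_arc hy.2⟩⟩).elim
      · rcases (hH.arc_lt hy.2).2.1 with rfl | rfl
        · rfl
        · exact (h ⟨y, Or.inr ⟨hG.weak_of_arc hy.1, hy.2⟩⟩).elim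
  simp only [hstrict, hzero]
  constructor
  · rintro ⟨hK, ⟨f, g, h, hGt, hHt, hKt⟩, h₁, h₀⟩
    rw [hG.hasType_iff] at hGt
    rw [hH.hasType_iff] at hHt
    rw [hK.hasType_iff] at hKt
    refine ⟨hK, hGt.2.trans hHt.1.symm, hKt.1.trans hGt.1.symm, hKt.2.trans hHt.2.symm,
      fun x z => ?_, h₁⟩
    rw [Weak, h₁, h₀]
    constructor
    · rintro (h | ⟨y, h | h⟩)
      · exact h.1
      · exact ⟨y, Or.inr h.1, h.2⟩
      · exact ⟨y, h.1, Or.inr h.2⟩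
    · intro h
      by_cases h' : ∃ y, Arc G x 1 y ∧ Weak H y z ∨ Weak G x y ∧ Arc H y 1 z
      · exact Or.inr h'
      · exact Or.inl ⟨h, h'⟩
  · intro h
    refine ⟨h.isGraph, ⟨src G, tgt G, tgt H, hG.hasType_iff.2 ⟨rfl, rfl⟩,
      hH.hasType_iff.2 ⟨h.mid.symm, rfl⟩, h.isGraph.hasType_iff.2 ⟨h.src_eq, h.tgt_eq⟩⟩, h.strict,
      fun x z => ?_⟩
    rw [h.isGraph.arc_zero_iff, h.weak, h.strict]

/-- The formula intersects only the closed sets of the model. The inductively defined closure is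
finite, hence is itself one of these sets, and the two notions agree. -/
theorem sat_inClosure {S : ℕ} {G : Tm} {n : ℕ} (hA : IsGraphSet (fun g => Model.mem g (w S)) n) :
    (inClosure S G).Sat Model.mem v w ↔ Closure (fun g => Model.mem g (w S)) (G.eval v) := by
  simp only [inClosure, sat_allS, sat_imp, sat_and, sat_all, sat_mem]
  constructor
  · intro h
    obtain ⟨X, hX⟩ := (dec_of_finite hA.closure.finite).out
    refine (hX _).1 (h X ⟨fun G hG => (hX G).2 (.base hG), ?_⟩)
    rintro G H K ⟨hG, hH, hK⟩
    have hG' := (hX G).1 hG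
    have hH' := (hX H).1 hH
    exact (hX K).2 (.comp hG' hH'
      ((sat_isComp_iff (v := cons K (cons H (cons G v))) (G := .var 2) (H := .var 1) (K := .var 0)
        (hA.isGraph_closure hG') (hA.isGraph_closure hH')).1 hK))
  · rintro h X ⟨h₁, h₂⟩
    change Model.mem (G.eval v) X
    generalize G.eval v = G at h
    induction h with
    | base h => exact h₁ _ h
    | @comp G H K hG hH hK ihG ihH =>
      exact h₂ G H K ⟨ihG, ihH, (sat_isComp_iff (v := cons K (cons H (cons G v))) (G := .var 2)
        (H := .var 1) (K := .var 0) (hA.isGraph_closure hG) (hA.isGraph_closure hH)).2 hK⟩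

/-- The set `X` is the graph of a function. -/
def IsFunction (X : Model.Sets N) : Prop :=
  (∀ z, Model.mem z X → ∃ x y, z = pr x y) ∧ (∀ x, ∃ y, Model.mem (pr x y) X) ∧
    ∀ x y y', Model.mem (pr x y) X ∧ Model.mem (pr x y') X → y = y'

theorem sat_isFunction {F : ℕ} : (isFunction F).Sat Model.mem v w ↔ IsFunction (w F) := by
  simp only [isFunction, sat_ex, sat_and, sat_eq, sat_all, sat_imp, sat_mem, eval_pair]
  rfl

theorem IsFunction.exists_rec {X : Model.Sets N} (h : IsFunction X) :
    ∃ f : N → N, Rec f ∧ ∀ x y, Model.mem (pr x y) X ↔ y = f x := by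
  choose f hf using h.2.1
  have hX : ∀ x y, Model.mem (pr x y) X ↔ y = f x := fun x y =>
    ⟨fun hy => h.2.2 x y _ ⟨hy, hf x⟩, by rintro rfl; exact hf x⟩
  exact ⟨f, ⟨X, hX⟩, hX⟩

theorem Rec.exists_isFunction {f : N → N} (hf : Rec f) :
    ∃ X : Model.Sets N, IsFunction X ∧ ∀ x y, Model.mem (SOA.pr x y) X ↔ y = f x := by
  have := hf.dec_eq
  obtain ⟨X, hX⟩ := (inferInstance : Dec fun z =>
    z = SOA.pr (SOA.fst z) (SOA.snd z) ∧ SOA.snd z = f (SOA.fst z)).out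
  have hX' : ∀ x y, Model.mem (SOA.pr x y) X ↔ y = f x := fun x y => by simp [hX]
  refine ⟨X, ⟨fun z hz => ⟨_, _, ((hX z).1 hz).1⟩, fun x => ⟨_, (hX' x _).2 rfl⟩, ?_⟩, hX'⟩
  rintro x y y' ⟨h, h'⟩
  rw [(hX' _ _).1 h, (hX' _ _).1 h']

theorem sat_isMultipath {S M : ℕ} : (isMultipath S M).Sat Model.mem v w ↔ IsFunction (w M) ∧
    (∀ s G, Model.mem (pr s G) (w M) → Model.mem G (w S)) ∧
    ∀ s G H, Model.mem (pr s G) (w M) ∧ Model.mem (pr (s + 1) H) (w M) →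
      ∃ f g h, HasType G f g ∧ HasType H g h := by
  simp only [isMultipath, sat_isFunction, sat_and, sat_all, sat_imp, sat_mem, sat_composable,
    eval_pair]
  rfl

theorem sat_hasDescent {M : ℕ} : (hasDescent M).Sat Model.mem v w ↔ ∃ (t : N) (X : Model.Sets N),
    IsFunction X ∧
    (∀ s x y G, Model.mem (pr s x) X ∧ Model.mem (pr (s + 1) y) X ∧
      Model.mem (pr (t + s) G) (w M) → Arc G x 0 y ∨ Arc G x 1 y) ∧
    ∀ n, ∃ s x y G, n < s ∧ Model.mem (pr s x) X ∧ Model.mem (pr (s + 1) y) X ∧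
      Model.mem (pr (t + s) G) (w M) ∧ Arc G x 1 y := by
  simp only [hasDescent, sat_ex, sat_exS, sat_isFunction, sat_and, sat_all, sat_imp, sat_mem,
    sat_or, sat_lt, sat_arc, eval_pair]
  rfl

theorem sat_hasDescent_iff {M : ℕ} {f : N → N} (hf : ∀ x y, Model.mem (pr x y) (w M) ↔ y = f x) :
    (hasDescent M).Sat Model.mem v w ↔ HasDescent f := by
  rw [sat_hasDescent]
  simp only [hf]
  constructor
  · rintro ⟨t, X, hX, h₁, h₂⟩
    obtain ⟨H, hH, hXH⟩ := hX.exists_rec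
    simp only [hXH] at h₁ h₂
    refine ⟨t, H, hH, fun s => h₁ s _ _ _ ⟨rfl, rfl, rfl⟩, fun n => ?_⟩
    obtain ⟨s, _, _, _, hs, rfl, rfl, rfl, h⟩ := h₂ n
    exact ⟨s, hs, h⟩
  · rintro ⟨t, H, hH, h₁, h₂⟩
    obtain ⟨X, hX, hXH⟩ := hH.exists_isFunction
    refine ⟨t, X, hX, ?_, fun n => ?_⟩
    · simp only [hXH]
      rintro s _ _ _ ⟨rfl, rfl, rfl⟩
      exact h₁ s
    · obtain ⟨s, hs, h⟩ := h₂ n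
      exact ⟨s, _, _, _, hs, (hXH _ _).2 rfl, (hXH _ _).2 rfl, rfl, h⟩

theorem sat_isSCT {S : ℕ} (hA : ∀ G, Model.mem G (w S) → IsGraph G) :
    (isSCT S).Sat Model.mem v w ↔ IsSCT fun g => Model.mem g (w S) := by
  simp only [isSCT, sat_allS, sat_imp, sat_isMultipath]
  constructor
  · intro h M hM hMA hMc
    obtain ⟨X, hX, hXM⟩ := hM.exists_isFunction
    refine (sat_hasDescent_iff (w := cons X w) (M := 0) hXM).1 (h X ⟨hX, ?_, ?_⟩)
    · intro s G hG
      rw [(hXM _ _).1 hG]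
      exact hMA s
    · rintro s G H ⟨hG, hH⟩
      rw [(hXM _ _).1 hG, (hXM _ _).1 hH]
      exact ⟨_, _, _, (hA _ (hMA s)).hasType_iff.2 ⟨rfl, rfl⟩,
        (hA _ (hMA (s + 1))).hasType_iff.2 ⟨(hMc s).symm, rfl⟩⟩
  · rintro h X ⟨hX, h₁, h₂⟩
    obtain ⟨M, hM, hXM⟩ := hX.exists_rec
    have hMA : ∀ s, Model.mem (M s) (w S) := fun s => h₁ s _ ((hXM _ _).2 rfl)
    refine (sat_hasDescent_iff (w := cons X w) (M := 0) hXM).2 (h M hM hMA fun s => ?_)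
    obtain ⟨f, g, k, hG, hH⟩ := h₂ s _ _ ⟨(hXM _ _).2 rfl, (hXM _ _).2 rfl⟩
    rw [(hA _ (hMA s)).hasType_iff] at hG
    rw [(hA _ (hMA (s + 1))).hasType_iff] at hH
    exact hG.2.trans hH.1.symm

theorem sat_idempotentsHaveStrictLoop {S n : ℕ}
    (hA : IsGraphSet (fun g => Model.mem g (w S)) n) :
    (idempotentsHaveStrictLoop S).Sat Model.mem v w ↔
      ∀ G, Closure (fun g => Model.mem g (w S)) G → IsComp G G G → ∃ x, Arc G x 1 x := by
  simp only [idempotentsHaveStrictLoop, sat_all, sat_imp, sat_and, sat_inClosure hA, sat_ex,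
    sat_arc]
  refine forall_congr' fun G => ?_
  constructor
  · exact fun h hG hGG => h ⟨hG, (sat_isComp_iff (v := cons G v) (G := .var 0) (H := .var 0)
      (K := .var 0) (hA.isGraph_closure hG) (hA.isGraph_closure hG)).2 hGG⟩
  · rintro h ⟨hG, hGG⟩
    exact h hG ((sat_isComp_iff (v := cons G v) (G := .var 0) (H := .var 0)
      (K := .var 0) (hA.isGraph_closure hG) (hA.isGraph_closure hG)).1 hGG)

theorem sat_cardLE {S : ℕ} {k : Tm} : (cardLE S k).Sat Model.mem v w ↔ ∃ X : Model.Sets N,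
    (∀ G, Model.mem G (w S) → ∃ i, i < k.eval v ∧ Model.mem (pr G i) X) ∧
    ∀ G H i, Model.mem (pr G i) X ∧ Model.mem (pr H i) X → G = H := by
  simp only [cardLE, sat_exS, sat_and, sat_all, sat_imp, sat_mem, sat_ex, sat_lt, sat_eq,
    Tm.eval_up, eval_pair]
  rfl

theorem sat_aritiesLE {S : ℕ} {n : Tm} : (aritiesLE S n).Sat Model.mem v w ↔
    ∀ G p a q b, Model.mem G (w S) ∧ HasType G (pr p a) (pr q b) →
      a < n.eval v + 1 ∧ b < n.eval v + 1 := by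
  simp only [aritiesLE, sat_all, sat_imp, sat_and, sat_mem, sat_hasType, sat_lt, eval_add,
    Tm.eval_up, eval_pair]
  rfl

theorem sat_sctCriterion (k n : ℕ) (v : ℕ → N) (w : ℕ → Model.Sets N) :
    (sctCriterion (Tm.num k) (Tm.num n)).Sat Model.mem v w := by
  simp only [sctCriterion, sat_allS, sat_imp, sat_and, sat_all, sat_mem, sat_isGraph, sat_cardLE,
    sat_aritiesLE, sat_iff, eval_num]
  rintro S ⟨hgraph, ⟨X, hX₁, hX₂⟩, har⟩
  have hA : IsGraphSet (fun g => Model.mem g (cons S w 0)) n := by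
    refine ⟨?_, fun {G} hG => hgraph G hG, fun {G} hG => ?_, fun {G} hG => ?_⟩
    -- An injection into the numbers below a standard `k` makes the set finite in the metatheory.
    · choose! i hi hiX using hX₁
      exact Set.Finite.of_injOn (f := i) (t := {x : N | x < k}) (fun G hG => hi G hG)
        (fun G hG H hH h => hX₂ G H (i G) ⟨hiX G hG, h ▸ hiX H hH⟩) (finite_lt_natCast k)
    · have h := hgraph G hG
      exact (har G (fst (src G)) (snd (src G)) (fst (tgt G)) (snd (tgt G))
        ⟨hG, h.hasType_iff.2 ⟨h.src_eq, h.tgt_eq⟩⟩).1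
    · have h := hgraph G hG
      exact (har G (fst (src G)) (snd (src G)) (fst (tgt G)) (snd (tgt G))
        ⟨hG, h.hasType_iff.2 ⟨h.src_eq, h.tgt_eq⟩⟩).2
  rw [sat_isSCT fun G hG => hA.isGraph hG, sat_idempotentsHaveStrictLoop hA]
  exact ⟨fun h G hG hGG => strict_loop_of_isSCT hA h hG hGG, isSCT_of_strict_loops hA⟩

end Meaning

/-- The required nonemptiness of the set sort is free: an assignment `w` already supplies the set `w
0`. -/
theorem proves_of_forall_model {φ : Fm}
    (h : ∀ (N : Type) [Model N] (v : ℕ → N) (w : ℕ → Model.Sets N), φ.Sat Model.mem v w) :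
    Proves RCA0 φ :=
  proves_of_forall_sat fun N _ _ _ _ _ _ _ hT v w =>
    letI := (satisfiesRCA0 (hS := ⟨w 0⟩) hT).toModel
    h N v w

end SOA

theorem mainTheorem5 :
    (∀ k : ℕ, SOA.Proves SOA.RCA0 (SOA.triangleRamsey (SOA.Tm.num k))) ∧
    (∀ k n : ℕ, SOA.Proves SOA.RCA0 (SOA.sctCriterion (SOA.Tm.num k) (SOA.Tm.num n))) :=
  ⟨fun k => SOA.proves_of_forall_model fun _ _ v w => SOA.sat_triangleRamsey k v w,
    fun k n => SOA.proves_of_forall_model fun _ _ v w => SOA.sat_sctCriterion k n v w⟩
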